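/- Let $P\subset\mathbb R^d$ be a $d$-dimensional (convex, compact) polytope, i.e. a compact convex set with non-empty interior that is the intersection of finitely many closed half-spaces. Here $P$ itself counts as its own $d$-face, $P_{(k)}$ denotes the $k$-skeleton of $P$ (the union of all its $k$-faces), $\mathrm{vol}_k$ denotes $k$-dimensional volume (the number of points for $k=0$), and $W_P(r)=\mathrm{vol}_d(P(r))$, where $P(r)=\{Q\in P : \mathrm d(Q,\partial P)\ge r\}$. Call $P$ dimension-wise equiangular with outer dihedral angles $\alpha_2,\dots,\alpha_d\in(0,\pi)$ if for every $2\le k\le d$, every $k$-face $F$ of $P$, and any two different facets of $F$ that meet along a common $(k-2)$-face of $F$, the inner unit normals $N,N'$ of these facets (taken inside the affine hull of $F$) satisfy $\langle N,N'\rangle=\cos\alpha_k$. In that case put $\gamma_k=\tan\frac{\alpha_{k+1}}2\tan\frac{\alpha_{k+2}}2\cdots\tan\frac{\alpha_d}2$ for $1\le k\le d$, so that $\gamma_d=1$. (1) Suppose $P$ is dimension-wise equiangular with outer dihedral angles $\alpha_2,\dots,\alpha_d$ and that for every $1\le k\le d$ the number of $k$-faces of $P$ containing any given $(k-1)$-face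 of $P$ is exactly $\mu_{(k)}$. Then there is $\varepsilon>0$ such that for all $r\in[0,\varepsilon]$ the function $W_P$ is given by the polynomial $$W_P(r)=\sum_{k=0}^d(-1)^{d-k}\,\mu_{(k+1)}\mu_{(k+2)}\cdots\mu_{(d)}\,\mathrm{vol}_k(P_{(k)})\,\gamma_{k+1}\gamma_{k+2}\cdots\gamma_d\,\frac{r^{d-k}}{(d-k)!}.$$ (2) Suppose $P$ is regular, i.e. the group of Euclidean isometries mapping $P$ onto itself acts transitively on the flags $F_0\subset F_1\subset\dots\subset F_{d-1}$ of $P$ ($F_i$ an $i$-face). Then $P$ is dimension-wise equiangular, numbers $\mu_{(k)}$ as in (1) exist, and with the inradius $g$ of $P$ (the largest radius of a ball contained in $P$), for all $0\le k\le d-1$, $$d!\,\mathrm{vol}_d(P_{(d)})=k!\,\mu_{(k+1)}\mu_{(k+2)}\cdots\mu_{(d)}\,\mathrm{vol}_k(P_{(k)})\,\gamma_{k+1}\gamma_{k+2}\cdots\gamma_d\,g^{d-k}.$$ -/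

import Mathlib

open scoped MeasureTheory

namespace EuclPolytope

variable {d : ℕ}

/-- A `d`-dimensional polytope: a convex body (compact, convex, with non-empty interior) that is
the intersection of finitely many closed half-spaces `{x | b ≤ ⟪a, x⟫}`, `a ≠ 0`. -/
def IsPolytope (P : Set (EuclideanSpace ℝ (Fin d))) : Prop :=
  IsCompact P ∧ Convex ℝ P ∧ (interior P).Nonempty ∧
    ∃ s : Finset (EuclideanSpace ℝ (Fin d) × ℝ),
      (∀ h ∈ s, h.1 ≠ 0) ∧ P = {x | ∀ h ∈ s, h.2 ≤ inner ℝ h.1 x}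

/-- `F` is a `k`-face of `P`: a non-empty set of all maximizers on `P` of some linear functional
(the zero functional gives `P` itself), whose affine hull has dimension `k`. -/
def IsFace (P : Set (EuclideanSpace ℝ (Fin d))) (k : ℕ)
    (F : Set (EuclideanSpace ℝ (Fin d))) : Prop :=
  F.Nonempty ∧ IsExposed ℝ P F ∧ Module.finrank ℝ (vectorSpan ℝ F) = k

/-- `N` is an inner unit normal vector of the facet `G` of `F`, relative to the affine hull
of `F`. -/
def IsInnerUnitNormal (F G : Set (EuclideanSpace ℝ (Fin d)))
    (N : EuclideanSpace ℝ (Fin d)) : Prop :=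
  N ∈ vectorSpan ℝ F ∧ ‖N‖ = 1 ∧
    (∀ x ∈ G, ∀ y ∈ G, inner ℝ N (y - x) = 0) ∧
    (∀ x ∈ G, ∀ y ∈ F, 0 ≤ inner ℝ N (y - x))

/-- The `k`-dimensional polytope `F` (`2 ≤ k`, lying in its affine hull) is equiangular with outer
dihedral angle `a`: inner unit normals of any two different facets of `F` meeting along a common
ridge enclose the angle `a`. -/
def IsEquiangular (k : ℕ) (F : Set (EuclideanSpace ℝ (Fin d))) (a : ℝ) : Prop :=
  ∀ G₁ G₂ : Set (EuclideanSpace ℝ (Fin d)),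
    IsFace F (k - 1) G₁ → IsFace F (k - 1) G₂ → G₁ ≠ G₂ → IsFace F (k - 2) (G₁ ∩ G₂) →
    ∀ N₁ N₂ : EuclideanSpace ℝ (Fin d),
      IsInnerUnitNormal F G₁ N₁ → IsInnerUnitNormal F G₂ N₂ → inner ℝ N₁ N₂ = Real.cos a

/-- `P` is dimension-wise equiangular with outer dihedral angles `α 2, …, α d`. -/
def IsDimensionwiseEquiangular (P : Set (EuclideanSpace ℝ (Fin d))) (α : ℕ → ℝ) : Prop :=
  ∀ k : ℕ, 2 ≤ k → k ≤ d → α k ∈ Set.Ioo 0 Real.pi ∧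
    ∀ F : Set (EuclideanSpace ℝ (Fin d)), IsFace P k F → IsEquiangular k F (α k)

/-- For every `1 ≤ k ≤ d`, exactly `μ k` of the `k`-faces of `P` meet at any `(k-1)`-face. -/
def HasConstantIncidence (P : Set (EuclideanSpace ℝ (Fin d))) (μ : ℕ → ℕ) : Prop :=
  ∀ k : ℕ, 1 ≤ k → k ≤ d → ∀ G : Set (EuclideanSpace ℝ (Fin d)), IsFace P (k - 1) G →
    {F : Set (EuclideanSpace ℝ (Fin d)) | IsFace P k F ∧ G ⊆ F}.encard = (μ k : ℕ∞)

/-- A flag of `P`: an increasing tuple `(F₀, …, F_{d-1})` where `Fᵢ` is an `i`-face of `P`. -/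
def IsFlag (P : Set (EuclideanSpace ℝ (Fin d)))
    (Φ : Fin d → Set (EuclideanSpace ℝ (Fin d))) : Prop :=
  (∀ i : Fin d, IsFace P (i : ℕ) (Φ i)) ∧ Monotone Φ

/-- `P` is regular: the Euclidean isometries mapping `P` onto itself act transitively on the
flags of `P`. -/
def IsRegular (P : Set (EuclideanSpace ℝ (Fin d))) : Prop :=
  ∀ Φ Ψ : Fin d → Set (EuclideanSpace ℝ (Fin d)), IsFlag P Φ → IsFlag P Ψ →
    ∃ f : EuclideanSpace ℝ (Fin d) ≃ᵃⁱ[ℝ] EuclideanSpace ℝ (Fin d),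
      f '' P = P ∧ ∀ i : Fin d, f '' Φ i = Ψ i

/-- The `r`-interior `P(r)`: the points of `P` at distance at least `r` from the boundary.
(The distance to the empty set is `∞`.) -/
def rInterior (P : Set (EuclideanSpace ℝ (Fin d))) (r : ℝ) : Set (EuclideanSpace ℝ (Fin d)) :=
  {Q ∈ P | ENNReal.ofReal r ≤ Metric.infEDist Q (frontier P)}

/-- The volume function `W_P(r)`, the `d`-dimensional volume of `P(r)`. -/
noncomputable def W (P : Set (EuclideanSpace ℝ (Fin d))) (r : ℝ) : ℝ :=
  (MeasureTheory.volume (rInterior P r)).toReal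

/-- The `k`-skeleton `P_(k)`: the union of all `k`-faces. -/
def skeleton (P : Set (EuclideanSpace ℝ (Fin d))) (k : ℕ) : Set (EuclideanSpace ℝ (Fin d)) :=
  ⋃ F ∈ {F : Set (EuclideanSpace ℝ (Fin d)) | IsFace P k F}, F

/-- `k`-dimensional volume: the `k`-dimensional Hausdorff measure, normalized so that it is
Lebesgue measure on `k`-dimensional flats (and the counting measure for `k = 0`). -/
noncomputable def vol (k : ℕ) (S : Set (EuclideanSpace ℝ (Fin d))) : ℝ :=
  (μHE[k] S).toReal

/-- The inradius: the largest radius of a ball contained in `P`. -/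
noncomputable def inradius (P : Set (EuclideanSpace ℝ (Fin d))) : ℝ :=
  sSup {g : ℝ | 0 < g ∧ ∃ c, Metric.closedBall c g ⊆ P}

/-- `γ_k = tan(α_{k+1}/2) ⋯ tan(α_d/2)`, so `γ_d = 1`. -/
noncomputable def gam (d : ℕ) (α : ℕ → ℝ) (k : ℕ) : ℝ :=
  ∏ j ∈ Finset.Ioc k d, Real.tan (α j / 2)

end EuclPolytope

open scoped MeasureTheory

namespace EuclPolytope

open MeasureTheory

-- Move all facet hyperplanes of `P` inwards at unit speed. What remains is `P(r)`, and the
-- derivative of its volume is minus the total volume of its facets. Equiangularity makes this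
-- recursive. At a ridge with outer angle `α` the normals satisfy `n' = cos α • n + sin α • ν`,
-- where `ν` is the inner normal of the ridge inside the facet of `n`. After a displacement by `r`,
-- the hyperplane of `n'` therefore cuts that of `n` at distance `tan (α/2) * r` from the shifted
-- ridge. So each facet of `P(r)` should be a translate of the inner parallel body of the original
-- facet at parameter `tan (α/2) * r`, and integrating the volume polynomials of the facets gives
-- that of `P` (`eventually_volume_par`). Faces are counted there once per chain leading up to `P`;
-- constant incidence turns the count into the products of the `μ`.
--
-- The delicate point is that a slice of `P(r)` is the whole parallel body of the facet, although
-- facets not adjacent to it along a ridge also impose constraints. This is settled at the vertices: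
-- each vertex `v` has a centre `c` with `⟪n, c⟫ = 1` for every facet normal `n` at `v`, however
-- many facets meet there (`exists_isCenter`). The centre is `n + tan (α/2) • c'`, with `c'` the
-- centre of `v` in the facet of `n`. It does not depend on the facet, because `n + tan (α/2) • ν =
-- (n + n') / (1 + cos α)` is symmetric across a ridge and the facets at `v` are connected through
-- ridges (`facets_connected`). For small `r` the parallel body is then the convex hull of the
-- points `v + r • c`, and the slices are as expected (`eventually_slice`).
--
-- If `P` is regular, nested faces extend to flags, so flag transitivity makes angles and incidence
-- numbers constant. The centroid of the vertices is fixed by all symmetries, hence has the same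
-- distance `g` from all facets. So `P(r)` is homothetic to `P`, giving `W P r = (1 - r/g)^d * W P
-- 0`, and comparing coefficients with the general polynomial gives the identities.

local notation "𝔼[" n "]" => EuclideanSpace ℝ (Fin n)

variable {d : ℕ}

/-! ### Irredundant half-space representations -/

/-- An irredundant representation of `G` by half-spaces of the affine subspace through `p` with
direction `V`: the inner unit normals form `s`, the point `p` is a relative interior point, and
each facet has a point that lies on no other facet. -/
structure IsRep (G : Set 𝔼[d]) (V : Submodule ℝ 𝔼[d]) (p : 𝔼[d]) (s : Finset 𝔼[d])
    (b : 𝔼[d] → ℝ) : Prop where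
  mem_iff : ∀ x, x ∈ G ↔ x - p ∈ V ∧ ∀ n ∈ s, b n ≤ inner ℝ n x
  lt : ∀ n ∈ s, b n < inner ℝ n p
  mem_dir : ∀ n ∈ s, n ∈ V
  norm_eq : ∀ n ∈ s, ‖n‖ = 1
  sharp : ∀ n ∈ s, ∃ x ∈ G, inner ℝ n x = b n ∧ ∀ n' ∈ s, n' ≠ n → b n' < inner ℝ n' x

theorem inner_starProjection_sub {V : Submodule ℝ 𝔼[d]} (a : 𝔼[d]) {v : 𝔼[d]} (hv : v ∈ V) :
    inner ℝ (V.starProjection a) v = inner ℝ a v := by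
  rw [Submodule.inner_starProjection_left_eq_right, Submodule.starProjection_eq_self_iff.2 hv]

/-- On `p + V`, projecting a normal to `V` changes its functional only by a constant, which the
bound absorbs. A normal projecting to `0` imposes no condition, since `p` satisfies its inequality
strictly. -/
theorem exists_normalized_halfspaces {G : Set 𝔼[d]} {V : Submodule ℝ 𝔼[d]} {p : 𝔼[d]}
    (T : Finset (𝔼[d] × ℝ)) (hG : ∀ x, x ∈ G ↔ x - p ∈ V ∧ ∀ h ∈ T, h.2 ≤ inner ℝ h.1 x)
    (hlt : ∀ h ∈ T, h.2 < inner ℝ h.1 p) :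
    ∃ T' : Finset (𝔼[d] × ℝ), (∀ x, x ∈ G ↔ x - p ∈ V ∧ ∀ h ∈ T', h.2 ≤ inner ℝ h.1 x) ∧
      ∀ h ∈ T', h.2 < inner ℝ h.1 p ∧ h.1 ∈ V ∧ ‖h.1‖ = 1 := by
  classical
  let w : 𝔼[d] × ℝ → 𝔼[d] := fun h => V.starProjection h.1
  let f : 𝔼[d] × ℝ → 𝔼[d] × ℝ := fun h =>
    (‖w h‖⁻¹ • w h, ‖w h‖⁻¹ * (h.2 - inner ℝ h.1 p + inner ℝ (w h) p))
  have hw : ∀ h x, x - p ∈ V → inner ℝ (w h) x = inner ℝ h.1 x - inner ℝ h.1 p + inner ℝ (w h) p := by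
    intro h x hx
    have := inner_starProjection_sub h.1 hx
    rw [inner_sub_right, inner_sub_right] at this
    linarith
  refine ⟨(T.filter (fun h => w h ≠ 0)).image f, fun x => ?_, ?_⟩
  · rw [hG]
    refine and_congr_right fun hx => ?_
    simp only [Finset.mem_image, Finset.mem_filter]
    constructor
    · rintro h _ ⟨a, ⟨ha, ha0⟩, rfl⟩
      have h1 := h a ha
      have h2 := hw a x hx
      simp only [f, inner_smul_left, RCLike.conj_to_real]
      have : 0 ≤ ‖w a‖⁻¹ := by positivity
      exact mul_le_mul_of_nonneg_left (by linarith) this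
    · intro h a ha
      by_cases ha0 : w a = 0
      · have h2 := hw a x hx
        rw [ha0] at h2
        simp only [inner_zero_left] at h2
        linarith [hlt a ha]
      · have h1 := h (f a) ⟨a, ⟨ha, ha0⟩, rfl⟩
        have h2 := hw a x hx
        simp only [f, inner_smul_left, RCLike.conj_to_real] at h1
        have : 0 < ‖w a‖⁻¹ := by positivity
        have := le_of_mul_le_mul_left h1 this
        linarith
  · intro h hh
    simp only [Finset.mem_image, Finset.mem_filter] at hh
    obtain ⟨a, ⟨ha, ha0⟩, rfl⟩ := hh
    refine ⟨?_, V.smul_mem _ (V.starProjection_apply_mem _), ?_⟩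
    · have h1 := hlt a ha
      simp only [f, inner_smul_left, RCLike.conj_to_real]
      have : 0 < ‖w a‖⁻¹ := by positivity
      exact mul_lt_mul_of_pos_left (by linarith) this
    · simp only [f]
      rw [norm_smul, norm_inv, norm_norm, inv_mul_cancel₀ (norm_ne_zero_iff.2 ha0)]

/-- Irredundancy comes from a minimal family: dropping a half-space must let in a new point, and the
segment from `p` to that point contains the sharp point. -/
theorem exists_isRep {G : Set 𝔼[d]} {V : Submodule ℝ 𝔼[d]} {p : 𝔼[d]}
    (T : Finset (𝔼[d] × ℝ)) (hG : ∀ x, x ∈ G ↔ x - p ∈ V ∧ ∀ h ∈ T, h.2 ≤ inner ℝ h.1 x)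
    (hlt : ∀ h ∈ T, h.2 < inner ℝ h.1 p) : ∃ s b, IsRep G V p s b := by
  classical
  obtain ⟨T, hT⟩ := exists_minimal_of_wellFoundedLT _ (exists_normalized_halfspaces T hG hlt)
  obtain ⟨⟨hG, hT⟩, hmin⟩ := hT
  have hsharp : ∀ h ∈ T, ∃ x ∈ G, inner ℝ h.1 x = h.2 ∧
      ∀ h' ∈ T, h' ≠ h → h'.2 < inner ℝ h'.1 x := by
    intro h hh
    have hno : ¬ ∀ x, x ∈ G ↔ x - p ∈ V ∧ ∀ h' ∈ T.erase h, h'.2 ≤ inner ℝ h'.1 x := by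
      intro hc
      have := hmin ⟨hc, fun h' hh' => hT h' (Finset.mem_of_mem_erase hh')⟩ (Finset.erase_subset h T)
      exact Finset.notMem_erase h T (this hh)
    push Not at hno
    obtain ⟨y, hy⟩ := hno
    have hy' : y ∉ G ∧ y - p ∈ V ∧ ∀ h' ∈ T.erase h, h'.2 ≤ inner ℝ h'.1 y := by
      rcases hy with hy | hy
      · exfalso
        obtain ⟨hy1, hy2⟩ := hy
        obtain ⟨h', hh', hlt'⟩ := hy2 ((hG y).1 hy1).1
        exact absurd (((hG y).1 hy1).2 h' (Finset.mem_of_mem_erase hh')) (not_le.2 hlt')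
      · exact hy
    obtain ⟨hyG, hyV, hyT⟩ := hy'
    have hyh : inner ℝ h.1 y < h.2 := by
      by_contra hc
      refine hyG ((hG y).2 ⟨hyV, fun h' hh' => ?_⟩)
      by_cases he : h' = h
      · subst he; exact not_lt.1 hc
      · exact hyT h' (Finset.mem_erase.2 ⟨he, hh'⟩)
    have hph := (hT h hh).1
    -- The parameter at which the segment from `p` to `y` crosses the hyperplane of `h`. The other
    -- inequalities are strict there, being strict at `p` and `τ < 1`.
    set τ : ℝ := (inner ℝ h.1 p - h.2) / (inner ℝ h.1 p - inner ℝ h.1 y) with hτ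
    have hden : 0 < (inner ℝ h.1 p : ℝ) - inner ℝ h.1 y := by linarith
    have hτ0 : 0 < τ := div_pos (by linarith) hden
    have hτ1 : τ < 1 := (div_lt_one hden).2 (by linarith)
    have hz : ∀ a : 𝔼[d], (inner ℝ a (p + τ • (y - p)) : ℝ)
        = (1 - τ) * inner ℝ a p + τ * inner ℝ a y := by
      intro a
      rw [inner_add_right, inner_smul_right, inner_sub_right]; ring
    have hzh : (inner ℝ h.1 (p + τ • (y - p)) : ℝ) = h.2 := by
      rw [hz, hτ]; field_simp; ring
    have hzs : ∀ h' ∈ T, h' ≠ h → h'.2 < inner ℝ h'.1 (p + τ • (y - p)) := by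
      intro h' hh' hne
      rw [hz]
      have h1 := (hT h' hh').1
      have h2 := hyT h' (Finset.mem_erase.2 ⟨hne, hh'⟩)
      nlinarith
    refine ⟨p + τ • (y - p), (hG _).2 ⟨?_, fun h' hh' => ?_⟩, hzh, hzs⟩
    · rw [add_sub_cancel_left]; exact V.smul_mem _ hyV
    · by_cases he : h' = h
      · subst he; exact hzh.ge
      · exact (hzs h' hh' he).le
  -- Sharp points of two half-spaces with the same normal would make each bound smaller than the
  -- other. Hence the bound is a function of the normal.
  have hinj : ∀ h ∈ T, ∀ h' ∈ T, h.1 = h'.1 → h = h' := by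
    intro h hh h' hh' he
    by_contra hne
    obtain ⟨x, -, hx, hx'⟩ := hsharp h hh
    obtain ⟨y, -, hy, hy'⟩ := hsharp h' hh'
    have h1 := hx' h' hh' (Ne.symm hne)
    have h2 := hy' h hh hne
    rw [← he, hx] at h1
    rw [he, hy] at h2
    exact lt_asymm h1 h2
  have hb : ∀ n : 𝔼[d], ∃ c : ℝ, n ∈ T.image Prod.fst → (n, c) ∈ T := by
    intro n
    by_cases hn : n ∈ T.image Prod.fst
    · obtain ⟨h, hh, rfl⟩ := Finset.mem_image.1 hn
      exact ⟨h.2, fun _ => hh⟩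
    · exact ⟨0, fun h => absurd h hn⟩
  choose b hb using hb
  have hbT : ∀ h ∈ T, b h.1 = h.2 := by
    intro h hh
    have := hinj _ (hb h.1 (Finset.mem_image_of_mem _ hh)) h hh rfl
    exact congrArg Prod.snd this
  refine ⟨T.image Prod.fst, b, ?_, ?_, ?_, ?_, ?_⟩
  · intro x
    rw [hG]
    refine and_congr_right fun _ => ⟨fun h n hn => h _ (hb n hn), fun h h' hh' => ?_⟩
    rw [← hbT h' hh']
    exact h _ (Finset.mem_image_of_mem _ hh')
  · exact fun n hn => (hT _ (hb n hn)).1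
  · exact fun n hn => (hT _ (hb n hn)).2.1
  · exact fun n hn => (hT _ (hb n hn)).2.2
  · intro n hn
    obtain ⟨x, hxG, hx, hx'⟩ := hsharp _ (hb n hn)
    refine ⟨x, hxG, hx, fun n' hn' hne => hx' _ (hb n' hn') fun he => hne ?_⟩
    exact congrArg Prod.fst he

/-! ### Faces described by active constraints -/

/-- The smallest face of `G` containing `x`. -/
def faceAt (G : Set 𝔼[d]) (s : Finset 𝔼[d]) (b : 𝔼[d] → ℝ) (x : 𝔼[d]) : Set 𝔼[d] :=
  {y ∈ G | ∀ n ∈ s, inner ℝ n x = b n → inner ℝ n y = b n}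

/-- The direction of the smallest face containing `x`. -/
def dirAt (V : Submodule ℝ 𝔼[d]) (s : Finset 𝔼[d]) (b : 𝔼[d] → ℝ) (x : 𝔼[d]) :
    Submodule ℝ 𝔼[d] where
  carrier := {v | v ∈ V ∧ ∀ n ∈ s, inner ℝ n x = b n → inner ℝ n v = 0}
  add_mem' := fun hv hw => ⟨V.add_mem hv.1 hw.1, fun n hn hx => by
    rw [inner_add_right, hv.2 n hn hx, hw.2 n hn hx, add_zero]⟩
  zero_mem' := ⟨V.zero_mem, fun n _ _ => inner_zero_right n⟩
  smul_mem' := fun c v hv => ⟨V.smul_mem c hv.1, fun n hn hx => by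
    rw [inner_smul_right, hv.2 n hn hx, mul_zero]⟩

namespace IsRep

variable {G : Set 𝔼[d]} {V : Submodule ℝ 𝔼[d]} {p : 𝔼[d]} {s : Finset 𝔼[d]} {b : 𝔼[d] → ℝ}

theorem base_mem (h : IsRep G V p s b) : p ∈ G :=
  (h.mem_iff p).2 ⟨by simp, fun n hn => (h.lt n hn).le⟩

theorem le (h : IsRep G V p s b) {x n : 𝔼[d]} (hx : x ∈ G) (hn : n ∈ s) : b n ≤ inner ℝ n x :=
  ((h.mem_iff x).1 hx).2 n hn

theorem sub_mem (h : IsRep G V p s b) {x y : 𝔼[d]} (hx : x ∈ G) (hy : y ∈ G) : x - y ∈ V := by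
  have := V.sub_mem ((h.mem_iff x).1 hx).1 ((h.mem_iff y).1 hy).1
  simpa using this

theorem mem_iff_of_mem (h : IsRep G V p s b) {x : 𝔼[d]} (hx : x ∈ G) (y : 𝔼[d]) :
    y ∈ G ↔ y - x ∈ V ∧ ∀ n ∈ s, b n ≤ inner ℝ n y := by
  rw [h.mem_iff]
  refine and_congr_left fun _ => ⟨fun hy => ?_, fun hy => ?_⟩
  · have := V.sub_mem hy ((h.mem_iff x).1 hx).1
    simpa using this
  · have := V.add_mem hy ((h.mem_iff x).1 hx).1
    simpa using this

theorem convex (h : IsRep G V p s b) : Convex ℝ G := by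
  intro x hx y hy u w hu hw huw
  rw [h.mem_iff]
  constructor
  · have := V.add_mem (V.smul_mem u ((h.mem_iff x).1 hx).1) (V.smul_mem w ((h.mem_iff y).1 hy).1)
    have hp : u • (x - p) + w • (y - p) = u • x + w • y - p := by
      rw [smul_sub, smul_sub]
      have : p = u • p + w • p := by rw [← add_smul, huw, one_smul]
      nth_rw 3 [this]; abel
    rwa [hp] at this
  · intro n hn
    rw [inner_add_right, inner_smul_right, inner_smul_right]
    have h1 := mul_le_mul_of_nonneg_left (h.le hx hn) hu
    have h2 := mul_le_mul_of_nonneg_left (h.le hy hn) hw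
    have : b n = u * b n + w * b n := by rw [← add_mul, huw, one_mul]
    linarith

theorem isClosed (h : IsRep G V p s b) : IsClosed G := by
  have : G = (fun x => x - p) ⁻¹' (V : Set 𝔼[d]) ∩ ⋂ n ∈ s, {x | b n ≤ inner ℝ n x} := by
    ext x; simp [h.mem_iff]
  rw [this]
  refine (V.closed_of_finiteDimensional.preimage (by fun_prop)).inter ?_
  exact isClosed_biInter fun n _ => isClosed_le (by fun_prop) (by fun_prop)

/-- Moving a little from `x` in a direction that enters all active half-spaces. -/
theorem eventually_mem (h : IsRep G V p s b) {x v : 𝔼[d]} (hx : x ∈ G) (hv : v ∈ V)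
    (hact : ∀ n ∈ s, inner ℝ n x = b n → 0 ≤ (inner ℝ n v : ℝ)) :
    ∀ᶠ t : ℝ in nhdsWithin 0 (Set.Ioi 0), x + t • v ∈ G ∧
      ∀ n ∈ s, b n < inner ℝ n x → b n < inner ℝ n (x + t • v) := by
  have h1 : ∀ᶠ t : ℝ in nhdsWithin 0 (Set.Ioi 0), ∀ n ∈ s, b n < inner ℝ n x →
      b n < inner ℝ n (x + t • v) := by
    refine (Filter.eventually_all_finset s).2 fun n _ => ?_
    by_cases hn : b n < inner ℝ n x
    · have hc : Continuous fun t : ℝ => (inner ℝ n (x + t • v) : ℝ) := by fun_prop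
      have := hc.tendsto 0
      rw [zero_smul, add_zero] at this
      filter_upwards [(this.mono_left nhdsWithin_le_nhds).eventually (lt_mem_nhds hn)] with t ht
      exact fun _ => ht
    · exact Filter.Eventually.of_forall fun t h => absurd h hn
  filter_upwards [h1, self_mem_nhdsWithin] with t ht ht0
  refine ⟨(h.mem_iff_of_mem hx _).2 ⟨by simpa using V.smul_mem t hv, fun n hn => ?_⟩, ht⟩
  rcases (h.le hx hn).lt_or_eq with hlt | heq
  · exact (ht n hn hlt).le
  · rw [inner_add_right, inner_smul_right, heq]
    have := mul_nonneg (le_of_lt ht0) (hact n hn heq.symm)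
    linarith

theorem exists_pos_mem (h : IsRep G V p s b) {x v : 𝔼[d]} (hx : x ∈ G) (hv : v ∈ V)
    (hact : ∀ n ∈ s, inner ℝ n x = b n → 0 ≤ (inner ℝ n v : ℝ)) :
    ∃ t : ℝ, 0 < t ∧ x + t • v ∈ G ∧
      ∀ n ∈ s, b n < inner ℝ n x → b n < inner ℝ n (x + t • v) := by
  obtain ⟨t, ht, ht0⟩ := ((h.eventually_mem hx hv hact).and self_mem_nhdsWithin).exists
  exact ⟨t, ht0, ht⟩

theorem faceAt_base (h : IsRep G V p s b) : faceAt G s b p = G := by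
  ext y
  exact ⟨fun hy => hy.1, fun hy => ⟨hy, fun n hn he => absurd he (h.lt n hn).ne'⟩⟩

theorem dirAt_base (h : IsRep G V p s b) : dirAt V s b p = V := by
  ext y
  exact ⟨fun hy => hy.1, fun hy => ⟨hy, fun n hn he => absurd he (h.lt n hn).ne'⟩⟩

theorem vectorSpan_faceAt (h : IsRep G V p s b) {x : 𝔼[d]} (hx : x ∈ G) :
    vectorSpan ℝ (faceAt G s b x) = dirAt V s b x := by
  apply le_antisymm
  · rw [vectorSpan_def, Submodule.span_le]
    rintro _ ⟨y, hy, z, hz, rfl⟩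
    refine ⟨h.sub_mem hy.1 hz.1, fun n hn hxn => ?_⟩
    change inner ℝ n (y - z) = 0
    rw [inner_sub_right, hy.2 n hn hxn, hz.2 n hn hxn, sub_self]
  · intro v hv
    obtain ⟨t, ht, htG, -⟩ := h.exists_pos_mem hx hv.1 (fun n hn hxn => (hv.2 n hn hxn).ge)
    have h1 : x + t • v ∈ faceAt G s b x := ⟨htG, fun n hn hxn => by
      rw [inner_add_right, inner_smul_right, hv.2 n hn hxn, hxn]; ring⟩
    have h2 : x ∈ faceAt G s b x := ⟨hx, fun _ _ h => h⟩
    have h3 := vsub_mem_vectorSpan ℝ h1 h2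
    have : v = t⁻¹ • ((x + t • v) -ᵥ x) := by
      rw [vsub_eq_sub, add_sub_cancel_left, smul_smul, inv_mul_cancel₀ ht.ne', one_smul]
    rw [this]
    exact Submodule.smul_mem _ _ h3

theorem vectorSpan_eq (h : IsRep G V p s b) : vectorSpan ℝ G = V := by
  have := h.vectorSpan_faceAt h.base_mem
  rwa [h.faceAt_base, h.dirAt_base] at this

/-- The sum of the normals active at `x` attains its minimum on `G` exactly where each of them does.
-/
theorem isExposed_faceAt (h : IsRep G V p s b) {x : 𝔼[d]} (hx : x ∈ G) :
    IsExposed ℝ G (faceAt G s b x) := by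
  classical
  intro _
  refine ⟨-innerSL ℝ (∑ n ∈ s.filter (fun n => inner ℝ n x = b n), n), ?_⟩
  have hval : ∀ y, (-innerSL ℝ (∑ n ∈ s.filter (fun n => inner ℝ n x = b n), n)) y =
      -∑ n ∈ s.filter (fun n => inner ℝ n x = b n), inner ℝ n y := by
    intro y; simp
  ext y
  simp only [hval, neg_le_neg_iff]
  constructor
  · refine fun hy => ⟨hy.1, fun z hz => Finset.sum_le_sum fun n hn => ?_⟩
    rw [Finset.mem_filter] at hn
    rw [hy.2 n hn.1 hn.2]
    exact h.le hz hn.1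
  · refine fun hy => ⟨hy.1, fun n hn hxn => ?_⟩
    have h1 := hy.2 x hx
    have h2 : ∀ n ∈ s.filter (fun n => inner ℝ n x = b n), (inner ℝ n x : ℝ) ≤ inner ℝ n y := by
      intro n hn
      rw [Finset.mem_filter] at hn
      rw [hn.2]
      exact h.le hy.1 hn.1
    have h3 := (Finset.sum_eq_sum_iff_of_le h2).1 (le_antisymm (Finset.sum_le_sum h2) h1)
    rw [← h3 n (Finset.mem_filter.2 ⟨hn, hxn⟩), hxn]

/-- A point `x` of `F` with the fewest active normals works: if one of them were inactive at another
point of `F`, the midpoint would have fewer. Conversely, a segment from a point of the face of `x`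
to `x` can be prolonged within `G`, so extremality puts that point into `F`. -/
theorem exists_eq_faceAt (h : IsRep G V p s b) {F : Set 𝔼[d]} (hne : F.Nonempty)
    (hconv : Convex ℝ F) (hext : IsExtreme ℝ G F) : ∃ x ∈ F, F = faceAt G s b x := by
  classical
  obtain ⟨x, hxF, hmin⟩ : ∃ x ∈ F, ∀ y ∈ F, (s.filter (fun n => inner ℝ n x = b n)).card ≤
      (s.filter (fun n => inner ℝ n y = b n)).card :=
    ⟨_, Function.argminOn_mem (fun x => (s.filter (fun n => inner ℝ n x = b n)).card) F hne,
      fun y hy => Function.argminOn_le (fun x => (s.filter (fun n => inner ℝ n x = b n)).card)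
        F hy⟩
  have hxG := hext.subset hxF
  refine ⟨x, hxF, Set.Subset.antisymm (fun y hy => ⟨hext.subset hy, fun n hn hxn => ?_⟩) ?_⟩
  · by_contra hyn
    set z : 𝔼[d] := (1 / 2 : ℝ) • x + (1 / 2 : ℝ) • y
    have hz : z ∈ F := hconv hxF hy (by norm_num) (by norm_num) (by norm_num)
    have hlt : (s.filter (fun n => inner ℝ n z = b n)).card
        < (s.filter (fun n => inner ℝ n x = b n)).card := by
      apply Finset.card_lt_card
      have hzi : ∀ m ∈ s, inner ℝ m z = b m → inner ℝ m x = b m ∧ inner ℝ m y = b m := by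
        intro m hm hz
        simp only [z] at hz
        rw [inner_add_right, inner_smul_right, inner_smul_right] at hz
        have h1 := h.le hxG hm
        have h2 := h.le (hext.subset hy) hm
        constructor <;> linarith
      rw [Finset.ssubset_iff_of_subset]
      · refine ⟨n, Finset.mem_filter.2 ⟨hn, hxn⟩, fun hc => hyn ?_⟩
        exact (hzi n hn (Finset.mem_filter.1 hc).2).2
      · intro m hm
        rw [Finset.mem_filter] at hm ⊢
        exact ⟨hm.1, (hzi m hm.1 hm.2).1⟩
    exact absurd (hmin z hz) (not_le.2 hlt)
  · intro y hy
    obtain ⟨t, ht, htG, -⟩ := h.exists_pos_mem (v := x - y) hxG (h.sub_mem hxG hy.1)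
      (fun n hn hxn => by rw [inner_sub_right, hxn, hy.2 n hn hxn, sub_self])
    refine hext.left_mem_of_mem_openSegment hy.1 htG hxF ?_
    refine ⟨t / (1 + t), 1 / (1 + t), by positivity, by positivity, by field_simp; ring, ?_⟩
    have h1 : (1 + t) ≠ 0 := by positivity
    have : (t / (1 + t)) • y + (1 / (1 + t)) • (x + t • (x - y)) =
        (t / (1 + t) - t / (1 + t)) • y + (1 / (1 + t) + t / (1 + t)) • x := by
      module
    rw [this, sub_self, zero_smul, zero_add, ← add_div, div_self h1, one_smul]

theorem isFace_iff (h : IsRep G V p s b) {k : ℕ} {F : Set 𝔼[d]} :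
    IsFace G k F ↔ ∃ x ∈ G, F = faceAt G s b x ∧ Module.finrank ℝ (dirAt V s b x) = k := by
  constructor
  · rintro ⟨hne, hexp, hk⟩
    obtain ⟨x, hx, rfl⟩ := h.exists_eq_faceAt hne (hexp.convex h.convex) hexp.isExtreme
    refine ⟨x, hx.1, rfl, ?_⟩
    rwa [h.vectorSpan_faceAt hx.1] at hk
  · rintro ⟨x, hx, rfl, hk⟩
    refine ⟨⟨x, hx, fun _ _ h => h⟩, h.isExposed_faceAt hx, ?_⟩
    rwa [h.vectorSpan_faceAt hx]

theorem isFace_self (h : IsRep G V p s b) : IsFace G (Module.finrank ℝ V) G :=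
  ⟨⟨p, h.base_mem⟩, IsExposed.refl G, by rw [h.vectorSpan_eq]⟩

/-- A face of a face is a face. -/
theorem isFace_trans (h : IsRep G V p s b) {k l : ℕ} {F R : Set 𝔼[d]} (hF : IsFace G k F)
    (hR : IsFace F l R) : IsFace G l R := by
  obtain ⟨x, hx, rfl⟩ := h.exists_eq_faceAt hR.1
    (hR.2.1.convex (hF.2.1.convex h.convex)) (hF.2.1.isExtreme.trans hR.2.1.isExtreme)
  exact ⟨hR.1, h.isExposed_faceAt hx.1, hR.2.2⟩

theorem finite_faces (h : IsRep G V p s b) (k : ℕ) : {F : Set 𝔼[d] | IsFace G k F}.Finite := by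
  classical
  refine (s.powerset.finite_toSet.image
    (fun a => {y ∈ G | ∀ n ∈ a, inner ℝ n y = b n})).subset ?_
  intro F hF
  obtain ⟨x, -, rfl, -⟩ := h.isFace_iff.1 hF
  refine ⟨s.filter (fun n => inner ℝ n x = b n),
    Finset.mem_coe.2 (Finset.mem_powerset.2 (Finset.filter_subset _ _)), ?_⟩
  ext y
  simp [faceAt, Finset.mem_filter]

/-- The constraints inactive at `x` cut the face out of its affine hull and are strict at `x`. They
may be redundant there, so the list is pruned again. -/
theorem exists_isRep_face (h : IsRep G V p s b) {k : ℕ} {F : Set 𝔼[d]} (hF : IsFace G k F) :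
    ∃ p' s' b', IsRep F (vectorSpan ℝ F) p' s' b' := by
  classical
  obtain ⟨x, hx, rfl, -⟩ := h.isFace_iff.1 hF
  rw [h.vectorSpan_faceAt hx]
  refine ⟨x, exists_isRep ((s.filter (fun n => inner ℝ n x ≠ b n)).image (fun n => (n, b n)))
    (fun y => ?_) ?_⟩
  · simp only [Finset.mem_image, Finset.mem_filter]
    constructor
    · intro hy
      refine ⟨⟨h.sub_mem hy.1 hx, fun n hn hxn => ?_⟩, ?_⟩
      · rw [inner_sub_right, hxn, hy.2 n hn hxn, sub_self]
      · rintro _ ⟨n, ⟨hn, -⟩, rfl⟩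
        exact h.le hy.1 hn
    · rintro ⟨⟨hyV, hyn⟩, hyT⟩
      have hyx : ∀ n ∈ s, inner ℝ n x = b n → inner ℝ n y = b n := by
        intro n hn hxn
        have := hyn n hn hxn
        rw [inner_sub_right] at this
        linarith
      refine ⟨(h.mem_iff_of_mem hx y).2 ⟨hyV, fun n hn => ?_⟩, hyx⟩
      by_cases hxn : inner ℝ n x = b n
      · exact (hyx n hn hxn).ge
      · exact hyT _ ⟨n, ⟨hn, hxn⟩, rfl⟩
  · intro h' hh'
    simp only [Finset.mem_image, Finset.mem_filter] at hh'
    obtain ⟨n, ⟨hn, hxn⟩, rfl⟩ := hh'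
    exact lt_of_le_of_ne (h.le hx hn) (Ne.symm hxn)

end IsRep

/-! ### Facets, their normals, and ridges -/

/-- The points of `G` on the hyperplane with normal `n`. -/
def facet (G : Set 𝔼[d]) (b : 𝔼[d] → ℝ) (n : 𝔼[d]) : Set 𝔼[d] := {y ∈ G | inner ℝ n y = b n}

theorem finrank_inf_orthogonal_singleton {V : Submodule ℝ 𝔼[d]} {n : 𝔼[d]} (hn : n ∈ V) (h0 : n ≠ 0) :
    Module.finrank ℝ (V ⊓ (ℝ ∙ n)ᗮ : Submodule ℝ 𝔼[d]) + 1 = Module.finrank ℝ V := by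
  have := Submodule.finrank_add_inf_finrank_orthogonal
    ((Submodule.span_singleton_le_iff_mem n V).2 hn)
  rw [finrank_span_singleton h0, inf_comm] at this
  omega

theorem mem_inf_orthogonal_singleton {V : Submodule ℝ 𝔼[d]} {n v : 𝔼[d]} :
    v ∈ (V ⊓ (ℝ ∙ n)ᗮ : Submodule ℝ 𝔼[d]) ↔ v ∈ V ∧ inner ℝ n v = 0 := by
  rw [Submodule.mem_inf, Submodule.mem_orthogonal_singleton_iff_inner_right]

theorem vectorSpan_le_of_forall {F : Set 𝔼[d]} {W : Submodule ℝ 𝔼[d]}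
    (h : ∀ x ∈ F, ∀ y ∈ F, x - y ∈ W) : vectorSpan ℝ F ≤ W := by
  rw [vectorSpan_def, Submodule.span_le]
  rintro _ ⟨y, hy, z, hz, rfl⟩
  exact h y hy z hz

theorem inner_eq_zero_of_mem_vectorSpan {F : Set 𝔼[d]} {n v : 𝔼[d]}
    (h : ∀ x ∈ F, ∀ y ∈ F, inner ℝ n (y - x) = 0) (hv : v ∈ vectorSpan ℝ F) :
    inner ℝ n v = 0 := by
  have : vectorSpan ℝ F ≤ (ℝ ∙ n)ᗮ := vectorSpan_le_of_forall fun x hx y hy => by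
    rw [Submodule.mem_orthogonal_singleton_iff_inner_right]; exact h y hy x hx
  exact Submodule.mem_orthogonal_singleton_iff_inner_right.1 (this hv)

theorem IsInnerUnitNormal.inner_eq_zero {F R : Set 𝔼[d]} {N v : 𝔼[d]} (hN : IsInnerUnitNormal F R N)
    (hv : v ∈ vectorSpan ℝ R) : inner ℝ N v = 0 :=
  inner_eq_zero_of_mem_vectorSpan hN.2.2.1 hv

theorem IsInnerUnitNormal.ne_zero {F R : Set 𝔼[d]} {N : 𝔼[d]} (hN : IsInnerUnitNormal F R N) :
    N ≠ 0 := by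
  rintro rfl
  simpa using hN.2.1

theorem IsFace.subset {k : ℕ} {G F : Set 𝔼[d]} (h : IsFace G k F) : F ⊆ G := h.2.1.subset

/-- A face of `G` contained in a subset `F` is a face of `F`. -/
theorem IsFace.mono {k : ℕ} {G F R : Set 𝔼[d]} (h : IsFace G k R) (hFG : F ⊆ G) (hRF : R ⊆ F) :
    IsFace F k R :=
  ⟨h.1, h.2.1.mono hFG hRF, h.2.2⟩

/-- The direction of a facet is the orthogonal complement of its normal. -/
theorem IsInnerUnitNormal.vectorSpan_eq {m : ℕ} {F R : Set 𝔼[d]} {N : 𝔼[d]}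
    (hN : IsInnerUnitNormal F R N) (hR : IsFace F m R)
    (hF : Module.finrank ℝ (vectorSpan ℝ F) = m + 1) :
    vectorSpan ℝ R = vectorSpan ℝ F ⊓ (ℝ ∙ N)ᗮ := by
  apply Submodule.eq_of_le_of_finrank_eq
  · exact le_inf (vectorSpan_mono ℝ hR.subset) fun v hv =>
      Submodule.mem_orthogonal_singleton_iff_inner_right.2 (hN.inner_eq_zero hv)
  · have := finrank_inf_orthogonal_singleton hN.1 hN.ne_zero
    rw [hR.2.2]; omega

namespace IsRep

variable {G : Set 𝔼[d]} {V : Submodule ℝ 𝔼[d]} {p : 𝔼[d]} {s : Finset 𝔼[d]} {b : 𝔼[d] → ℝ}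

theorem ne_zero (h : IsRep G V p s b) {n : 𝔼[d]} (hn : n ∈ s) : n ≠ 0 := by
  rintro rfl
  simpa using h.norm_eq _ hn

/-- The dimensions force the two directions to coincide, so a constraint active on `F` is constant
along `F'`. -/
theorem eq_of_subset (h : IsRep G V p s b) {k l : ℕ} {F F' : Set 𝔼[d]} (hF : IsFace G k F)
    (hF' : IsFace G l F') (hsub : F ⊆ F') (hle : l ≤ k) : F = F' := by
  obtain ⟨x, hx, rfl, hk⟩ := h.isFace_iff.1 hF
  refine hsub.antisymm fun y hy => ⟨hF'.subset hy, fun n hn hxn => ?_⟩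
  have h1 : vectorSpan ℝ (faceAt G s b x) = vectorSpan ℝ F' := by
    apply Submodule.eq_of_le_of_finrank_le (vectorSpan_mono ℝ hsub)
    rw [hF.2.2, hF'.2.2]; exact hle
  have h2 : y - x ∈ vectorSpan ℝ F' := vsub_mem_vectorSpan ℝ hy (hsub ⟨hx, fun _ _ h => h⟩)
  rw [← h1, h.vectorSpan_faceAt hx] at h2
  have := h2.2 n hn hxn
  rw [inner_sub_right] at this
  linarith

theorem facet_eq_faceAt (h : IsRep G V p s b) {n : 𝔼[d]} (hn : n ∈ s) :
    ∃ x ∈ G, facet G b n = faceAt G s b x ∧ dirAt V s b x = V ⊓ (ℝ ∙ n)ᗮ := by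
  obtain ⟨x, hx, hxn, hx'⟩ := h.sharp n hn
  have hact : ∀ n' ∈ s, inner ℝ n' x = b n' → n' = n := by
    intro n' hn' he
    by_contra hne
    exact absurd he (hx' n' hn' hne).ne'
  refine ⟨x, hx, ?_, ?_⟩
  · ext y
    refine and_congr_right fun _ => ⟨fun hy n' hn' he => ?_, fun hy => hy n hn hxn⟩
    rw [hact n' hn' he]; exact hy
  · ext v
    rw [mem_inf_orthogonal_singleton]
    refine and_congr_right fun _ => ⟨fun hy => hy n hn hxn, fun hy n' hn' he => ?_⟩
    rw [hact n' hn' he]; exact hy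

theorem vectorSpan_facet (h : IsRep G V p s b) {n : 𝔼[d]} (hn : n ∈ s) :
    vectorSpan ℝ (facet G b n) = V ⊓ (ℝ ∙ n)ᗮ := by
  obtain ⟨x, hx, h1, h2⟩ := h.facet_eq_faceAt hn
  rw [h1, h.vectorSpan_faceAt hx, h2]

theorem finrank_facet (h : IsRep G V p s b) {n : 𝔼[d]} (hn : n ∈ s) :
    Module.finrank ℝ (vectorSpan ℝ (facet G b n)) + 1 = Module.finrank ℝ V := by
  rw [h.vectorSpan_facet hn, finrank_inf_orthogonal_singleton (h.mem_dir n hn) (h.ne_zero hn)]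

theorem isFace_facet (h : IsRep G V p s b) {n : 𝔼[d]} (hn : n ∈ s) {m : ℕ}
    (hm : Module.finrank ℝ V = m + 1) : IsFace G m (facet G b n) := by
  have hf := h.finrank_facet hn
  obtain ⟨x, hx, h1, h2⟩ := h.facet_eq_faceAt hn
  rw [h1]
  refine h.isFace_iff.2 ⟨x, hx, rfl, ?_⟩
  rw [← h.vectorSpan_faceAt hx, ← h1]; omega

theorem exists_eq_facet (h : IsRep G V p s b) {m : ℕ} (hm : Module.finrank ℝ V = m + 1)
    {F : Set 𝔼[d]} (hF : IsFace G m F) : ∃ n ∈ s, F = facet G b n := by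
  obtain ⟨x, hx, rfl, hk⟩ := h.isFace_iff.1 hF
  by_cases hact : ∃ n ∈ s, inner ℝ n x = b n
  · obtain ⟨n, hn, hxn⟩ := hact
    exact ⟨n, hn, h.eq_of_subset hF (h.isFace_facet hn hm)
      (fun y hy => ⟨hy.1, hy.2 n hn hxn⟩) le_rfl⟩
  · exfalso
    push Not at hact
    have : dirAt V s b x = V := by
      ext v
      exact ⟨fun hv => hv.1, fun hv => ⟨hv, fun n hn he => absurd he (hact n hn)⟩⟩
    rw [this] at hk
    omega

/-- A proper face is contained in a facet. -/
theorem exists_subset_facet (h : IsRep G V p s b) {k : ℕ}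
    {F : Set 𝔼[d]} (hF : IsFace G k F) (hne : F ≠ G) : ∃ n ∈ s, F ⊆ facet G b n := by
  obtain ⟨x, hx, rfl, hk⟩ := h.isFace_iff.1 hF
  by_contra hc
  push Not at hc
  refine hne (Set.Subset.antisymm (fun y hy => hy.1) fun y hy => ⟨hy, fun n hn hxn => ?_⟩)
  exact absurd (fun z hz => ⟨hz.1, hz.2 n hn hxn⟩) (hc n hn)

theorem facet_injOn (h : IsRep G V p s b) {n n' : 𝔼[d]} (hn : n ∈ s) (hn' : n' ∈ s)
    (he : facet G b n = facet G b n') : n = n' := by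
  by_contra hne
  obtain ⟨x, hx, hxn, hx'⟩ := h.sharp n hn
  have : x ∈ facet G b n' := he ▸ ⟨hx, hxn⟩
  exact absurd this.2 (hx' n' hn' (Ne.symm hne)).ne'

theorem isInnerUnitNormal_facet (h : IsRep G V p s b) {n : 𝔼[d]} (hn : n ∈ s) :
    IsInnerUnitNormal G (facet G b n) n := by
  refine ⟨by rw [h.vectorSpan_eq]; exact h.mem_dir n hn, h.norm_eq n hn, ?_, ?_⟩
  · intro x hx y hy
    rw [inner_sub_right, hx.2, hy.2, sub_self]
  · intro x hx y hy
    rw [inner_sub_right, hx.2, sub_nonneg]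
    exact h.le hy hn

/-- The facet has codimension one in `V`, so `N` is `n` or `-n`; the point `p`, strictly on the
inner side, decides the sign. -/
theorem eq_of_isInnerUnitNormal_facet (h : IsRep G V p s b) {n N : 𝔼[d]} (hn : n ∈ s)
    (hN : IsInnerUnitNormal G (facet G b n) N) : N = n := by
  have h1 : (inner ℝ n n : ℝ) = 1 := by rw [real_inner_self_eq_norm_sq, h.norm_eq n hn, one_pow]
  have hNV : N ∈ V := by rw [← h.vectorSpan_eq]; exact hN.1
  set w := N - (inner ℝ n N : ℝ) • n with hw
  have hwmem : w ∈ vectorSpan ℝ (facet G b n) := by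
    rw [h.vectorSpan_facet hn, mem_inf_orthogonal_singleton]
    refine ⟨V.sub_mem hNV (V.smul_mem _ (h.mem_dir n hn)), ?_⟩
    rw [hw, inner_sub_right, inner_smul_right, h1]; ring
  have h2 := hN.inner_eq_zero hwmem
  have h3 := (h.isInnerUnitNormal_facet hn).inner_eq_zero hwmem
  have h4 : w = 0 := by
    rw [← inner_self_eq_zero (𝕜 := ℝ)]
    nth_rw 1 [hw]
    rw [inner_sub_left, inner_smul_left, h2, h3]; simp
  have h5 : N = (inner ℝ n N : ℝ) • n := sub_eq_zero.1 h4
  have h6 : |(inner ℝ n N : ℝ)| = 1 := by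
    have := congrArg norm h5
    rw [norm_smul, h.norm_eq n hn, hN.2.1, mul_one] at this
    simpa using this.symm
  obtain ⟨x, hx, hxn, -⟩ := h.sharp n hn
  have h7 := hN.2.2.2 x ⟨hx, hxn⟩ p h.base_mem
  rw [h5, inner_smul_left, inner_sub_right, hxn] at h7
  have h8 := h.lt n hn
  have h9 : 0 ≤ (inner ℝ n N : ℝ) := by
    by_contra hc
    push Not at hc
    simp only [RCLike.conj_to_real] at h7
    nlinarith
  rw [abs_of_nonneg h9] at h6
  rw [h5, h6, one_smul]

/-- A face of codimension two in a facet is cut out by exactly one more facet. -/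
theorem exists_ridge_eq (h : IsRep G V p s b) {m : ℕ} (hm : Module.finrank ℝ V = m + 2)
    {n : 𝔼[d]} (hn : n ∈ s) {R : Set 𝔼[d]} (hR : IsFace G m R) (hRn : R ⊆ facet G b n) :
    ∃ n' ∈ s, n' ≠ n ∧ R = facet G b n ∩ facet G b n' := by
  obtain ⟨x, hx, hRx, hk⟩ := h.isFace_iff.1 hR
  have hxR : x ∈ R := hRx ▸ ⟨hx, fun _ _ h => h⟩
  have hxn := (hRn hxR).2
  obtain ⟨n', hn', hne, hxn'⟩ : ∃ n' ∈ s, n' ≠ n ∧ inner ℝ n' x = b n' := by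
    by_contra hc
    push Not at hc
    have : dirAt V s b x = V ⊓ (ℝ ∙ n)ᗮ := by
      ext v
      rw [mem_inf_orthogonal_singleton]
      refine and_congr_right fun _ => ⟨fun hy => hy n hn hxn, fun hy n' hn' he => ?_⟩
      by_cases h' : n' = n
      · rw [h']; exact hy
      · exact absurd he (hc n' hn' h')
    have h1 := finrank_inf_orthogonal_singleton (h.mem_dir n hn) (h.ne_zero hn)
    rw [← this] at h1
    omega
  refine ⟨n', hn', hne, ?_⟩
  have hm' : Module.finrank ℝ V = (m + 1) + 1 := hm
  have hRn' : R ⊆ facet G b n' := by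
    rw [hRx]; exact fun y hy => ⟨hy.1, hy.2 n' hn' hxn'⟩
  have hF1 := h.isFace_facet hn hm'
  have hF2 := h.isFace_facet hn' hm'
  have hI : IsFace G (Module.finrank ℝ (vectorSpan ℝ (facet G b n ∩ facet G b n')))
      (facet G b n ∩ facet G b n') :=
    ⟨⟨x, hRn hxR, hRn' hxR⟩, hF1.2.1.inter hF2.2.1, rfl⟩
  refine h.eq_of_subset hR hI (Set.subset_inter hRn hRn') ?_
  by_contra hlt
  push Not at hlt
  have h2 := h.eq_of_subset hI hF1 Set.inter_subset_left hlt
  obtain ⟨y, hy, hyn, hy'⟩ := h.sharp n hn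
  have : y ∈ facet G b n ∩ facet G b n' := h2.ge ⟨hy, hyn⟩
  exact absurd this.2.2 (hy' n' hn' hne).ne'

/-- At most two facets contain a given ridge. -/
theorem ridge_not_three (h : IsRep G V p s b) {m : ℕ} (hm : Module.finrank ℝ V = m + 2)
    {R : Set 𝔼[d]} (hR : IsFace G m R) {n₁ n₂ n₃ : 𝔼[d]} (h₁ : n₁ ∈ s) (h₂ : n₂ ∈ s) (h₃ : n₃ ∈ s)
    (h12 : n₁ ≠ n₂) (h13 : n₁ ≠ n₃) (h23 : n₂ ≠ n₃) (hR₁ : R ⊆ facet G b n₁)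
    (hR₂ : R ⊆ facet G b n₂) (hR₃ : R ⊆ facet G b n₃) : False := by
  obtain ⟨x, hx⟩ := hR.1
  have hRV : vectorSpan ℝ R ≤ V := by
    rw [← h.vectorSpan_eq]; exact vectorSpan_mono ℝ hR.subset
  set U : Submodule ℝ 𝔼[d] := (vectorSpan ℝ R)ᗮ ⊓ V with hU
  have hUr : Module.finrank ℝ U = 2 := by
    have : Module.finrank ℝ (vectorSpan ℝ R) + Module.finrank ℝ U = Module.finrank ℝ V :=
      Submodule.finrank_add_inf_finrank_orthogonal hRV
    rw [hR.2.2] at this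
    omega
  have hmem : ∀ n ∈ s, R ⊆ facet G b n → n ∈ U := by
    intro n hn hRn
    refine ⟨(Submodule.mem_orthogonal' _ _).2 fun v hv => ?_, h.mem_dir n hn⟩
    refine inner_eq_zero_of_mem_vectorSpan (fun y hy z hz => ?_) hv
    rw [inner_sub_right, (hRn hy).2, (hRn hz).2, sub_self]
  -- Three normals in the two-dimensional orthogonal complement of the ridge satisfy a nontrivial
  -- linear relation.
  let f : Fin 3 → U := ![⟨n₁, hmem n₁ h₁ hR₁⟩, ⟨n₂, hmem n₂ h₂ hR₂⟩, ⟨n₃, hmem n₃ h₃ hR₃⟩]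
  have hdep : ¬ LinearIndependent ℝ f := by
    intro hc
    have := hc.fintype_card_le_finrank
    rw [hUr, Fintype.card_fin] at this
    omega
  obtain ⟨c, hc, i, hi⟩ := Fintype.not_linearIndependent_iff.1 hdep
  rw [Fin.sum_univ_three] at hc
  have hc' : c 0 • n₁ + c 1 • n₂ + c 2 • n₃ = 0 := by
    have := congrArg (Subtype.val) hc
    simpa [f] using this
  have hpair : ∀ v : 𝔼[d], c 0 * inner ℝ n₁ v + c 1 * inner ℝ n₂ v + c 2 * inner ℝ n₃ v = 0 := by
    intro v
    have := congrArg (fun w => (inner ℝ w v : ℝ)) hc'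
    simpa [inner_add_left, inner_smul_left] using this
  have hb₁ := (hR₁ hx).2
  have hb₂ := (hR₂ hx).2
  have hb₃ := (hR₃ hx).2
  obtain ⟨y₁, -, hy₁, hy₁'⟩ := h.sharp n₁ h₁
  obtain ⟨y₂, -, hy₂, hy₂'⟩ := h.sharp n₂ h₂
  obtain ⟨y₃, -, hy₃, hy₃'⟩ := h.sharp n₃ h₃
  have e₁ := hpair (y₁ - x)
  have e₂ := hpair (y₂ - x)
  have e₃ := hpair (y₃ - x)
  simp only [inner_sub_right, hb₁, hb₂, hb₃, hy₁, hy₂, hy₃, sub_self, mul_zero, zero_add,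
    add_zero] at e₁ e₂ e₃
  have a12 := sub_pos.2 (hy₁' n₂ h₂ h12.symm)
  have a13 := sub_pos.2 (hy₁' n₃ h₃ h13.symm)
  have a21 := sub_pos.2 (hy₂' n₁ h₁ h12)
  have a23 := sub_pos.2 (hy₂' n₃ h₃ h23.symm)
  have a31 := sub_pos.2 (hy₃' n₁ h₁ h13)
  have a32 := sub_pos.2 (hy₃' n₂ h₂ h23)
  generalize (inner ℝ n₂ y₁ - b n₂ : ℝ) = A12 at *
  generalize (inner ℝ n₃ y₁ - b n₃ : ℝ) = A13 at *
  generalize (inner ℝ n₁ y₂ - b n₁ : ℝ) = A21 at *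
  generalize (inner ℝ n₃ y₂ - b n₃ : ℝ) = A23 at *
  generalize (inner ℝ n₁ y₃ - b n₁ : ℝ) = A31 at *
  generalize (inner ℝ n₂ y₃ - b n₂ : ℝ) = A32 at *
  rcases lt_trichotomy (c 0) 0 with h0 | h0 | h0
  · have i1 : 0 < c 1 := by
      by_contra hc1
      nlinarith [mul_neg_of_neg_of_pos h0 a31, mul_nonneg (neg_nonneg.2 (not_lt.1 hc1)) a32.le]
    have i2 : 0 < c 2 := by
      by_contra hc1
      nlinarith [mul_neg_of_neg_of_pos h0 a21, mul_nonneg (neg_nonneg.2 (not_lt.1 hc1)) a23.le]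
    nlinarith [mul_pos i1 a12, mul_pos i2 a13]
  · rw [h0, zero_mul, zero_add] at e₂ e₃
    have i1 : c 1 = 0 := (mul_eq_zero.1 e₃).resolve_right a32.ne'
    have i2 : c 2 = 0 := (mul_eq_zero.1 e₂).resolve_right a23.ne'
    fin_cases i
    · exact hi h0
    · exact hi i1
    · exact hi i2
  · have i1 : c 1 < 0 := by
      by_contra hc1
      nlinarith [mul_pos h0 a31, mul_nonneg (not_lt.1 hc1) a32.le]
    have i2 : c 2 < 0 := by
      by_contra hc1
      nlinarith [mul_pos h0 a21, mul_nonneg (not_lt.1 hc1) a23.le]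
    nlinarith [mul_neg_of_neg_of_pos i1 a12, mul_neg_of_neg_of_pos i2 a13]

/-- The normal of the second facet at a ridge, in terms of the first facet. -/
theorem normal_eq_of_inner_eq_cos (h : IsRep G V p s b) {m : ℕ}
    (hm : Module.finrank ℝ V = m + 2) {n n' ν : 𝔼[d]} (hn : n ∈ s) (hn' : n' ∈ s) (hne : n' ≠ n)
    (hR : IsFace G m (facet G b n ∩ facet G b n'))
    (hν : IsInnerUnitNormal (facet G b n) (facet G b n ∩ facet G b n') ν) {a : ℝ}
    (hcos : inner ℝ n n' = Real.cos a) (hsin : 0 < Real.sin a) :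
    n' = Real.cos a • n + Real.sin a • ν := by
  set R := facet G b n ∩ facet G b n' with hRdef
  have hm' : Module.finrank ℝ V = (m + 1) + 1 := hm
  have hF := h.isFace_facet hn hm'
  have hRspan := hν.vectorSpan_eq (hR.mono hF.subset Set.inter_subset_left) hF.2.2
  have h1 : (inner ℝ n n : ℝ) = 1 := by rw [real_inner_self_eq_norm_sq, h.norm_eq n hn, one_pow]
  have h1' : (inner ℝ n' n' : ℝ) = 1 := by
    rw [real_inner_self_eq_norm_sq, h.norm_eq n' hn', one_pow]
  have h1ν : (inner ℝ ν ν : ℝ) = 1 := by rw [real_inner_self_eq_norm_sq, hν.2.1, one_pow]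
  have hνV := hν.1
  rw [h.vectorSpan_facet hn, mem_inf_orthogonal_singleton] at hνV
  have hcos' : inner ℝ n' n = Real.cos a := by rw [real_inner_comm]; exact hcos
  have hνn : (inner ℝ ν n : ℝ) = 0 := by rw [real_inner_comm]; exact hνV.2
  set c : ℝ := inner ℝ ν n' with hc
  have hc' : inner ℝ n' ν = c := by rw [hc, real_inner_comm]
  -- `w` lies in the direction of the ridge and is a combination of vectors orthogonal to it, so it
  -- vanishes.
  set w := n' - Real.cos a • n - c • ν with hw
  have hwR : w ∈ vectorSpan ℝ R := by
    rw [hRspan, mem_inf_orthogonal_singleton, h.vectorSpan_facet hn, mem_inf_orthogonal_singleton]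
    refine ⟨⟨V.sub_mem (V.sub_mem (h.mem_dir n' hn') (V.smul_mem _ (h.mem_dir n hn)))
      (V.smul_mem _ hνV.1), ?_⟩, ?_⟩
    · rw [hw, inner_sub_right, inner_sub_right, inner_smul_right, inner_smul_right, hcos, h1,
        hνV.2]; ring
    · rw [hw, inner_sub_right, inner_sub_right, inner_smul_right, inner_smul_right, hνn, h1ν,
        ← hc]; ring
  have hw1 : (inner ℝ n w : ℝ) = 0 :=
    inner_eq_zero_of_mem_vectorSpan (fun x hx y hy => by
      rw [inner_sub_right, hx.1.2, hy.1.2, sub_self]) hwR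
  have hw2 : (inner ℝ n' w : ℝ) = 0 :=
    inner_eq_zero_of_mem_vectorSpan (fun x hx y hy => by
      rw [inner_sub_right, hx.2.2, hy.2.2, sub_self]) hwR
  have hw3 : (inner ℝ ν w : ℝ) = 0 := hν.inner_eq_zero hwR
  have hw0 : w = 0 := by
    rw [← inner_self_eq_zero (𝕜 := ℝ)]
    nth_rw 1 [hw]
    rw [inner_sub_left, inner_sub_left, inner_smul_left, inner_smul_left, hw1, hw2, hw3]; simp
  have hn'eq : n' = Real.cos a • n + c • ν := by
    rw [hw, sub_sub, sub_eq_zero] at hw0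
    exact hw0
  have key : ∀ v, (inner ℝ n' v : ℝ) = Real.cos a * inner ℝ n v + c * inner ℝ ν v := by
    intro v
    have := congrArg (fun z => (inner ℝ z v : ℝ)) hn'eq
    simpa [inner_add_left, inner_smul_left] using this
  have hsq : c ^ 2 = Real.sin a ^ 2 := by
    have h2 := key n'
    rw [h1', hcos, ← hc] at h2
    have := Real.sin_sq_add_cos_sq a
    nlinarith
  -- Unit length determines `c` up to sign; a point of the facet of `n` strictly inside the
  -- half-space of `n'` shows that `c` is positive.
  have hcpos : 0 < c := by
    obtain ⟨y, hy, hyn, hy'⟩ := h.sharp n hn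
    obtain ⟨x, hx⟩ := hR.1
    have h2 := hν.2.2.2 x hx y ⟨hy, hyn⟩
    have h3 := hy' n' hn' hne
    have h4 := key (y - x)
    rw [inner_sub_right n' y x, inner_sub_right n y x, hyn, hx.1.2, hx.2.2] at h4
    by_contra hc0
    nlinarith
  have : c = Real.sin a := by
    rcases sq_eq_sq_iff_eq_or_eq_neg.1 hsq with h | h
    · exact h
    · linarith
  rw [← this]; exact hn'eq

end IsRep

/-! ### Connectivity of the facets at a point -/

theorem exists_forall_inner_ne_zero {V : Submodule ℝ 𝔼[d]} (B : Finset 𝔼[d])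
    (hB : ∀ w ∈ B, w ∈ V ∧ w ≠ 0) : ∃ u ∈ V, ∀ w ∈ B, (inner ℝ w u : ℝ) ≠ 0 := by
  classical
  let q : 𝔼[d] → Submodule ℝ V := fun w => ((ℝ ∙ w)ᗮ).comap V.subtype
  have htop : (⊤ : Submodule ℝ V) ∉ B.image q := by
    intro hc
    obtain ⟨w, hw, he⟩ := Finset.mem_image.1 hc
    have : (⟨w, (hB w hw).1⟩ : V) ∈ q w := by rw [he]; trivial
    have h2 : w ∈ (ℝ ∙ w)ᗮ := this
    rw [Submodule.mem_orthogonal_singleton_iff_inner_right, inner_self_eq_zero] at h2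
    exact (hB w hw).2 h2
  have := Subspace.biUnion_ne_univ_of_top_notMem htop
  obtain ⟨u, hu⟩ := (Set.ne_univ_iff_exists_notMem _).1 this
  refine ⟨u, u.2, fun w hw h0 => hu ?_⟩
  simp only [Set.mem_iUnion]
  refine ⟨q w, Finset.mem_image_of_mem q hw, ?_⟩
  exact Submodule.mem_orthogonal_singleton_iff_inner_right.2 h0

/-- Finitely many hyperplanes do not cover `V`. A short step from `y` in a direction off all of them
leaves those through `y` and does not reach the others. -/
theorem exists_generic {V : Submodule ℝ 𝔼[d]} (B : Finset 𝔼[d]) (hB : ∀ w ∈ B, w ∈ V ∧ w ≠ 0)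
    {y : 𝔼[d]} (hy : y ∈ V) {U : Set 𝔼[d]} (hU : IsOpen U) (hyU : y ∈ U) :
    ∃ z ∈ V, z ∈ U ∧ ∀ w ∈ B, (inner ℝ w z : ℝ) ≠ 0 := by
  obtain ⟨u, hu, hu'⟩ := exists_forall_inner_ne_zero B hB
  have hc : Continuous fun t : ℝ => y + t • u := by fun_prop
  have h0 := hc.tendsto 0
  simp only [zero_smul, add_zero] at h0
  have h1 : ∀ᶠ t : ℝ in nhdsWithin 0 (Set.Ioi 0), y + t • u ∈ U :=
    (h0.mono_left nhdsWithin_le_nhds).eventually (hU.mem_nhds hyU)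
  have h2 : ∀ᶠ t : ℝ in nhdsWithin 0 (Set.Ioi 0), ∀ w ∈ B, (inner ℝ w (y + t • u) : ℝ) ≠ 0 := by
    refine (Filter.eventually_all_finset B).2 fun w hw => ?_
    by_cases hwy : (inner ℝ w y : ℝ) = 0
    · filter_upwards [self_mem_nhdsWithin] with t ht
      rw [inner_add_right, inner_smul_right, hwy, zero_add]
      exact mul_ne_zero (ne_of_gt ht) (hu' w hw)
    · have hc' : Continuous fun t : ℝ => (inner ℝ w (y + t • u) : ℝ) := by fun_prop
      have h3 := hc'.tendsto 0
      simp only [zero_smul, add_zero] at h3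
      exact (h3.mono_left nhdsWithin_le_nhds).eventually (isOpen_ne.mem_nhds hwy)
  obtain ⟨t, ht1, ht2⟩ := (h1.and h2).exists
  exact ⟨_, V.add_mem hy (V.smul_mem t hu), ht1, ht2⟩

namespace IsRep

variable {G : Set 𝔼[d]} {V : Submodule ℝ 𝔼[d]} {p : 𝔼[d]} {s : Finset 𝔼[d]} {b : 𝔼[d] → ℝ}

theorem ne_neg_of_active (h : IsRep G V p s b) {v n n' : 𝔼[d]} (hn : n ∈ s) (hn' : n' ∈ s)
    (hv : inner ℝ n v = b n) (hv' : inner ℝ n' v = b n') : n' ≠ -n := by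
  intro he
  have h1 := h.lt n hn
  have h2 := h.lt n' hn'
  rw [← hv'] at h2
  rw [← hv] at h1
  rw [he, inner_neg_left, inner_neg_left] at h2
  linarith

theorem finrank_inf_two (h : IsRep G V p s b) {v n n' : 𝔼[d]} (hn : n ∈ s) (hn' : n' ∈ s)
    (hv : inner ℝ n v = b n) (hv' : inner ℝ n' v = b n') (hne : n' ≠ n) :
    Module.finrank ℝ (V ⊓ (ℝ ∙ n)ᗮ ⊓ (ℝ ∙ n')ᗮ : Submodule ℝ 𝔼[d]) + 2 = Module.finrank ℝ V := by
  have h1 : (inner ℝ n n : ℝ) = 1 := by rw [real_inner_self_eq_norm_sq, h.norm_eq n hn, one_pow]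
  set w := n' - (inner ℝ n n' : ℝ) • n with hw
  have hwV : w ∈ V ⊓ (ℝ ∙ n)ᗮ := by
    rw [mem_inf_orthogonal_singleton]
    refine ⟨V.sub_mem (h.mem_dir _ hn') (V.smul_mem _ (h.mem_dir _ hn)), ?_⟩
    rw [hw, inner_sub_right, inner_smul_right, h1]; ring
  have hw0 : w ≠ 0 := by
    intro h0
    have h2 : n' = (inner ℝ n n' : ℝ) • n := sub_eq_zero.1 h0
    have h3 := congrArg norm h2
    rw [norm_smul, h.norm_eq n hn, h.norm_eq n' hn', mul_one, Real.norm_eq_abs] at h3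
    rcases abs_eq (zero_le_one) |>.1 h3.symm with h4 | h4
    · rw [h4, one_smul] at h2; exact hne h2
    · rw [h4, neg_smul, one_smul] at h2; exact h.ne_neg_of_active hn hn' hv hv' h2
  have h2 := finrank_inf_orthogonal_singleton hwV hw0
  have h3 := finrank_inf_orthogonal_singleton (h.mem_dir _ hn) (h.ne_zero hn)
  have h4 : V ⊓ (ℝ ∙ n)ᗮ ⊓ (ℝ ∙ n')ᗮ = V ⊓ (ℝ ∙ n)ᗮ ⊓ (ℝ ∙ w)ᗮ := by
    ext x
    rw [mem_inf_orthogonal_singleton, mem_inf_orthogonal_singleton (n := w)]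
    refine and_congr_right fun hx => ?_
    rw [mem_inf_orthogonal_singleton] at hx
    rw [hw, inner_sub_left, inner_smul_left, hx.2]; simp
  rw [h4]; omega

/-- If all facets containing the point `z` have normals in the span of two of them, these two
facets meet in a ridge. -/
theorem isFace_inter_of_active_mem_span (h : IsRep G V p s b) {m : ℕ}
    (hm : Module.finrank ℝ V = m + 2) {z n n' : 𝔼[d]} (hz : z ∈ G) (hn : n ∈ s) (hn' : n' ∈ s)
    (hzn : inner ℝ n z = b n) (hzn' : inner ℝ n' z = b n') (hne : n' ≠ n)
    (hspan : ∀ k ∈ s, inner ℝ k z = b k → k ∈ Submodule.span ℝ {n, n'}) :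
    IsFace G m (facet G b n ∩ facet G b n') := by
  have horth : ∀ x, inner ℝ n x = 0 → inner ℝ n' x = 0 → ∀ k ∈ s, inner ℝ k z = b k →
      (inner ℝ k x : ℝ) = 0 := by
    intro x hx hx' k hk hkz
    obtain ⟨a, c, rfl⟩ := Submodule.mem_span_pair.1 (hspan k hk hkz)
    rw [inner_add_left, inner_smul_left, inner_smul_left, hx, hx']; simp
  have hdir : dirAt V s b z = V ⊓ (ℝ ∙ n)ᗮ ⊓ (ℝ ∙ n')ᗮ := by
    ext x
    rw [mem_inf_orthogonal_singleton, mem_inf_orthogonal_singleton]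
    exact ⟨fun hx => ⟨⟨hx.1, hx.2 n hn hzn⟩, hx.2 n' hn' hzn'⟩,
      fun hx => ⟨hx.1.1, horth x hx.1.2 hx.2⟩⟩
  refine h.isFace_iff.2 ⟨z, hz, ?_, ?_⟩
  · ext y
    constructor
    · rintro ⟨⟨hy, hyn⟩, -, hyn'⟩
      refine ⟨hy, fun k hk hkz => ?_⟩
      have := horth (y - z) (by rw [inner_sub_right, hyn, hzn, sub_self])
        (by rw [inner_sub_right, hyn', hzn', sub_self]) k hk hkz
      rw [inner_sub_right] at this
      linarith
    · exact fun hy => ⟨⟨hy.1, hy.2 n hn hzn⟩, hy.1, hy.2 n' hn' hzn'⟩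
  · rw [hdir]
    have := h.finrank_inf_two hn hn' hzn hzn' hne
    omega

/-- The facets through a point are connected through ridges. -/
theorem facets_connected (h : IsRep G V p s b) {m : ℕ} (hm : Module.finrank ℝ V = m + 2)
    {v : 𝔼[d]} (hv : v ∈ G) {C : Set 𝔼[d]} {i l : 𝔼[d]} (hi : i ∈ s) (hiv : inner ℝ i v = b i)
    (hiC : i ∈ C) (hl : l ∈ s) (hlv : inner ℝ l v = b l)
    (hC : ∀ n ∈ s, inner ℝ n v = b n → n ∈ C → ∀ n' ∈ s, inner ℝ n' v = b n' → n' ≠ n →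
      IsFace G m (facet G b n ∩ facet G b n') → n' ∈ C) : l ∈ C := by
  classical
  by_contra hlC
  set A : Finset 𝔼[d] := s.filter (fun n => inner ℝ n v = b n) with hA
  have hAs : ∀ n ∈ A, n ∈ s ∧ inner ℝ n v = b n := fun n hn => Finset.mem_filter.1 hn
  have hiA : i ∈ A := Finset.mem_filter.2 ⟨hi, hiv⟩
  have hlA : l ∈ A := Finset.mem_filter.2 ⟨hl, hlv⟩
  set o : 𝔼[d] := p - v with ho
  have hoV : o ∈ V := h.sub_mem h.base_mem hv
  have hpos : ∀ n ∈ A, 0 < (inner ℝ n o : ℝ) := by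
    intro n hn
    rw [ho, inner_sub_right, (hAs n hn).2, sub_pos]
    exact h.lt n (hAs n hn).1
  -- Scaled so that `⟪e n, o⟫ = 1`: subtracting a multiple of `o` lowers all these functionals
  -- equally, so the minimal ones can be brought to `0` with the others staying positive.
  let e : 𝔼[d] → 𝔼[d] := fun n => (inner ℝ n o : ℝ)⁻¹ • n
  have heV : ∀ n ∈ A, e n ∈ V := fun n hn => V.smul_mem _ (h.mem_dir n (hAs n hn).1)
  have he : ∀ n q, (inner ℝ (e n) q : ℝ) = (inner ℝ n o : ℝ)⁻¹ * inner ℝ n q := by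
    intro n q; simp only [e]; rw [inner_smul_left]; simp
  have hne : ∀ n ∈ A, ∀ n' ∈ A, n ≠ n' → e n - e n' ≠ 0 := by
    intro n hn n' hn' hnn h0
    have h1 : e n = e n' := sub_eq_zero.1 h0
    have h2 := congrArg norm h1
    simp only [e] at h1 h2
    rw [norm_smul, norm_smul, h.norm_eq n (hAs n hn).1, h.norm_eq n' (hAs n' hn').1, mul_one,
      mul_one, Real.norm_eq_abs, Real.norm_eq_abs, abs_of_pos (inv_pos.2 (hpos n hn)),
      abs_of_pos (inv_pos.2 (hpos n' hn'))] at h2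
    rw [h2] at h1
    exact hnn (smul_right_injective _ (inv_pos.2 (hpos n' hn')).ne' h1)
  obtain ⟨x₀, hx₀, hix₀, hx₀'⟩ := h.sharp i hi
  obtain ⟨y₀, hy₀, hly₀, hy₀'⟩ := h.sharp l hl
  set x : 𝔼[d] := x₀ - v with hx
  have hxV : x ∈ V := h.sub_mem hx₀ hv
  have hfx : ∀ n ∈ A, n ≠ i → (inner ℝ (e i) x : ℝ) < inner ℝ (e n) x := by
    intro n hn hni
    rw [he, he, hx, inner_sub_right i x₀ v, hix₀, hiv, sub_self, mul_zero]
    refine mul_pos (inv_pos.2 (hpos n hn)) ?_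
    rw [inner_sub_right, (hAs n hn).2, sub_pos]
    exact hx₀' n (hAs n hn).1 hni
  have hfy : ∀ n ∈ A, n ≠ l → (inner ℝ (e l) (y₀ - v) : ℝ) < inner ℝ (e n) (y₀ - v) := by
    intro n hn hni
    rw [he, he, inner_sub_right l y₀ v, hly₀, hlv, sub_self, mul_zero]
    refine mul_pos (inv_pos.2 (hpos n hn)) ?_
    rw [inner_sub_right, (hAs n hn).2, sub_pos]
    exact hy₀' n (hAs n hn).1 hni
  -- If three of the functionals agree at a point other than `x` on the segment from `x` to `y`,
  -- then `y` is orthogonal to such a vector. A generic `y` avoids the nonzero ones, and also those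
  -- orthogonal to a nonzero difference of two `e n`.
  let ebad : 𝔼[d] × 𝔼[d] × 𝔼[d] → 𝔼[d] := fun w =>
    (inner ℝ (e w.1 - e w.2.1) x : ℝ) • (e w.1 - e w.2.2) -
      (inner ℝ (e w.1 - e w.2.2) x : ℝ) • (e w.1 - e w.2.1)
  let B : Finset 𝔼[d] := ((A ×ˢ A ×ˢ A).image ebad ∪ (A ×ˢ A).image (fun w => e w.1 - e w.2)).filter
    (fun w => w ≠ 0)
  have hB : ∀ w ∈ B, w ∈ V ∧ w ≠ 0 := by
    intro w hw
    refine ⟨?_, (Finset.mem_filter.1 hw).2⟩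
    rcases Finset.mem_union.1 (Finset.mem_filter.1 hw).1 with hw | hw
    · obtain ⟨⟨a, a', a''⟩, ha, rfl⟩ := Finset.mem_image.1 hw
      simp only [Finset.mem_product] at ha
      exact V.sub_mem (V.smul_mem _ (V.sub_mem (heV _ ha.1) (heV _ ha.2.2)))
        (V.smul_mem _ (V.sub_mem (heV _ ha.1) (heV _ ha.2.1)))
    · obtain ⟨⟨a, a'⟩, ha, rfl⟩ := Finset.mem_image.1 hw
      simp only [Finset.mem_product] at ha
      exact V.sub_mem (heV _ ha.1) (heV _ ha.2)
  have hUo : IsOpen {y : 𝔼[d] | ∀ n ∈ A, n ≠ l → (inner ℝ (e l) y : ℝ) < inner ℝ (e n) y} := by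
    have : {y : 𝔼[d] | ∀ n ∈ A, n ≠ l → (inner ℝ (e l) y : ℝ) < inner ℝ (e n) y} =
        ⋂ n ∈ A.filter (fun n => n ≠ l), {y | (inner ℝ (e l) y : ℝ) < inner ℝ (e n) y} := by
      ext y; simp
    rw [this]
    exact isOpen_biInter_finset fun n _ => isOpen_lt (by fun_prop) (by fun_prop)
  obtain ⟨y, hyV, hyU, hyB⟩ := exists_generic B hB (h.sub_mem hy₀ hv) hUo hfy
  let q : ℝ → 𝔼[d] := fun τ => x + τ • (y - x)
  have hq : ∀ n τ, (inner ℝ n (q τ) : ℝ) = (1 - τ) * inner ℝ n x + τ * inner ℝ n y := by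
    intro n τ
    simp only [q]
    rw [inner_add_right, inner_smul_right, inner_sub_right n y x]; ring
  have hqc : Continuous q := by fun_prop
  let I : Finset 𝔼[d] → Set ℝ := fun D =>
    ⋃ n ∈ D, ⋂ k ∈ A, {τ | (inner ℝ (e n) (q τ) : ℝ) ≤ inner ℝ (e k) (q τ)}
  have hIc : ∀ D, IsClosed (I D) := fun D =>
    isClosed_biUnion_finset fun n _ => isClosed_biInter fun k _ =>
      isClosed_le (by fun_prop) (by fun_prop)
  have hI : ∀ D τ, τ ∈ I D ↔ ∃ n ∈ D, ∀ k ∈ A, (inner ℝ (e n) (q τ) : ℝ) ≤ inner ℝ (e k) (q τ) := by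
    intro D τ; simp [I]
  -- The times at which some minimal normal is in `C`, and those at which one is outside, are
  -- closed, nonempty and cover `[0, 1]`. They share a time `τ`, where `a` in `C` and `c` outside
  -- are both minimal.
  have hconn := isPreconnected_closed_iff.1 (isPreconnected_Icc (a := (0 : ℝ)) (b := 1))
    (I (A.filter (· ∈ C))) (I (A.filter (· ∉ C))) (hIc _) (hIc _) ?_ ?_ ?_
  rotate_left
  · intro τ _
    obtain ⟨n, hn, hmin⟩ := A.exists_min_image (fun k => (inner ℝ (e k) (q τ) : ℝ)) ⟨i, hiA⟩
    by_cases hnC : n ∈ C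
    · exact Or.inl ((hI _ _).2 ⟨n, Finset.mem_filter.2 ⟨hn, hnC⟩, hmin⟩)
    · exact Or.inr ((hI _ _).2 ⟨n, Finset.mem_filter.2 ⟨hn, hnC⟩, hmin⟩)
  · refine ⟨0, by simp, (hI _ _).2 ⟨i, Finset.mem_filter.2 ⟨hiA, hiC⟩, fun k hk => ?_⟩⟩
    by_cases hki : k = i
    · rw [hki]
    · rw [hq, hq]; simpa using (hfx k hk hki).le
  · refine ⟨1, by simp, (hI _ _).2 ⟨l, Finset.mem_filter.2 ⟨hlA, hlC⟩, fun k hk => ?_⟩⟩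
    by_cases hki : k = l
    · rw [hki]
    · rw [hq, hq]; simpa using (hyU k hk hki).le
  obtain ⟨τ, ⟨hτ0, hτ1⟩, hτa, hτb⟩ := hconn
  obtain ⟨a, ha, hamin⟩ := (hI _ _).1 hτa
  obtain ⟨c, hc, hcmin⟩ := (hI _ _).1 hτb
  rw [Finset.mem_filter] at ha hc
  obtain ⟨haA, haC⟩ := ha
  obtain ⟨hcA, hcC⟩ := hc
  have hac : a ≠ c := fun h => hcC (h ▸ haC)
  have heq : (inner ℝ (e a) (q τ) : ℝ) = inner ℝ (e c) (q τ) :=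
    le_antisymm (hamin c hcA) (hcmin a haA)
  have hτpos : 0 < τ := by
    refine lt_of_le_of_ne hτ0 fun h0 => ?_
    have hq0 : q τ = x := by simp [q, ← h0]
    rw [hq0] at hamin hcmin
    have h1 : a = i := by
      by_contra hai
      exact absurd (hamin i hiA) (not_le.2 (hfx a haA hai))
    have h2 : c = i := by
      by_contra hai
      exact absurd (hcmin i hiA) (not_le.2 (hfx c hcA hai))
    exact hac (h1.trans h2.symm)
  have hgen : ∀ k ∈ A, (inner ℝ (e k) (q τ) : ℝ) = inner ℝ (e a) (q τ) →
      k ∈ Submodule.span ℝ {a, c} := by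
    intro k hk hkeq
    by_contra hks
    have hes : ∀ n ∈ A, ∀ S : Submodule ℝ 𝔼[d], e n ∈ S → n ∈ S := by
      intro n hn S hS
      have := S.smul_mem (inner ℝ n o : ℝ) hS
      simp only [e] at this
      rwa [smul_smul, mul_inv_cancel₀ (hpos n hn).ne', one_smul] at this
    have heas : e a ∈ Submodule.span ℝ {a, c} :=
      Submodule.smul_mem _ _ (Submodule.subset_span (by simp))
    have hecs : e c ∈ Submodule.span ℝ {a, c} :=
      Submodule.smul_mem _ _ (Submodule.subset_span (by simp))
    have g1 : (1 - τ) * (inner ℝ (e a - e c) x : ℝ) + τ * inner ℝ (e a - e c) y = 0 := by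
      rw [← hq, inner_sub_left, heq, sub_self]
    have g2 : (1 - τ) * (inner ℝ (e a - e k) x : ℝ) + τ * inner ℝ (e a - e k) y = 0 := by
      rw [← hq, inner_sub_left, hkeq, sub_self]
    set X1 : ℝ := inner ℝ (e a - e c) x with hX1
    set X2 : ℝ := inner ℝ (e a - e k) x with hX2
    by_cases hbad : ebad (a, c, k) = 0
    · have hz : X1 • (e a - e k) - X2 • (e a - e c) = 0 := hbad
      have hX10 : X1 = 0 := by
        by_contra h0
        apply hks
        apply hes k hk
        have : e k = e a - X1⁻¹ • (X2 • (e a - e c)) := by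
          rw [← sub_eq_zero.1 hz, smul_smul, inv_mul_cancel₀ h0, one_smul]; abel
        rw [this]
        exact Submodule.sub_mem _ heas (Submodule.smul_mem _ _ (Submodule.smul_mem _ _
          (Submodule.sub_mem _ heas hecs)))
      rw [hX10, mul_zero, zero_add] at g1
      have h3 : (inner ℝ (e a - e c) y : ℝ) = 0 := (mul_eq_zero.1 g1).resolve_left hτpos.ne'
      refine hyB (e a - e c) (Finset.mem_filter.2 ⟨Finset.mem_union_right _ ?_,
        hne a haA c hcA hac⟩) h3
      exact Finset.mem_image.2 ⟨(a, c), Finset.mem_product.2 ⟨haA, hcA⟩, rfl⟩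
    · refine hyB (ebad (a, c, k)) (Finset.mem_filter.2 ⟨Finset.mem_union_left _ ?_, hbad⟩) ?_
      · exact Finset.mem_image.2 ⟨(a, c, k), Finset.mem_product.2 ⟨haA,
          Finset.mem_product.2 ⟨hcA, hk⟩⟩, rfl⟩
      · change (inner ℝ (X1 • (e a - e k) - X2 • (e a - e c)) y : ℝ) = 0
        rw [inner_sub_left, inner_smul_left, inner_smul_left]
        simp only [RCLike.conj_to_real]
        have : τ * (X1 * inner ℝ (e a - e k) y - X2 * inner ℝ (e a - e c) y) = 0 := by
          linear_combination X1 * g2 - X2 * g1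
        exact (mul_eq_zero.1 this).resolve_left hτpos.ne'
  set lam : ℝ := inner ℝ (e a) (q τ) with hlam
  -- Among the normals active at `v`, those minimal at `τ` vanish on `z'` and the others are
  -- positive. A short step from `v` along `z'` reaches a point lying only on the facets minimal at
  -- `τ`, whose normals are in the span of `a` and `c`; hence these two facets share a ridge.
  set z' : 𝔼[d] := q τ - lam • o with hz'
  have hqV : q τ ∈ V := V.add_mem hxV (V.smul_mem _ (V.sub_mem hyV hxV))
  have hz'V : z' ∈ V := V.sub_mem hqV (V.smul_mem _ hoV)
  have hz'n : ∀ n ∈ A, (inner ℝ n z' : ℝ) = inner ℝ n o * (inner ℝ (e n) (q τ) - lam) := by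
    intro n hn
    rw [hz', inner_sub_right, inner_smul_right, he]
    have := (hpos n hn).ne'
    field_simp
  obtain ⟨t, ht, htG, hts⟩ := h.exists_pos_mem hv hz'V (fun n hn hnv => by
    have hnA : n ∈ A := Finset.mem_filter.2 ⟨hn, hnv⟩
    rw [hz'n n hnA]
    exact mul_nonneg (hpos n hnA).le (sub_nonneg.2 (hamin n hnA)))
  have hact : ∀ n ∈ s, inner ℝ n (v + t • z') = b n ↔ n ∈ A ∧ (inner ℝ (e n) (q τ) : ℝ) = lam := by
    intro n hn
    constructor
    · intro hz
      have hnA : n ∈ A := by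
        refine Finset.mem_filter.2 ⟨hn, ?_⟩
        by_contra hnv
        exact absurd hz (hts n hn (lt_of_le_of_ne (h.le hv hn) (Ne.symm hnv))).ne'
      refine ⟨hnA, ?_⟩
      rw [inner_add_right, inner_smul_right, (hAs n hnA).2, hz'n n hnA] at hz
      have h1 : t * (inner ℝ n o * (inner ℝ (e n) (q τ) - lam)) = 0 := by linarith
      have h2 := (mul_eq_zero.1 ((mul_eq_zero.1 h1).resolve_left ht.ne')).resolve_left
        (hpos n hnA).ne'
      linarith
    · rintro ⟨hnA, heq⟩
      rw [inner_add_right, inner_smul_right, (hAs n hnA).2, hz'n n hnA, heq]; ring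
  have hridge := h.isFace_inter_of_active_mem_span hm htG (hAs a haA).1 (hAs c hcA).1
    ((hact a (hAs a haA).1).2 ⟨haA, rfl⟩) ((hact c (hAs c hcA).1).2 ⟨hcA, heq.symm⟩) hac.symm
    (fun k hk hkz => by
      obtain ⟨hkA, hkeq⟩ := (hact k hk).1 hkz
      exact hgen k hkA hkeq)
  exact hcC (hC a (hAs a haA).1 (hAs a haA).2 haC c (hAs c hcA).1 (hAs c hcA).2 hac.symm hridge)

end IsRep

/-! ### Equiangular polytopes and the centres of their vertices -/

/-- An `m`-dimensional compact polytope, in its affine hull, that is dimension-wise equiangular. -/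
structure IsEquiangularPolytope (α : ℕ → ℝ) (m : ℕ) (G : Set 𝔼[d]) : Prop where
  exists_rep : ∃ p s b, IsRep G (vectorSpan ℝ G) p s b
  isCompact : IsCompact G
  finrank_eq : Module.finrank ℝ (vectorSpan ℝ G) = m
  mem_Ioo : ∀ k, α k ∈ Set.Ioo 0 Real.pi
  isEquiangular : ∀ k, 2 ≤ k → k ≤ m → ∀ F, IsFace G k F → IsEquiangular k F (α k)

theorem IsFace.finrank_le {k m : ℕ} {G F : Set 𝔼[d]} (hF : IsFace G k F)
    (hm : Module.finrank ℝ (vectorSpan ℝ G) = m) : k ≤ m := by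
  rw [← hF.2.2, ← hm]
  exact Submodule.finrank_mono (vectorSpan_mono ℝ hF.subset)

theorem IsEquiangularPolytope.face {α : ℕ → ℝ} {m k : ℕ} {G F : Set 𝔼[d]}
    (h : IsEquiangularPolytope α m G) (hF : IsFace G k F) : IsEquiangularPolytope α k F := by
  obtain ⟨p, s, b, hr⟩ := h.exists_rep
  have hkm := hF.finrank_le h.finrank_eq
  obtain ⟨p', s', b', hr'⟩ := hr.exists_isRep_face hF
  exact ⟨⟨p', s', b', hr'⟩, h.isCompact.of_isClosed_subset hr'.isClosed hF.subset, hF.2.2,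
    h.mem_Ioo,
    fun j hj hjk R hR => h.isEquiangular j hj (hjk.trans hkm) R (hr.isFace_trans hF hR)⟩

/-- `c` is the direction in which the vertex `v` of `G` moves (with unit speed relative to each
facet) when all facets are moved inwards. -/
def IsCenter (G : Set 𝔼[d]) (v c : 𝔼[d]) : Prop :=
  c ∈ vectorSpan ℝ G ∧ ∀ F N, IsFace G (Module.finrank ℝ (vectorSpan ℝ G) - 1) F → v ∈ F →
    IsInnerUnitNormal G F N → inner ℝ N c = 1

namespace IsRep

variable {G : Set 𝔼[d]} {V : Submodule ℝ 𝔼[d]} {p : 𝔼[d]} {s : Finset 𝔼[d]} {b : 𝔼[d] → ℝ}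

theorem finrank_pos (h : IsRep G V p s b) {n : 𝔼[d]} (hn : n ∈ s) : 0 < Module.finrank ℝ V := by
  have := h.finrank_facet hn
  omega

theorem isCenter_iff (h : IsRep G V p s b) {v : 𝔼[d]} (hv : v ∈ G) {c : 𝔼[d]} :
    IsCenter G v c ↔ c ∈ V ∧ ∀ n ∈ s, inner ℝ n v = b n → inner ℝ n c = 1 := by
  unfold IsCenter
  rw [h.vectorSpan_eq]
  refine and_congr_right fun _ => ⟨fun hc n hn hnv => ?_, fun hc F N hF hvF hN => ?_⟩
  · have := h.finrank_pos hn
    exact hc _ n (h.isFace_facet hn (by omega)) ⟨hv, hnv⟩ (h.isInnerUnitNormal_facet hn)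
  · have hpos : 0 < Module.finrank ℝ V := by
      rw [Module.finrank_pos_iff_exists_ne_zero]
      refine ⟨⟨N, ?_⟩, fun h0 => hN.ne_zero (congrArg Subtype.val h0)⟩
      rw [← h.vectorSpan_eq]; exact hN.1
    obtain ⟨n, hn, rfl⟩ := h.exists_eq_facet (m := Module.finrank ℝ V - 1) (by omega) hF
    rw [h.eq_of_isInnerUnitNormal_facet hn hN]
    exact hc n hn hvF.2

theorem eq_zero_of_vertex (h : IsRep G V p s b) {v w : 𝔼[d]} (hv : IsFace G 0 {v}) (hw : w ∈ V)
    (h0 : ∀ n ∈ s, inner ℝ n v = b n → inner ℝ n w = 0) : w = 0 := by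
  obtain ⟨x, hx, he, hk⟩ := h.isFace_iff.1 hv
  have hxv : x = v := by
    have : x ∈ ({v} : Set 𝔼[d]) := he ▸ ⟨hx, fun _ _ h => h⟩
    exact this
  subst hxv
  have : w ∈ dirAt V s b x := ⟨hw, h0⟩
  rw [Submodule.finrank_eq_zero.1 hk] at this
  exact this

theorem isCenter_unique (h : IsRep G V p s b) {v c c' : 𝔼[d]} (hv : IsFace G 0 {v})
    (hc : IsCenter G v c) (hc' : IsCenter G v c') : c = c' := by
  have hvG : v ∈ G := hv.subset rfl
  rw [h.isCenter_iff hvG] at hc hc'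
  refine sub_eq_zero.1 (h.eq_zero_of_vertex hv (V.sub_mem hc.1 hc'.1) fun n hn hnv => ?_)
  rw [inner_sub_right, hc.2 n hn hnv, hc'.2 n hn hnv, sub_self]

end IsRep

theorem IsFace.zero_eq_singleton {G F : Set 𝔼[d]} (hF : IsFace G 0 F) {v : 𝔼[d]} (hv : v ∈ F) :
    F = {v} := by
  have h0 := Submodule.finrank_eq_zero.1 hF.2.2
  rw [vectorSpan_eq_bot_iff_subsingleton] at h0
  exact h0.eq_singleton_of_mem hv

theorem tan_half_eq {a : ℝ} (h0 : 0 < a) (hpi : a < Real.pi) :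
    Real.tan (a / 2) = Real.sin a / (1 + Real.cos a) := by
  have hc : 0 < Real.cos (a / 2) := Real.cos_pos_of_mem_Ioo ⟨by linarith, by linarith⟩
  have h1 : Real.sin a = 2 * Real.sin (a / 2) * Real.cos (a / 2) := by
    rw [← Real.sin_two_mul]; ring_nf
  have h2 : Real.cos a = 2 * Real.cos (a / 2) ^ 2 - 1 := by
    rw [← Real.cos_two_mul]; ring_nf
  rw [h1, h2, Real.tan_eq_sin_div_cos]
  field_simp
  ring

namespace IsEquiangularPolytope

variable {α : ℕ → ℝ} {m : ℕ} {G : Set 𝔼[d]}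

/-- The two normals at a ridge of an equiangular polytope, and the normal of the ridge in one of
its facets. -/
theorem normal_add_tan_smul (h : IsEquiangularPolytope α (m + 2) G) {V : Submodule ℝ 𝔼[d]} {p : 𝔼[d]}
    {s : Finset 𝔼[d]} {b : 𝔼[d] → ℝ} (hr : IsRep G V p s b) {n n' ν : 𝔼[d]} (hn : n ∈ s) (hn' : n' ∈ s)
    (hne : n' ≠ n) (hR : IsFace G m (facet G b n ∩ facet G b n'))
    (hν : IsInnerUnitNormal (facet G b n) (facet G b n ∩ facet G b n') ν) :
    n' = Real.cos (α (m + 2)) • n + Real.sin (α (m + 2)) • ν ∧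
    n + Real.tan (α (m + 2) / 2) • ν = (1 + Real.cos (α (m + 2)))⁻¹ • (n + n') := by
  have hV := hr.vectorSpan_eq
  have hm : Module.finrank ℝ V = m + 2 := by rw [← hV]; exact h.finrank_eq
  have ha := h.mem_Ioo (m + 2)
  have hG : IsFace G (m + 2) G := hm ▸ hr.isFace_self
  have hcos := h.isEquiangular (m + 2) (by omega) le_rfl G hG (facet G b n) (facet G b n')
    (hr.isFace_facet hn hm) (hr.isFace_facet hn' hm)
    (fun he => hne (hr.facet_injOn hn' hn he.symm)) hR n n' (hr.isInnerUnitNormal_facet hn)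
    (hr.isInnerUnitNormal_facet hn')
  have hsin := Real.sin_pos_of_mem_Ioo ha
  have key := hr.normal_eq_of_inner_eq_cos hm hn hn' hne hR hν hcos hsin
  refine ⟨key, ?_⟩
  have hc : 0 < 1 + Real.cos (α (m + 2)) := by
    have h2 : Real.cos (α (m + 2)) ^ 2 < 1 := by
      have := Real.sin_sq_add_cos_sq (α (m + 2)); nlinarith
    nlinarith
  rw [tan_half_eq ha.1 ha.2]
  rw [key]
  rw [← add_assoc]
  have : n + Real.cos (α (m + 2)) • n = (1 + Real.cos (α (m + 2))) • n := by
    rw [add_smul, one_smul]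
  rw [this, smul_add, smul_smul, smul_smul, inv_mul_cancel₀ hc.ne', one_smul, div_eq_inv_mul]

/-- The vertices of a dimension-wise equiangular polytope have centers, and these are compatible
with those of the facets. -/
theorem exists_isCenter (m : ℕ) : ∀ (G : Set 𝔼[d]), IsEquiangularPolytope α m G →
    ∀ v, IsFace G 0 {v} → ∃ c, IsCenter G v c ∧ ∀ k, m = k + 1 → ∀ F, IsFace G k F → v ∈ F →
      ∀ N c', IsInnerUnitNormal G F N → IsCenter F v c' → c = N + Real.tan (α m / 2) • c' := by
  classical
  induction m using Nat.strong_induction_on with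
  | _ m ih =>
  intro G h v hv
  obtain ⟨p, s, b, hr⟩ := h.exists_rep
  have hvG : v ∈ G := hv.subset rfl
  have hm := h.finrank_eq
  rcases Nat.eq_zero_or_pos m with hm0 | hmpos
  · subst hm0
    refine ⟨0, (hr.isCenter_iff hvG).2 ⟨zero_mem _, fun n hn _ => ?_⟩, fun k hk => by omega⟩
    have := hr.finrank_pos hn
    omega
  obtain ⟨k, rfl⟩ : ∃ k, m = k + 1 := ⟨m - 1, by omega⟩
  have hfv : ∀ n ∈ s, inner ℝ n v = b n → IsFace (facet G b n) 0 {v} := fun n hn hnv =>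
    hv.mono (fun _ hx => hx.1) (Set.singleton_subset_iff.2 ⟨hvG, hnv⟩)
  have hex : ∀ n, ∃ c, n ∈ s → inner ℝ n v = b n → IsCenter (facet G b n) v c ∧
      ∀ j, k = j + 1 → ∀ F, IsFace (facet G b n) j F → v ∈ F →
      ∀ N c', IsInnerUnitNormal (facet G b n) F N → IsCenter F v c' →
        c = N + Real.tan (α k / 2) • c' := by
    intro n
    by_cases hn : n ∈ s ∧ inner ℝ n v = b n
    · obtain ⟨c, hc⟩ := ih k (by omega) _ (h.face (hr.isFace_facet hn.1 hm)) v (hfv n hn.1 hn.2)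
      exact ⟨c, fun _ _ => hc⟩
    · exact ⟨0, fun h1 h2 => absurd ⟨h1, h2⟩ hn⟩
  choose c hc using hex
  set q : 𝔼[d] → 𝔼[d] := fun n => n + Real.tan (α (k + 1) / 2) • c n with hq
  obtain ⟨i, hi, hiv⟩ : ∃ i ∈ s, inner ℝ i v = b i := by
    have hne : ({v} : Set 𝔼[d]) ≠ G := by
      intro he
      have h1 : Module.finrank ℝ (vectorSpan ℝ ({v} : Set 𝔼[d])) = 0 := hv.2.2
      rw [he] at h1
      omega
    obtain ⟨n, hn, hsub⟩ := hr.exists_subset_facet hv hne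
    exact ⟨n, hn, (hsub rfl).2⟩
  -- `q` takes equal values on adjacent facets, and adjacency connects all facets at `v`. In
  -- dimension one there is only one facet at `v`, namely `{v}`.
  have hconst : ∀ n ∈ s, inner ℝ n v = b n → q n = q i := by
    intro n hn hnv
    rcases Nat.eq_zero_or_pos k with hk0 | hkpos
    · subst hk0
      have h1 := (hr.isFace_facet hn hm).zero_eq_singleton ⟨hvG, hnv⟩
      have h2 := (hr.isFace_facet hi hm).zero_eq_singleton ⟨hvG, hiv⟩
      rw [hr.facet_injOn hn hi (h1.trans h2.symm)]
    · obtain ⟨j, rfl⟩ : ∃ j, k = j + 1 := ⟨k - 1, by omega⟩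
      have hm2 : Module.finrank ℝ (vectorSpan ℝ G) = j + 2 := hm
      refine hr.facets_connected (C := {n | q n = q i}) hm2 hvG hi hiv rfl hn hnv ?_
      intro a ha hav haC a' ha' hav' hne hR
      -- By induction the centre in the facet of `a` is `ν + tan • e`, with `e` the centre in the
      -- ridge. Inserted into `q a`, this gives an expression symmetric in `a` and `a'`.
      have hC : ∀ a ∈ s, ∀ a' ∈ s, inner ℝ a v = b a → inner ℝ a' v = b a' → a' ≠ a →
          IsFace G j (facet G b a ∩ facet G b a') → ∀ e,
          IsCenter (facet G b a ∩ facet G b a') v e →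
          q a = (1 + Real.cos (α (j + 2)))⁻¹ • (a + a') +
            (Real.tan (α (j + 2) / 2) * Real.tan (α (j + 1) / 2)) • e := by
        intro a ha a' ha' hav hav' hne hR e he
        have hRa := hR.mono (F := facet G b a) (fun _ hx => hx.1) Set.inter_subset_left
        have hFa := hr.isFace_facet ha hm
        obtain ⟨p₁, s₁, b₁, hr₁⟩ := hr.exists_isRep_face hFa
        obtain ⟨ν, hν, hνR⟩ := hr₁.exists_eq_facet hFa.2.2 hRa
        have hνN := hr₁.isInnerUnitNormal_facet hν
        rw [← hνR] at hνN
        have h1 := (hc a ha hav).2 j rfl _ hRa ⟨⟨hvG, hav⟩, hvG, hav'⟩ ν e hνN he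
        have h2 := (h.normal_add_tan_smul hr ha ha' hne hR hνN).2
        change a + Real.tan (α (j + 2) / 2) • c a = _
        rw [h1, smul_add, ← add_assoc, h2, smul_smul]
      obtain ⟨e, he, -⟩ := ih j (by omega) _ (h.face hR) v (hv.mono hR.subset
        (Set.singleton_subset_iff.2 ⟨⟨hvG, hav⟩, hvG, hav'⟩))
      have e1 := hC a ha a' ha' hav hav' hne hR e he
      rw [Set.inter_comm] at hR he
      have e2 := hC a' ha' a ha hav' hav hne.symm hR e he
      change q a' = q i
      rw [← (show q a = q i from haC), e1, e2, add_comm a a']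
  have hcenter : IsCenter G v (q i) := by
    refine (hr.isCenter_iff hvG).2 ⟨?_, fun n hn hnv => ?_⟩
    · refine Submodule.add_mem _ (hr.mem_dir i hi) (Submodule.smul_mem _ _ ?_)
      exact vectorSpan_mono ℝ (fun _ hx => hx.1) (hc i hi hiv).1.1
    · rw [← hconst n hn hnv]
      have h1 : (inner ℝ n n : ℝ) = 1 := by
        rw [real_inner_self_eq_norm_sq, hr.norm_eq n hn, one_pow]
      have h2 := (hr.isInnerUnitNormal_facet hn).inner_eq_zero (hc n hn hnv).1.1
      rw [hq]
      simp only
      rw [inner_add_right, inner_smul_right, h1, h2]; ring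
  refine ⟨q i, hcenter, ?_⟩
  intro k' hk' F hF hvF N c' hN hc'
  obtain rfl : k = k' := by omega
  obtain ⟨n, hn, rfl⟩ := hr.exists_eq_facet hm hF
  rw [hr.eq_of_isInnerUnitNormal_facet hn hN, ← hconst n hn hvF.2]
  obtain ⟨p₁, s₁, b₁, hr₁⟩ := hr.exists_isRep_face hF
  rw [hr₁.isCenter_unique (hfv n hn hvF.2) hc' (hc n hn hvF.2).1]

end IsEquiangularPolytope

/-! ### Inner parallel bodies as hulls of moved vertices -/

/-- The inner parallel body of `G` in its affine hull: the points at distance at least `r` from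
all hyperplanes of facets. -/
def par (G : Set 𝔼[d]) (r : ℝ) : Set 𝔼[d] :=
  {x ∈ G | ∀ F N, IsFace G (Module.finrank ℝ (vectorSpan ℝ G) - 1) F → IsInnerUnitNormal G F N →
    ∀ y ∈ F, r ≤ inner ℝ N (x - y)}

namespace IsRep

variable {G : Set 𝔼[d]} {V : Submodule ℝ 𝔼[d]} {p : 𝔼[d]} {s : Finset 𝔼[d]} {b : 𝔼[d] → ℝ}

theorem mem_par_iff (h : IsRep G V p s b) {r : ℝ} {x : 𝔼[d]} :
    x ∈ par G r ↔ x ∈ G ∧ ∀ n ∈ s, b n + r ≤ inner ℝ n x := by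
  unfold par
  rw [h.vectorSpan_eq]
  refine and_congr_right fun _ => ⟨fun hx n hn => ?_, fun hx F N hF hN y hy => ?_⟩
  · have := h.finrank_pos hn
    obtain ⟨y, hy, hyn, -⟩ := h.sharp n hn
    have := hx _ n (h.isFace_facet hn (by omega)) (h.isInnerUnitNormal_facet hn) y ⟨hy, hyn⟩
    rw [inner_sub_right, hyn] at this
    linarith
  · have hpos : 0 < Module.finrank ℝ V := by
      rw [Module.finrank_pos_iff_exists_ne_zero]
      refine ⟨⟨N, ?_⟩, fun h0 => hN.ne_zero (congrArg Subtype.val h0)⟩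
      rw [← h.vectorSpan_eq]; exact hN.1
    obtain ⟨n, hn, rfl⟩ := h.exists_eq_facet (m := Module.finrank ℝ V - 1) (by omega) hF
    rw [h.eq_of_isInnerUnitNormal_facet hn hN, inner_sub_right, hy.2]
    linarith [hx n hn]

theorem mem_par_iff_of_nonneg (h : IsRep G V p s b) {r : ℝ} (hr : 0 ≤ r) {x : 𝔼[d]} :
    x ∈ par G r ↔ x - p ∈ V ∧ ∀ n ∈ s, b n + r ≤ inner ℝ n x := by
  rw [h.mem_par_iff, h.mem_iff]
  exact ⟨fun hx => ⟨hx.1.1, hx.2⟩,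
    fun hx => ⟨⟨hx.1, fun n hn => by linarith [hx.2 n hn]⟩, hx.2⟩⟩

theorem par_zero (h : IsRep G V p s b) : par G 0 = G := by
  ext x
  rw [h.mem_par_iff]
  exact ⟨fun hx => hx.1, fun hx => ⟨hx, fun n hn => by rw [add_zero]; exact h.le hx hn⟩⟩

theorem convex_par (h : IsRep G V p s b) (r : ℝ) : Convex ℝ (par G r) := by
  intro x hx y hy u w hu hw huw
  rw [h.mem_par_iff] at hx hy ⊢
  refine ⟨h.convex hx.1 hy.1 hu hw huw, fun n hn => ?_⟩
  rw [inner_add_right, inner_smul_right, inner_smul_right]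
  have h1 := mul_le_mul_of_nonneg_left (hx.2 n hn) hu
  have h2 := mul_le_mul_of_nonneg_left (hy.2 n hn) hw
  have : b n + r = u * (b n + r) + w * (b n + r) := by rw [← add_mul, huw, one_mul]
  linarith

theorem isClosed_par (h : IsRep G V p s b) (r : ℝ) : IsClosed (par G r) := by
  have : par G r = G ∩ ⋂ n ∈ s, {x | b n + r ≤ inner ℝ n x} := by
    ext x; simp [h.mem_par_iff]
  rw [this]
  exact h.isClosed.inter (isClosed_biInter fun n _ => isClosed_le (by fun_prop) (by fun_prop))

/-- A compact polytope contains no ray. -/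
theorem exists_inner_neg (h : IsRep G V p s b) (hc : IsCompact G) {u : 𝔼[d]} (hu : u ∈ V)
    (hu0 : u ≠ 0) : ∃ n ∈ s, (inner ℝ n u : ℝ) < 0 := by
  by_contra hcon
  push Not at hcon
  obtain ⟨C, hC⟩ := hc.isBounded.exists_norm_le
  have hray : ∀ t : ℝ, 0 ≤ t → p + t • u ∈ G := by
    intro t ht
    refine (h.mem_iff _).2 ⟨by simpa using V.smul_mem t hu, fun n hn => ?_⟩
    rw [inner_add_right, inner_smul_right]
    have := mul_nonneg ht (hcon n hn)
    linarith [h.lt n hn]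
  have hun : 0 < ‖u‖ := norm_pos_iff.2 hu0
  have hp := hC p h.base_mem
  have hCp : 0 ≤ C := (norm_nonneg p).trans hp
  have h1 := hC _ (hray ((2 * C + 1) / ‖u‖) (by positivity))
  have h2 : ‖((2 * C + 1) / ‖u‖) • u‖ = 2 * C + 1 := by
    rw [norm_smul, Real.norm_eq_abs, abs_of_nonneg (by positivity)]
    field_simp
  have h3 : ‖((2 * C + 1) / ‖u‖) • u‖ ≤ ‖p + ((2 * C + 1) / ‖u‖) • u‖ + ‖p‖ := by
    have := norm_sub_le (p + ((2 * C + 1) / ‖u‖) • u) p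
    rwa [add_sub_cancel_left] at this
  linarith

/-- A ray from a point of a parallel body leaves it through a facet. -/
theorem exists_exit (h : IsRep G V p s b) (hc : IsCompact G) {r : ℝ} (hr : 0 ≤ r) {x u : 𝔼[d]}
    (hx : x ∈ par G r) (hu : u ∈ V) (hu0 : u ≠ 0) :
    ∃ τ : ℝ, 0 ≤ τ ∧ x + τ • u ∈ par G r ∧ ∃ n ∈ s, inner ℝ n (x + τ • u) = b n + r := by
  classical
  have hx' := (h.mem_par_iff_of_nonneg hr).1 hx
  obtain ⟨n₀, hn₀, hn₀u⟩ := h.exists_inner_neg hc hu hu0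
  obtain ⟨n, hn, hmin⟩ := (s.filter (fun n => (inner ℝ n u : ℝ) < 0)).exists_min_image
    (fun n => ((inner ℝ n x : ℝ) - b n - r) / (-(inner ℝ n u : ℝ)))
    ⟨n₀, Finset.mem_filter.2 ⟨hn₀, hn₀u⟩⟩
  rw [Finset.mem_filter] at hn
  have hn' : 0 < -(inner ℝ n u : ℝ) := by linarith [hn.2]
  set τ : ℝ := ((inner ℝ n x : ℝ) - b n - r) / (-(inner ℝ n u : ℝ)) with hτ
  have hτ0 : 0 ≤ τ := div_nonneg (by linarith [hx'.2 n hn.1]) hn'.le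
  refine ⟨τ, hτ0, (h.mem_par_iff_of_nonneg hr).2 ⟨?_, fun k hk => ?_⟩, n, hn.1, ?_⟩
  · have := V.add_mem hx'.1 (V.smul_mem τ hu)
    rwa [sub_add_eq_add_sub] at this
  · rw [inner_add_right, inner_smul_right]
    by_cases hku : (inner ℝ k u : ℝ) < 0
    · have h1 := hmin k (Finset.mem_filter.2 ⟨hk, hku⟩)
      have hk' : 0 < -(inner ℝ k u : ℝ) := by linarith
      rw [le_div_iff₀ hk'] at h1
      linarith
    · have := mul_nonneg hτ0 (not_lt.1 hku)
      linarith [hx'.2 k hk]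
  · rw [inner_add_right, inner_smul_right]
    have : τ * -(inner ℝ n u : ℝ) = (inner ℝ n x : ℝ) - b n - r := by
      rw [hτ, div_mul_cancel₀ _ hn'.ne']
    linarith

theorem finite_vertices (h : IsRep G V p s b) : {v : 𝔼[d] | IsFace G 0 {v}}.Finite :=
  (h.finite_faces 0).preimage Set.singleton_injective.injOn

end IsRep

namespace IsEquiangularPolytope

variable {α : ℕ → ℝ} {m : ℕ} {G : Set 𝔼[d]}

theorem tan_pos (h : IsEquiangularPolytope α m G) (k : ℕ) : 0 < Real.tan (α k / 2) := by
  have := h.mem_Ioo k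
  exact Real.tan_pos_of_pos_of_lt_pi_div_two (by linarith [this.1]) (by linarith [this.2])

/-- Slices of the parallel body near a facet are contained in parallel bodies of the facet. -/
theorem sub_smul_mem_par_facet (h : IsEquiangularPolytope α (m + 1) G) {V : Submodule ℝ 𝔼[d]}
    {p : 𝔼[d]} {s : Finset 𝔼[d]} {b : 𝔼[d] → ℝ} (hr : IsRep G V p s b) {n : 𝔼[d]} (hn : n ∈ s) {r : ℝ}
    (h0 : 0 ≤ r) {x : 𝔼[d]} (hx : x ∈ par G r) (hxn : inner ℝ n x = b n + r) :
    x - r • n ∈ par (facet G b n) (Real.tan (α (m + 1) / 2) * r) := by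
  have hV := hr.vectorSpan_eq
  have hm : Module.finrank ℝ V = m + 1 := by rw [← hV]; exact h.finrank_eq
  have hF := hr.isFace_facet hn hm
  obtain ⟨p₁, s₁, b₁, hr₁⟩ := hr.exists_isRep_face hF
  have hx' := hr.mem_par_iff.1 hx
  have ht := h.tan_pos (m + 1)
  have hnn : (inner ℝ n n : ℝ) = 1 := by rw [real_inner_self_eq_norm_sq, hr.norm_eq n hn, one_pow]
  rw [hr₁.mem_par_iff_of_nonneg (mul_nonneg ht.le h0)]
  constructor
  · rw [hr.vectorSpan_facet hn, mem_inf_orthogonal_singleton]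
    have hp₁ := hr₁.base_mem
    constructor
    · have := V.sub_mem (hr.sub_mem hx'.1 hp₁.1) (V.smul_mem r (hr.mem_dir n hn))
      rwa [sub_right_comm] at this
    · rw [inner_sub_right, inner_sub_right, inner_smul_right, hxn, hp₁.2, hnn]; ring
  · intro ν hν
    obtain ⟨j, rfl⟩ : ∃ j, m = j + 1 := by
      have := hr₁.finrank_pos hν
      rw [hF.2.2] at this
      exact ⟨m - 1, by omega⟩
    have hR := hr₁.isFace_facet hν hF.2.2
    have hνN := hr₁.isInnerUnitNormal_facet hν
    -- A facet of the facet is a ridge of `G`, so a constraint of the facet comes from one further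
    -- facet of `G`.
    obtain ⟨n', hn', hne, he⟩ := hr.exists_ridge_eq hm hn (hr.isFace_trans hF hR) hR.subset
    obtain ⟨y, hy⟩ := hR.1
    have hyν := hy.2
    rw [he] at hR hνN hy
    have key := (h.normal_add_tan_smul hr hn hn' hne
      (hr.isFace_trans hF hR) hνN).1
    have hνn : (inner ℝ ν n : ℝ) = 0 := by
      have := hνN.1
      rw [hr.vectorSpan_facet hn, mem_inf_orthogonal_singleton] at this
      rw [real_inner_comm]; exact this.2
    have ha := h.mem_Ioo (j + 1 + 1)
    have hsin := Real.sin_pos_of_mem_Ioo ha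
    have hsc := Real.sin_sq_add_cos_sq (α (j + 1 + 1))
    have hc : 0 < 1 + Real.cos (α (j + 1 + 1)) := by nlinarith
    have htan := tan_half_eq ha.1 ha.2
    have h1 := hx'.2 n' hn'
    rw [← hy.2.2] at h1
    have h2 : (inner ℝ n' (x - y) : ℝ) = Real.cos (α (j + 1 + 1)) * inner ℝ n (x - y) +
        Real.sin (α (j + 1 + 1)) * inner ℝ ν (x - y) := by
      have := congrArg (fun z => (inner ℝ z (x - y) : ℝ)) key
      simpa [inner_add_left, inner_smul_left] using this
    rw [inner_sub_right n', inner_sub_right n, hxn, hy.1.2, inner_sub_right ν, hyν] at h2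
    rw [inner_sub_right, inner_smul_right, hνn, mul_zero, sub_zero, htan]
    -- Since `tan (α/2) * sin α = 1 - cos α`, the inequality `r ≤ ⟪n', x - y⟫ = r * cos α + sin α *
    -- ⟪ν, x - y⟫` says that `⟪ν, x - y⟫` is at least `tan (α/2) * r`.
    have h3 : Real.sin (α (j + 1 + 1)) / (1 + Real.cos (α (j + 1 + 1))) *
        Real.sin (α (j + 1 + 1)) = 1 - Real.cos (α (j + 1 + 1)) := by
      field_simp; nlinarith
    have h4 : Real.sin (α (j + 1 + 1)) * (Real.sin (α (j + 1 + 1)) /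
        (1 + Real.cos (α (j + 1 + 1))) * r) ≤
        Real.sin (α (j + 1 + 1)) * (inner ℝ ν x - b₁ ν) := by
      have : Real.sin (α (j + 1 + 1)) * (Real.sin (α (j + 1 + 1)) /
        (1 + Real.cos (α (j + 1 + 1))) * r) = (1 - Real.cos (α (j + 1 + 1))) * r := by
        rw [← h3]; ring
      rw [this]
      linarith
    have := le_of_mul_le_mul_left h4 hsin
    linarith

/-- The positions of the vertices after all facets have moved by `r`. -/
def movedVertices (G : Set 𝔼[d]) (r : ℝ) : Set 𝔼[d] :=
  {w | ∃ v c, IsFace G 0 {v} ∧ IsCenter G v c ∧ w = v + r • c}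

/-- At `v + r • c` the shifted constraints active at `v` hold with equality, and the strict ones
survive for small `r`; there are finitely many vertices and constraints. -/
theorem eventually_movedVertices_subset (h : IsEquiangularPolytope α m G) :
    ∀ᶠ r in nhdsWithin (0 : ℝ) (Set.Ici 0), movedVertices G r ⊆ par G r := by
  obtain ⟨p, s, b, hr⟩ := h.exists_rep
  have h1 : ∀ᶠ r in nhdsWithin (0 : ℝ) (Set.Ici 0), ∀ v ∈ {v : 𝔼[d] | IsFace G 0 {v}},
      ∀ c, IsCenter G v c → v + r • c ∈ par G r := by
    refine (Filter.eventually_all_finite hr.finite_vertices).2 fun v hv => ?_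
    have hvG : v ∈ G := hv.subset rfl
    obtain ⟨c, hc, -⟩ := exists_isCenter m G h v hv
    have hcV := (hr.isCenter_iff hvG).1 hc
    have h2 : ∀ᶠ r in nhdsWithin (0 : ℝ) (Set.Ici 0), ∀ n ∈ s, b n + r ≤ inner ℝ n (v + r • c) := by
      refine (Filter.eventually_all_finset s).2 fun n hn => ?_
      rcases (hr.le hvG hn).lt_or_eq with hlt | heq
      · have hcont : Continuous fun r : ℝ => (inner ℝ n (v + r • c) : ℝ) - (b n + r) := by fun_prop
        have h3 := hcont.tendsto 0
        simp only [zero_smul, add_zero] at h3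
        filter_upwards [(h3.mono_left nhdsWithin_le_nhds).eventually
          (lt_mem_nhds (sub_pos.2 hlt))] with r hr'
        linarith
      · refine Filter.Eventually.of_forall fun r => ?_
        rw [inner_add_right, inner_smul_right, hcV.2 n hn heq.symm, heq, mul_one]
    filter_upwards [h2, self_mem_nhdsWithin] with r h3 h4 c' hc'
    rw [hr.isCenter_unique hv hc' hc, hr.mem_par_iff_of_nonneg h4]
    refine ⟨?_, h3⟩
    have := (vectorSpan ℝ G).add_mem (hr.sub_mem hvG hr.base_mem)
      ((vectorSpan ℝ G).smul_mem r hcV.1)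
    rwa [sub_add_eq_add_sub] at this
  filter_upwards [h1] with r hr'
  rintro _ ⟨v, c, hv, hc, rfl⟩
  exact hr' v hv c hc

/-- By the relation between the centres of `v` in `G` and in the facet, a moved vertex of the facet,
pushed by `r • n`, is a moved vertex of `G`. -/
theorem add_smul_mem_convexHull (h : IsEquiangularPolytope α (m + 1) G) {V : Submodule ℝ 𝔼[d]}
    {p : 𝔼[d]} {s : Finset 𝔼[d]} {b : 𝔼[d] → ℝ} (hr : IsRep G V p s b) {n : 𝔼[d]} (hn : n ∈ s) {r : ℝ}
    {y : 𝔼[d]} (hy : y ∈ convexHull ℝ (movedVertices (facet G b n) (Real.tan (α (m + 1) / 2) * r))) :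
    y + r • n ∈ convexHull ℝ (movedVertices G r) := by
  have hm : Module.finrank ℝ V = m + 1 := by rw [← hr.vectorSpan_eq]; exact h.finrank_eq
  have hconv : Convex ℝ ((fun z => z + r • n) ⁻¹' convexHull ℝ (movedVertices G r)) :=
    (convex_convexHull ℝ _).translate_preimage_left (r • n)
  refine convexHull_min ?_ hconv hy
  rintro _ ⟨v, c, hv, hc, rfl⟩
  have hF := hr.isFace_facet hn hm
  have hvG := hr.isFace_trans hF hv
  obtain ⟨e, he, he'⟩ := exists_isCenter (m + 1) G h v hvG
  have := he' m rfl _ hF (hv.subset rfl) n c (hr.isInnerUnitNormal_facet hn) hc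
  apply subset_convexHull
  refine ⟨v, e, hvG, he, ?_⟩
  rw [this, smul_add, smul_smul]
  simp only
  rw [mul_comm r, add_assoc, add_comm _ (r • n)]

theorem tendsto_tan_mul (h : IsEquiangularPolytope α m G) (k : ℕ) :
    Filter.Tendsto (fun r => Real.tan (α k / 2) * r) (nhdsWithin (0 : ℝ) (Set.Ici 0))
      (nhdsWithin (0 : ℝ) (Set.Ici 0)) := by
  refine tendsto_nhdsWithin_iff.2 ⟨?_, ?_⟩
  · have : Continuous fun r => Real.tan (α k / 2) * r := by fun_prop
    have h1 := this.tendsto 0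
    rw [mul_zero] at h1
    exact h1.mono_left nhdsWithin_le_nhds
  · filter_upwards [self_mem_nhdsWithin] with r hr
    exact mul_nonneg (h.tan_pos k).le hr

/-- A point lies between the two exit points of a line through it. Each exit point is in the slice
at some facet, which is contained in a translated parallel body of that facet, so induction on the
dimension applies. -/
theorem eventually_par_subset (m : ℕ) : ∀ G : Set 𝔼[d], IsEquiangularPolytope α m G →
    ∀ᶠ r in nhdsWithin (0 : ℝ) (Set.Ici 0), par G r ⊆ convexHull ℝ (movedVertices G r) := by
  induction m with
  | zero =>
    intro G h
    refine Filter.Eventually.of_forall fun r x hx => ?_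
    obtain ⟨p, s, b, hr⟩ := h.exists_rep
    have hxG := hx.1
    have hG : IsFace G 0 G := by
      have := hr.isFace_self
      rwa [h.finrank_eq] at this
    have hGx := hG.zero_eq_singleton hxG
    have hv : IsFace G 0 {x} := hGx ▸ hG
    obtain ⟨c, hc, -⟩ := exists_isCenter 0 G h x hv
    have hc0 : c = 0 := by
      have h1 := hc.1
      rw [Submodule.finrank_eq_zero.1 h.finrank_eq] at h1
      exact h1
    apply subset_convexHull
    exact ⟨x, c, hv, hc, by rw [hc0]; simp⟩
  | succ m ih =>
    intro G h
    obtain ⟨p, s, b, hr⟩ := h.exists_rep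
    have hm := h.finrank_eq
    have h1 : ∀ᶠ r in nhdsWithin (0 : ℝ) (Set.Ici 0), ∀ n ∈ s,
        par (facet G b n) (Real.tan (α (m + 1) / 2) * r) ⊆
          convexHull ℝ (movedVertices (facet G b n) (Real.tan (α (m + 1) / 2) * r)) :=
      (Filter.eventually_all_finset s).2 fun n hn =>
        (h.tendsto_tan_mul (m + 1)).eventually (ih _ (h.face (hr.isFace_facet hn hm)))
    filter_upwards [h1, self_mem_nhdsWithin] with r hr1 hr0 x hx
    have hexit : ∀ u ∈ vectorSpan ℝ G, u ≠ 0 → ∃ τ : ℝ, 0 ≤ τ ∧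
        x + τ • u ∈ convexHull ℝ (movedVertices G r) := by
      intro u hu hu0
      obtain ⟨τ, hτ, hmem, n, hn, hnx⟩ := hr.exists_exit h.isCompact hr0 hx hu hu0
      refine ⟨τ, hτ, ?_⟩
      have := h.add_smul_mem_convexHull hr hn
        (hr1 n hn (h.sub_smul_mem_par_facet hr hn hr0 hmem hnx))
      rwa [sub_add_cancel] at this
    have hpos : 0 < Module.finrank ℝ (vectorSpan ℝ G) := by omega
    obtain ⟨⟨u, hu⟩, hu0⟩ := Module.finrank_pos_iff_exists_ne_zero.1 hpos
    have hu0' : u ≠ 0 := fun h0 => hu0 (Subtype.ext h0)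
    obtain ⟨τ, hτ, h2⟩ := hexit u hu hu0'
    obtain ⟨σ, hσ, h3⟩ := hexit (-u) (Submodule.neg_mem _ hu) (neg_ne_zero.2 hu0')
    rcases hτ.eq_or_lt with h0 | hτ'
    · rw [← h0] at h2; simpa using h2
    have hsum : 0 < σ + τ := by linarith
    have h4 := (convex_convexHull ℝ (movedVertices G r)) h2 h3
      (a := σ / (σ + τ)) (b := τ / (σ + τ)) (by positivity) (by positivity) (by field_simp)
    have : (σ / (σ + τ)) • (x + τ • u) + (τ / (σ + τ)) • (x + σ • -u) = x := by
      have e1 : (σ / (σ + τ)) • (x + τ • u) + (τ / (σ + τ)) • (x + σ • -u) =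
          (σ / (σ + τ) + τ / (σ + τ)) • x +
            (σ / (σ + τ) * τ - τ / (σ + τ) * σ) • u := by module
      have e2 : σ / (σ + τ) + τ / (σ + τ) = 1 := by field_simp
      have e3 : σ / (σ + τ) * τ - τ / (σ + τ) * σ = 0 := by ring
      rw [e1, e2, e3]; simp
    rwa [this] at h4

/-- For small `r`, the slice of the parallel body near a facet is a translate of a parallel body
of the facet. -/
theorem eventually_slice (h : IsEquiangularPolytope α (m + 1) G) {V : Submodule ℝ 𝔼[d]}
    {p : 𝔼[d]} {s : Finset 𝔼[d]} {b : 𝔼[d] → ℝ} (hr : IsRep G V p s b) {n : 𝔼[d]} (hn : n ∈ s) :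
    ∀ᶠ r in nhdsWithin (0 : ℝ) (Set.Ici 0), ∀ x, x ∈ par G r ∧ inner ℝ n x = b n + r ↔
      x - r • n ∈ par (facet G b n) (Real.tan (α (m + 1) / 2) * r) := by
  have hm : Module.finrank ℝ V = m + 1 := by rw [← hr.vectorSpan_eq]; exact h.finrank_eq
  have hF := h.face (hr.isFace_facet hn hm)
  filter_upwards [h.eventually_movedVertices_subset,
    (h.tendsto_tan_mul (m + 1)).eventually (eventually_par_subset m _ hF),
    self_mem_nhdsWithin] with r h1 h2 h0 x
  refine ⟨fun hx => h.sub_smul_mem_par_facet hr hn h0 hx.1 hx.2, fun hx => ⟨?_, ?_⟩⟩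
  · have h3 := h.add_smul_mem_convexHull hr hn (h2 hx)
    rw [sub_add_cancel] at h3
    exact convexHull_min h1 (hr.convex_par r) h3
  · have h3 := hx.1.2
    rw [inner_sub_right, inner_smul_right, real_inner_self_eq_norm_sq, hr.norm_eq n hn] at h3
    linarith

end IsEquiangularPolytope

/-! ### Cavalieri's principle and the collar decomposition -/

theorem isometry_add_coe (V : Submodule ℝ 𝔼[d]) (p : 𝔼[d]) : Isometry (fun v : V => p + (v : 𝔼[d])) :=
  (isometry_vadd 𝔼[d] p).comp isometry_subtype_coe

theorem image_preimage_add_coe {V : Submodule ℝ 𝔼[d]} {p : 𝔼[d]} {A : Set 𝔼[d]}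
    (hA : ∀ x ∈ A, x - p ∈ V) :
    (fun v : V => p + (v : 𝔼[d])) '' ((fun v : V => p + (v : 𝔼[d])) ⁻¹' A) = A := by
  refine Set.image_preimage_eq_of_subset fun x hx => ?_
  exact ⟨⟨x - p, hA x hx⟩, by simp⟩

/-- Cavalieri's principle in an affine subspace. -/
theorem euclideanHausdorffMeasure_eq_lintegral_slice {V : Submodule ℝ 𝔼[d]} {m : ℕ}
    (hm : Module.finrank ℝ V = m + 1) {p N : 𝔼[d]} (hN : N ∈ V) (hN1 : ‖N‖ = 1) {A : Set 𝔼[d]}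
    (hA : ∀ x ∈ A, x - p ∈ V) (hAm : MeasurableSet A) :
    μHE[m + 1] A = ∫⁻ t : ℝ, μHE[m] {x ∈ A | inner ℝ N x = t} := by
  set f : V → 𝔼[d] := fun v => p + (v : 𝔼[d]) with hf
  have hiso : Isometry f := isometry_add_coe V p
  have hA' : f '' (f ⁻¹' A) = A := image_preimage_add_coe hA
  have hN0 : (⟨N, hN⟩ : V) ≠ 0 := by
    intro h0
    have : N = 0 := congrArg Subtype.val h0
    rw [this, norm_zero] at hN1
    exact zero_ne_one hN1
  have key := EuclideanGeometry.euclideanHausdorffMeasure_eq_lintegral (P := V) (0 : V) hN0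
    (hiso.continuous.measurable hAm)
  have hn1 : ‖(⟨N, hN⟩ : V)‖ₑ = 1 := by
    rw [← ofReal_norm, Submodule.coe_norm, hN1, ENNReal.ofReal_one]
  rw [hm, Nat.add_sub_cancel, hn1, one_mul, ← hiso.euclideanHausdorffMeasure_image, hA'] at key
  rw [key, ← lintegral_add_right_eq_self (fun t => μHE[m] {x ∈ A | inner ℝ N x = t}) (inner ℝ N p)]
  congr with x
  rw [← hiso.euclideanHausdorffMeasure_image]
  congr 1
  have hNN : (inner ℝ N N : ℝ) = 1 := by rw [real_inner_self_eq_norm_sq, hN1, one_pow]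
  have hmem : ∀ v : V, v ∈ AffineSubspace.mk' (x • (⟨N, hN⟩ : V) +ᵥ (0 : V)) (ℝ ∙ (⟨N, hN⟩ : V))ᗮ ↔
      inner ℝ N (p + (v : 𝔼[d])) = x + inner ℝ N p := by
    intro v
    rw [AffineSubspace.mem_mk', Submodule.mem_orthogonal_singleton_iff_inner_right,
      Submodule.coe_inner]
    simp only [vadd_eq_add, add_zero, vsub_eq_sub, Submodule.coe_sub, Submodule.coe_smul]
    rw [inner_sub_right, inner_smul_right, hNN, inner_add_right]
    constructor <;> intro h <;> linarith
  ext y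
  constructor
  · rintro ⟨v, ⟨hv, hv'⟩, rfl⟩
    exact ⟨hv, (hmem v).1 hv'⟩
  · rintro ⟨hy, hy'⟩
    have hyp : p + (y - p) = y := add_sub_cancel p y
    refine ⟨⟨y - p, hA y hy⟩, ⟨?_, (hmem _).2 ?_⟩, hyp⟩
    · change p + (y - p) ∈ A
      rwa [hyp]
    · simp only
      rw [hyp]; exact hy'

theorem euclideanHausdorffMeasure_lt_top {V : Submodule ℝ 𝔼[d]} {m : ℕ}
    (hm : Module.finrank ℝ V = m) {p : 𝔼[d]} {A : Set 𝔼[d]} (hA : ∀ x ∈ A, x - p ∈ V)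
    (hc : IsCompact A) : μHE[m] A < ⊤ := by
  have hiso := isometry_add_coe V p
  rw [← image_preimage_add_coe hA, hiso.euclideanHausdorffMeasure_image, ← hm,
    InnerProductSpace.euclideanHausdorffMeasure_eq_volume]
  exact (hiso.isClosedEmbedding.isCompact_preimage hc).measure_lt_top

/-- Balls of `V` have finite measure in the dimension of `V`, hence measure zero in any larger one,
and countably many of them cover `V`. -/
theorem euclideanHausdorffMeasure_eq_zero {V : Submodule ℝ 𝔼[d]} {m : ℕ}
    (hm : Module.finrank ℝ V < m) {p : 𝔼[d]} {A : Set 𝔼[d]} (hA : ∀ x ∈ A, x - p ∈ V) :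
    μHE[m] A = 0 := by
  have hiso := isometry_add_coe V p
  rw [← image_preimage_add_coe hA, hiso.euclideanHausdorffMeasure_image]
  refine measure_mono_null (Set.subset_univ _) ?_
  rw [← Metric.iUnion_closedBall_nat (0 : V)]
  refine measure_iUnion_null fun i => ?_
  refine (Measure.euclideanHausdorffMeasure_zero_or_top hm _).resolve_right ?_
  rw [InnerProductSpace.euclideanHausdorffMeasure_eq_volume]
  exact (isCompact_closedBall (0 : V) (i : ℝ)).measure_lt_top.ne

namespace IsRep

variable {G : Set 𝔼[d]} {V : Submodule ℝ 𝔼[d]} {p : 𝔼[d]} {s : Finset 𝔼[d]} {b : 𝔼[d] → ℝ}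

/-- The part of `G` that is closest to the facet with normal `n`, at distance less than `r`. -/
def collar (G : Set 𝔼[d]) (s : Finset 𝔼[d]) (b : 𝔼[d] → ℝ) (r : ℝ) (n : 𝔼[d]) : Set 𝔼[d] :=
  {x ∈ G | inner ℝ n x - b n < r ∧ ∀ n' ∈ s, (inner ℝ n x : ℝ) - b n ≤ inner ℝ n' x - b n'}

theorem measurableSet_collar (h : IsRep G V p s b) (r : ℝ) (n : 𝔼[d]) :
    MeasurableSet (collar G s b r n) := by
  have : collar G s b r n = G ∩ ({x | (inner ℝ n x : ℝ) - b n < r} ∩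
      ⋂ n' ∈ s, {x | (inner ℝ n x : ℝ) - b n ≤ inner ℝ n' x - b n'}) := by
    ext x
    simp only [collar, Set.mem_ofPred_eq, Set.mem_inter_iff, Set.mem_iInter]
  rw [this]
  refine h.isClosed.measurableSet.inter ((isOpen_lt (by fun_prop) (by fun_prop)).measurableSet.inter
    (IsClosed.measurableSet ?_))
  exact isClosed_biInter fun n' _ => isClosed_le (by fun_prop) (by fun_prop)

theorem eq_par_union_collar (h : IsRep G V p s b) (r : ℝ) :
    G = par G r ∪ ⋃ n ∈ s, collar G s b r n := by
  ext x
  simp only [Set.mem_union, Set.mem_iUnion, h.mem_par_iff]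
  constructor
  · intro hx
    by_cases hp : ∀ n ∈ s, b n + r ≤ inner ℝ n x
    · exact Or.inl ⟨hx, hp⟩
    · push Not at hp
      obtain ⟨n₀, hn₀, hlt⟩ := hp
      obtain ⟨n, hn, hmin⟩ := s.exists_min_image (fun n => (inner ℝ n x : ℝ) - b n) ⟨n₀, hn₀⟩
      exact Or.inr ⟨n, hn, hx, by linarith [hmin n₀ hn₀], hmin⟩
  · rintro (hx | ⟨n, _, hx⟩)
    · exact hx.1
    · exact hx.1

/-- On the overlap the distances to the two hyperplanes agree. As the normals differ, this confines
it to a set of codimension one. -/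
theorem collar_inter_null (h : IsRep G V p s b) {m : ℕ} (hm : Module.finrank ℝ V = m + 1)
    {r : ℝ} {n n' : 𝔼[d]} (hn : n ∈ s) (hn' : n' ∈ s) (hne : n ≠ n') :
    μHE[m + 1] (collar G s b r n ∩ collar G s b r n') = 0 := by
  rcases (collar G s b r n ∩ collar G s b r n').eq_empty_or_nonempty with he | ⟨y, hy⟩
  · rw [he, measure_empty]
  have heq : ∀ x ∈ collar G s b r n ∩ collar G s b r n',
      (inner ℝ (n - n') x : ℝ) = b n - b n' := by
    intro x hx
    have h1 := hx.1.2.2 n' hn'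
    have h2 := hx.2.2.2 n hn
    rw [inner_sub_left]; linarith
  have hd := finrank_inf_orthogonal_singleton (V.sub_mem (h.mem_dir n hn) (h.mem_dir n' hn'))
    (sub_ne_zero.2 hne)
  refine euclideanHausdorffMeasure_eq_zero (V := V ⊓ (ℝ ∙ (n - n'))ᗮ) (p := y) (by omega)
    fun x hx => ?_
  rw [mem_inf_orthogonal_singleton]
  exact ⟨h.sub_mem hx.1.1 hy.1.1, by rw [inner_sub_right, heq x hx, heq y hy, sub_self]⟩

/-- Slicing along `n`: at height `t` above its facet, a point is nearest to that hyperplane exactly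
when it is at distance at least `t` from all the others. -/
theorem measure_collar (h : IsRep G V p s b) {m : ℕ} (hm : Module.finrank ℝ V = m + 1)
    (r : ℝ) {n : 𝔼[d]} (hn : n ∈ s) : μHE[m + 1] (collar G s b r n) =
      ∫⁻ t in Set.Ico 0 r, μHE[m] {x | x ∈ par G t ∧ inner ℝ n x = b n + t} := by
  rw [euclideanHausdorffMeasure_eq_lintegral_slice hm (h.mem_dir n hn) (h.norm_eq n hn)
    (p := p) (fun x hx => ((h.mem_iff x).1 hx.1).1) (h.measurableSet_collar r n),
    ← lintegral_add_right_eq_self _ (b n), ← lintegral_indicator measurableSet_Ico]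
  congr with t
  by_cases ht : t ∈ Set.Ico 0 r
  · rw [Set.indicator_of_mem ht]
    congr 1
    ext x
    simp only [collar, Set.mem_ofPred_eq, h.mem_par_iff]
    constructor
    · rintro ⟨⟨hx, -, hx2⟩, hx3⟩
      exact ⟨⟨hx, fun n' hn' => by linarith [hx2 n' hn']⟩, by linarith⟩
    · rintro ⟨⟨hx, hx2⟩, hx3⟩
      exact ⟨⟨hx, by linarith [ht.2], fun n' hn' => by linarith [hx2 n' hn']⟩, by linarith⟩
  · rw [Set.indicator_of_notMem ht]
    convert measure_empty (μ := μHE[m]) using 2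
    ext x
    simp only [collar, Set.mem_ofPred_eq, Set.mem_empty_iff_false, iff_false]
    rintro ⟨⟨hx, hx2, -⟩, hx3⟩
    exact ht ⟨by linarith [h.le hx hn], by linarith⟩

/-- A polytope decomposes into its parallel body and the collars of its facets. -/
theorem measure_eq_par_add (h : IsRep G V p s b) {m : ℕ} (hm : Module.finrank ℝ V = m + 1)
    (r : ℝ) : μHE[m + 1] G = μHE[m + 1] (par G r) + ∑ n ∈ s,
      ∫⁻ t in Set.Ico 0 r, μHE[m] {x | x ∈ par G t ∧ inner ℝ n x = b n + t} := by
  have hmeas : MeasurableSet (⋃ n ∈ s, collar G s b r n) :=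
    Finset.measurableSet_biUnion s fun n _ => h.measurableSet_collar r n
  have hdisj : Disjoint (par G r) (⋃ n ∈ s, collar G s b r n) := by
    rw [Set.disjoint_left]
    intro x hx hx'
    simp only [Set.mem_iUnion] at hx'
    obtain ⟨n, hn, hx'⟩ := hx'
    have := (h.mem_par_iff.1 hx).2 n hn
    linarith [hx'.2.1]
  conv_lhs => rw [h.eq_par_union_collar r]
  rw [measure_union hdisj hmeas, measure_biUnion_finset₀]
  · congr 1
    exact Finset.sum_congr rfl fun n hn => h.measure_collar hm r hn
  · intro n hn n' hn' hne
    exact h.collar_inter_null hm hn hn' hne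
  · exact fun n _ => (h.measurableSet_collar r n).nullMeasurableSet

end IsRep

/-! ### The volume polynomial -/

/-- The sum of the volumes of the faces of codimension `j` of the `m`-dimensional polytope `G`,
each counted as often as there are complete chains of faces between it and `G`. -/
noncomputable def chainVol : ℕ → ℕ → Set 𝔼[d] → ℝ
  | 0, m, G => vol m G
  | j + 1, m, G => ∑ᶠ F ∈ {F : Set 𝔼[d] | IsFace G (m - 1) F}, chainVol j (m - 1) F

/-- The volume polynomial of the inner parallel bodies. -/
noncomputable def parPoly (α : ℕ → ℝ) (m : ℕ) (G : Set 𝔼[d]) (r : ℝ) : ℝ :=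
  ∑ j ∈ Finset.range (m + 1), (-1 : ℝ) ^ j * chainVol j m G *
    (∏ i ∈ Finset.Ioc (m - j) m, gam m α i) * (r ^ j / (j.factorial : ℝ))

theorem continuous_parPoly (α : ℕ → ℝ) (m : ℕ) (G : Set 𝔼[d]) : Continuous (parPoly α m G) := by
  unfold parPoly; fun_prop

theorem gam_succ (α : ℕ → ℝ) {m i : ℕ} (hi : i ≤ m) :
    gam (m + 1) α i = gam m α i * Real.tan (α (m + 1) / 2) := by
  unfold gam
  rw [Finset.prod_Ioc_succ_top hi]

theorem gam_self (α : ℕ → ℝ) (m : ℕ) : gam m α m = 1 := by simp [gam]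

/-- The power of the tangent comes from rescaling the parameter in the facets. Each of the `j` old
factors absorbs one tangent, and the new factor, of index `m + 1`, is `1`. -/
theorem prod_gam_succ (α : ℕ → ℝ) {m j : ℕ} (hj : j ≤ m) :
    ∏ i ∈ Finset.Ioc (m + 1 - (j + 1)) (m + 1), gam (m + 1) α i =
      (∏ i ∈ Finset.Ioc (m - j) m, gam m α i) * Real.tan (α (m + 1) / 2) ^ j := by
  rw [Nat.add_sub_add_right, Finset.prod_Ioc_succ_top (by omega), gam_self, mul_one]
  have : ∏ i ∈ Finset.Ioc (m - j) m, gam (m + 1) α i =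
      ∏ i ∈ Finset.Ioc (m - j) m, (gam m α i * Real.tan (α (m + 1) / 2)) :=
    Finset.prod_congr rfl fun i hi => gam_succ α (Finset.mem_Ioc.1 hi).2
  rw [this, Finset.prod_mul_distrib, Finset.prod_const, Nat.card_Ioc, Nat.sub_sub_self hj]

theorem integral_parPoly (α : ℕ → ℝ) (m : ℕ) (F : Set 𝔼[d]) (t : ℝ) {r : ℝ} (hr : 0 ≤ r) :
    ∫ τ in Set.Ico 0 r, parPoly α m F (t * τ) = ∑ j ∈ Finset.range (m + 1),
      (-1 : ℝ) ^ j * chainVol j m F * ((∏ i ∈ Finset.Ioc (m - j) m, gam m α i) * t ^ j) *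
        (r ^ (j + 1) / ((j + 1).factorial : ℝ)) := by
  rw [integral_Ico_eq_integral_Ioc, ← intervalIntegral.integral_of_le hr]
  unfold parPoly
  rw [intervalIntegral.integral_finsetSum]
  · refine Finset.sum_congr rfl fun j _ => ?_
    have : (fun τ : ℝ => (-1 : ℝ) ^ j * chainVol j m F *
        (∏ i ∈ Finset.Ioc (m - j) m, gam m α i) * ((t * τ) ^ j / (j.factorial : ℝ))) =
        fun τ => ((-1 : ℝ) ^ j * chainVol j m F *
        ((∏ i ∈ Finset.Ioc (m - j) m, gam m α i) * t ^ j) / (j.factorial : ℝ)) * τ ^ j := by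
      funext τ; rw [mul_pow]; ring
    rw [this, intervalIntegral.integral_const_mul, integral_pow, Nat.factorial_succ]
    have h1 : (j.factorial : ℝ) ≠ 0 := by positivity
    push_cast
    rw [zero_pow (by omega)]
    field_simp
    ring
  · intro j _
    exact (by fun_prop : Continuous _).intervalIntegrable _ _

theorem IsRep.chainVol_succ {G : Set 𝔼[d]} {V : Submodule ℝ 𝔼[d]} {p : 𝔼[d]} {s : Finset 𝔼[d]} {b : 𝔼[d] → ℝ}
    (h : IsRep G V p s b) {m : ℕ} (hm : Module.finrank ℝ V = m + 1) (j : ℕ) :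
    chainVol (j + 1) (m + 1) G = ∑ n ∈ s, chainVol j m (facet G b n) := by
  have : {F : Set 𝔼[d] | IsFace G m F} = facet G b '' (s : Set 𝔼[d]) := by
    ext F
    constructor
    · intro hF
      obtain ⟨n, hn, rfl⟩ := h.exists_eq_facet hm hF
      exact ⟨n, hn, rfl⟩
    · rintro ⟨n, hn, rfl⟩
      exact h.isFace_facet hn hm
  rw [chainVol, Nat.add_sub_cancel, this, finsum_mem_image, finsum_mem_coe_finset]
  exact fun n hn n' hn' he => h.facet_injOn hn hn' he

namespace IsEquiangularPolytope

variable {α : ℕ → ℝ} {m : ℕ} {G : Set 𝔼[d]}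

theorem euclideanHausdorffMeasure_lt_top (h : IsEquiangularPolytope α m G) : μHE[m] G < ⊤ := by
  obtain ⟨p, s, b, hr⟩ := h.exists_rep
  exact EuclPolytope.euclideanHausdorffMeasure_lt_top h.finrank_eq
    (fun x hx => hr.sub_mem hx hr.base_mem) h.isCompact

/-- For small `r`, the volume of the inner parallel body is a polynomial. -/
theorem eventually_volume_par (m : ℕ) : ∀ G : Set 𝔼[d], IsEquiangularPolytope α m G →
    ∀ᶠ r in nhdsWithin (0 : ℝ) (Set.Ici 0), (μHE[m] (par G r)).toReal = parPoly α m G r := by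
  induction m with
  | zero =>
    intro G h
    refine Filter.Eventually.of_forall fun r => ?_
    obtain ⟨p, s, b, hr⟩ := h.exists_rep
    have : par G r = G := by
      ext x
      rw [hr.mem_par_iff]
      refine ⟨fun hx => hx.1, fun hx => ⟨hx, fun n hn => ?_⟩⟩
      have h1 := hr.finrank_pos hn
      have h2 := h.finrank_eq
      omega
    rw [this]
    simp [parPoly, chainVol, vol]
  | succ m ih =>
    intro G h
    obtain ⟨p, s, b, hr⟩ := h.exists_rep
    have hm := h.finrank_eq
    set t := Real.tan (α (m + 1) / 2) with ht
    have h1 : ∀ᶠ r in nhdsWithin (0 : ℝ) (Set.Ici 0), ∀ n ∈ s,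
        (μHE[m] {x | x ∈ par G r ∧ inner ℝ n x = b n + r}).toReal =
          parPoly α m (facet G b n) (t * r) := by
      refine (Filter.eventually_all_finset s).2 fun n hn => ?_
      filter_upwards [h.eventually_slice hr hn, (h.tendsto_tan_mul (m + 1)).eventually
        (ih _ (h.face (hr.isFace_facet hn hm)))] with r h1 h2
      rw [← h2]
      congr 1
      have : {x | x ∈ par G r ∧ inner ℝ n x = b n + r} =
          (fun x => r • n + x) '' par (facet G b n) (t * r) := by
        ext x
        rw [Set.mem_ofPred_eq, h1 x]
        constructor
        · exact fun hx => ⟨_, hx, by simp⟩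
        · rintro ⟨y, hy, rfl⟩
          simpa using hy
      rw [this]
      exact (isometry_vadd 𝔼[d] (r • n)).euclideanHausdorffMeasure_image _
    -- The slice volumes are integrated over all heights below `r`, so their formula is needed on a
    -- whole interval.
    obtain ⟨ε, hε, hsub⟩ := mem_nhdsGE_iff_exists_Icc_subset.1 h1
    have hmem : Set.Icc 0 ε ∈ nhdsWithin (0 : ℝ) (Set.Ici 0) := Icc_mem_nhdsGE hε
    filter_upwards [hmem] with r hrε
    have hfin := h.euclideanHausdorffMeasure_lt_top
    have hdec := hr.measure_eq_par_add hm r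
    have hint : ∀ n ∈ s, ∫⁻ τ in Set.Ico 0 r,
        μHE[m] {x | x ∈ par G τ ∧ inner ℝ n x = b n + τ} =
        ENNReal.ofReal (∫ τ in Set.Ico 0 r, parPoly α m (facet G b n) (t * τ)) := by
      intro n hn
      have hval : ∀ τ ∈ Set.Ico 0 r, (μHE[m] {x | x ∈ par G τ ∧ inner ℝ n x = b n + τ}).toReal =
          parPoly α m (facet G b n) (t * τ) := fun τ hτ =>
        hsub ⟨hτ.1, hτ.2.le.trans hrε.2⟩ n hn
      rw [ofReal_integral_eq_lintegral_ofReal]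
      · refine setLIntegral_congr_fun measurableSet_Ico fun τ hτ => ?_
        rw [← hval τ hτ, ENNReal.ofReal_toReal]
        obtain ⟨y, hy⟩ := (hr.isFace_facet hn hm).1
        have hFdim := (hr.isFace_facet hn hm).2.2
        refine ne_of_lt (EuclPolytope.euclideanHausdorffMeasure_lt_top hFdim (p := y + τ • n)
          (fun x hx => ?_) ?_)
        · rw [hr.vectorSpan_facet hn, mem_inf_orthogonal_singleton, ← sub_sub]
          refine ⟨Submodule.sub_mem _ (hr.sub_mem hx.1.1 hy.1)
            (Submodule.smul_mem _ _ (hr.mem_dir n hn)), ?_⟩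
          rw [inner_sub_right, inner_sub_right, inner_smul_right, real_inner_self_eq_norm_sq,
            hr.norm_eq n hn, hx.2, hy.2]; ring
        · refine h.isCompact.of_isClosed_subset ?_ fun x hx => hx.1.1
          exact (hr.isClosed_par τ).inter (isClosed_eq (by fun_prop) (by fun_prop))
      · refine (Continuous.integrableOn_Icc ?_).mono_set Set.Ico_subset_Icc_self
        exact (continuous_parPoly α m _).comp (by fun_prop)
      · refine (ae_restrict_iff' measurableSet_Ico).2 (Filter.Eventually.of_forall fun τ hτ => ?_)
        change 0 ≤ parPoly α m (facet G b n) (t * τ)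
        rw [← hval τ hτ]
        exact ENNReal.toReal_nonneg
    have hnn : ∀ n ∈ s, 0 ≤ ∫ τ in Set.Ico 0 r, parPoly α m (facet G b n) (t * τ) := by
      intro n hn
      refine setIntegral_nonneg measurableSet_Ico fun τ hτ => ?_
      have := hsub ⟨hτ.1, hτ.2.le.trans hrε.2⟩ n hn
      rw [← this]
      exact ENNReal.toReal_nonneg
    rw [Finset.sum_congr rfl hint, ← ENNReal.ofReal_sum_of_nonneg hnn] at hdec
    have hparfin : μHE[m + 1] (par G r) ≠ ⊤ :=
      ne_of_lt ((measure_mono fun x hx => hx.1).trans_lt hfin)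
    have hreal := congrArg ENNReal.toReal hdec
    rw [ENNReal.toReal_add hparfin ENNReal.ofReal_ne_top,
      ENNReal.toReal_ofReal (Finset.sum_nonneg hnn)] at hreal
    have hgoal : parPoly α (m + 1) G r = (μHE[m + 1] G).toReal -
        ∑ n ∈ s, ∫ τ in Set.Ico 0 r, parPoly α m (facet G b n) (t * τ) := by
      unfold parPoly
      -- The constant term is the volume of `G`. Integration raises the degree `j` terms of the
      -- facets to degree `j + 1`, and subtracting the collars changes their sign.
      rw [Finset.sum_range_succ']
      have e0 : (-1 : ℝ) ^ 0 * chainVol 0 (m + 1) G *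
          (∏ i ∈ Finset.Ioc (m + 1 - 0) (m + 1), gam (m + 1) α i) *
          (r ^ 0 / ((Nat.factorial 0 : ℕ) : ℝ)) = (μHE[m + 1] G).toReal := by
        simp [chainVol, vol]
      rw [e0]
      have e1 : ∑ n ∈ s, ∫ τ in Set.Ico 0 r, parPoly α m (facet G b n) (t * τ) =
          -∑ j ∈ Finset.range (m + 1), (-1 : ℝ) ^ (j + 1) * chainVol (j + 1) (m + 1) G *
          (∏ i ∈ Finset.Ioc (m + 1 - (j + 1)) (m + 1), gam (m + 1) α i) *
          (r ^ (j + 1) / ((j + 1).factorial : ℝ)) := by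
        rw [Finset.sum_congr rfl fun n _ => integral_parPoly α m (facet G b n) t hrε.1,
          Finset.sum_comm, ← Finset.sum_neg_distrib]
        refine Finset.sum_congr rfl fun j hj => ?_
        rw [prod_gam_succ α (Nat.lt_succ_iff.1 (Finset.mem_range.1 hj)), hr.chainVol_succ hm,
          ← Finset.sum_mul, ← Finset.sum_mul, ← Finset.mul_sum]
        ring
      have e2 : ∑ n ∈ s, ∫ τ in Set.Ico 0 r, parPoly α m (facet G b n) (t * τ) =
        ∑ n ∈ s, ∫ τ in Set.Ico 0 r, ∑ j ∈ Finset.range (m + 1), (-1 : ℝ) ^ j *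
          chainVol j m (facet G b n) * (∏ i ∈ Finset.Ioc (m - j) m, gam m α i) *
          ((t * τ) ^ j / (j.factorial : ℝ)) := rfl
      rw [← e2, e1]
      ring
    rw [hgoal, hreal]
    ring

end IsEquiangularPolytope

/-! ### The `r`-interior of a polytope and the volumes of its skeleta -/

/-- An interior point satisfies every inequality strictly, since a small step against the nonzero
normal stays in `P`. -/
theorem IsPolytope.exists_isRep {P : Set 𝔼[d]} (hP : IsPolytope P) :
    ∃ p s b, IsRep P (⊤ : Submodule ℝ 𝔼[d]) p s b := by
  obtain ⟨-, -, ⟨p, hp⟩, T, hT0, rfl⟩ := hP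
  obtain ⟨s, b, h⟩ := EuclPolytope.exists_isRep (V := ⊤) (p := p) T
    (G := {x | ∀ h ∈ T, h.2 ≤ inner ℝ h.1 x}) (fun x => by simp) (fun h hh => by
      have hc : Continuous fun t : ℝ => p - t • h.1 := by fun_prop
      have h0 := hc.tendsto 0
      rw [zero_smul, sub_zero] at h0
      have h1 : ∀ᶠ t : ℝ in nhdsWithin 0 (Set.Ioi 0), p - t • h.1 ∈
          {x | ∀ h ∈ T, h.2 ≤ inner ℝ h.1 x} :=
        (h0.mono_left nhdsWithin_le_nhds).eventually (mem_interior_iff_mem_nhds.1 hp)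
      obtain ⟨t, ht, ht0⟩ := (h1.and self_mem_nhdsWithin).exists
      have h2 := ht h hh
      rw [inner_sub_right, inner_smul_right, real_inner_self_eq_norm_sq] at h2
      have h3 : 0 < t * ‖h.1‖ ^ 2 :=
        mul_pos ht0 (pow_pos (norm_pos_iff.2 (hT0 h hh)) 2)
      linarith)
  exact ⟨p, s, b, h⟩

theorem IsRep.isEquiangularPolytope {P : Set 𝔼[d]} {p : 𝔼[d]} {s : Finset 𝔼[d]} {b : 𝔼[d] → ℝ}
    (hr : IsRep P ⊤ p s b) (hc : IsCompact P) {α : ℕ → ℝ} (hα : ∀ k, α k ∈ Set.Ioo 0 Real.pi)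
    (h : IsDimensionwiseEquiangular P α) : IsEquiangularPolytope α d P :=
  ⟨⟨p, s, b, by rw [hr.vectorSpan_eq]; exact hr⟩, hc,
    by rw [hr.vectorSpan_eq, finrank_top, finrank_euclideanSpace_fin], hα,
    fun k h2 hk => (h k h2 hk).2⟩

/-- The `r`-interior is cut out by the translated half-spaces. -/
theorem IsRep.rInterior_eq_par {P : Set 𝔼[d]} {p : 𝔼[d]} {s : Finset 𝔼[d]} {b : 𝔼[d] → ℝ}
    (hr : IsRep P ⊤ p s b) (r : ℝ) : rInterior P r = par P r := by
  ext x
  rw [hr.mem_par_iff]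
  refine and_congr_right fun hx => ⟨fun h n hn => ?_, fun h => ?_⟩
  · by_contra hlt
    push Not at hlt
    obtain ⟨δ, hδ1, hδ2⟩ := exists_between (show (inner ℝ n x : ℝ) - b n < r by linarith)
    have hδ0 : 0 ≤ δ := by linarith [hr.le hx hn]
    have hn1 := hr.norm_eq n hn
    have hy : x - δ • n ∉ P := by
      intro hy
      have := hr.le hy hn
      rw [inner_sub_right, inner_smul_right, real_inner_self_eq_norm_sq, hn1] at this
      linarith
    have hyb : x - δ • n ∈ Metric.ball x r := by
      rw [Metric.mem_ball, dist_eq_norm, sub_sub_cancel_left, norm_neg, norm_smul, hn1,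
        Real.norm_eq_abs, abs_of_nonneg hδ0, mul_one]
      exact hδ2
    -- The ball is connected and meets both `P` and its complement, so it meets the boundary.
    obtain ⟨z, hz, hzf⟩ : ∃ z ∈ Metric.ball x r, z ∈ frontier P := by
      by_contra hno
      push Not at hno
      have hint : ∀ z ∈ Metric.ball x r, z ∈ P → z ∈ interior P := fun z hz hzP => by
        by_contra hni
        exact hno z hz ⟨subset_closure hzP, hni⟩
      have hxb := Metric.mem_ball_self (x := x) (hδ0.trans_lt hδ2)
      obtain ⟨z, -, hz1, hz2⟩ := (convex_ball x r).isPreconnected (interior P) Pᶜ isOpen_interior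
        hr.isClosed.isOpen_compl (fun z hz => by
          by_cases hzP : z ∈ P
          · exact Or.inl (hint z hz hzP)
          · exact Or.inr hzP) ⟨x, hxb, hint x hxb hx⟩ ⟨_, hyb, hy⟩
      exact hz2 (interior_subset hz1)
    have h1 := h.trans (Metric.infEDist_le_edist_of_mem hzf)
    rw [edist_dist, ENNReal.ofReal_le_ofReal_iff dist_nonneg, dist_comm] at h1
    rw [Metric.mem_ball] at hz
    linarith
  · refine Metric.le_infEDist.2 fun z hz => ?_
    by_contra hlt
    push Not at hlt
    rw [edist_dist, ENNReal.ofReal_lt_ofReal_iff_of_nonneg dist_nonneg, dist_eq_norm] at hlt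
    have hopen : IsOpen (⋂ n ∈ s, {y : 𝔼[d] | b n < inner ℝ n y}) :=
      isOpen_biInter_finset fun n _ => isOpen_lt (by fun_prop) (by fun_prop)
    have hsub : (⋂ n ∈ s, {y : 𝔼[d] | b n < inner ℝ n y}) ⊆ P := by
      intro y hy
      simp only [Set.mem_iInter] at hy
      exact (hr.mem_iff y).2 ⟨trivial, fun n hn => (hy n hn).le⟩
    have hzint : z ∈ interior P := by
      refine mem_interior.2 ⟨_, hsub, hopen, ?_⟩
      simp only [Set.mem_iInter]
      intro n hn
      have h1 := h n hn
      have h2 := real_inner_le_norm n (x - z)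
      rw [hr.norm_eq n hn, one_mul, inner_sub_right] at h2
      change b n < inner ℝ n z
      linarith
    exact hz.2 hzint

/-- Double counting of pairs `F ⊆ G`: the facets of `G` are the `m`-faces of `P` inside it, and each
of these lies in `c` faces of the next dimension. -/
theorem IsRep.sum_chainVol_succ {P : Set 𝔼[d]} {V : Submodule ℝ 𝔼[d]} {p : 𝔼[d]} {s : Finset 𝔼[d]}
    {b : 𝔼[d] → ℝ} (hr : IsRep P V p s b) {m c : ℕ}
    (hc : ∀ F, IsFace P m F → {G : Set 𝔼[d] | IsFace P (m + 1) G ∧ F ⊆ G}.encard = (c : ℕ∞)) (j : ℕ) :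
    ∑ G ∈ (hr.finite_faces (m + 1)).toFinset, chainVol (j + 1) (m + 1) G =
      c * ∑ F ∈ (hr.finite_faces m).toFinset, chainVol j m F := by
  classical
  have h1 : ∀ G ∈ (hr.finite_faces (m + 1)).toFinset, chainVol (j + 1) (m + 1) G =
      ∑ F ∈ (hr.finite_faces m).toFinset, if F ⊆ G then chainVol j m F else 0 := by
    intro G hG
    have hG : IsFace P (m + 1) G := by simpa using hG
    rw [chainVol, Nat.add_sub_cancel, ← Finset.sum_filter, ← finsum_mem_coe_finset]
    congr with F
    have : IsFace G m F ↔ IsFace P m F ∧ F ⊆ G :=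
      ⟨fun h => ⟨hr.isFace_trans hG h, h.subset⟩, fun h => h.1.mono hG.subset h.2⟩
    simp [this]
  rw [Finset.sum_congr rfl h1, Finset.sum_comm, Finset.mul_sum]
  refine Finset.sum_congr rfl fun F hF => ?_
  have hF : IsFace P m F := by simpa using hF
  rw [← Finset.sum_filter, Finset.sum_const, nsmul_eq_mul]
  congr 2
  have h2 : {G : Set 𝔼[d] | IsFace P (m + 1) G ∧ F ⊆ G} =
      (((hr.finite_faces (m + 1)).toFinset.filter (fun G => F ⊆ G) : Finset (Set 𝔼[d])) :
        Set (Set 𝔼[d])) := by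
    ext G; simp
  have h3 := hc F hF
  rw [h2, Set.encard_coe_eq_coe_finsetCard] at h3
  exact_mod_cast h3

/-- The volume of the skeleton is the sum of the volumes of the faces. -/
theorem IsRep.vol_skeleton {P : Set 𝔼[d]} {V : Submodule ℝ 𝔼[d]} {p : 𝔼[d]} {s : Finset 𝔼[d]}
    {b : 𝔼[d] → ℝ} (hr : IsRep P V p s b) (hcpt : IsCompact P) (k : ℕ) :
    vol k (skeleton P k) = ∑ F ∈ (hr.finite_faces k).toFinset, vol k F := by
  have hsk : skeleton P k = ⋃ F ∈ (hr.finite_faces k).toFinset, F := by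
    unfold skeleton
    ext x; simp
  have hclosed : ∀ F, IsFace P k F → IsClosed F := fun F hF => by
    obtain ⟨p', s', b', hr'⟩ := hr.exists_isRep_face hF
    exact hr'.isClosed
  unfold vol
  rw [hsk, measure_biUnion_finset₀, ENNReal.toReal_sum]
  · intro F hF
    have hF : IsFace P k F := by simpa using hF
    obtain ⟨x, hx⟩ := hF.1
    exact (euclideanHausdorffMeasure_lt_top hF.2.2 (p := x)
      (fun y hy => vsub_mem_vectorSpan ℝ hy hx)
      (hcpt.of_isClosed_subset (hclosed F hF) hF.subset)).ne
  · intro F hF F' hF' hne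
    have hF : IsFace P k F := by simpa using hF
    have hF' : IsFace P k F' := by simpa using hF'
    change μHE[k] (F ∩ F') = 0
    rcases (F ∩ F').eq_empty_or_nonempty with he | ⟨x, hx⟩
    · rw [he, measure_empty]
    -- Distinct `k`-faces meet in a face of smaller dimension, hence in a null set.
    · refine euclideanHausdorffMeasure_eq_zero (V := vectorSpan ℝ (F ∩ F')) (p := x) ?_
        (fun y hy => vsub_mem_vectorSpan ℝ hy hx)
      by_contra hlt
      have hI : IsFace P _ (F ∩ F') := ⟨⟨x, hx⟩, hF.2.1.inter hF'.2.1, rfl⟩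
      exact hne ((hr.eq_of_subset hI hF Set.inter_subset_left (not_lt.1 hlt)).symm.trans
        (hr.eq_of_subset hI hF' Set.inter_subset_right (not_lt.1 hlt)))
  · intro F hF
    have hF : IsFace P k F := by simpa using hF
    exact (hclosed F hF).measurableSet.nullMeasurableSet

theorem IsRep.sum_chainVol {P : Set 𝔼[d]} {V : Submodule ℝ 𝔼[d]} {p : 𝔼[d]} {s : Finset 𝔼[d]}
    {b : 𝔼[d] → ℝ} (hr : IsRep P V p s b) (hcpt : IsCompact P) {μ : ℕ → ℕ}
    (hμ : HasConstantIncidence P μ) (j m : ℕ) (hj : j ≤ m) (hm : m ≤ d) :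
    ∑ F ∈ (hr.finite_faces m).toFinset, chainVol j m F =
      (∏ i ∈ Finset.Ioc (m - j) m, (μ i : ℝ)) * vol (m - j) (skeleton P (m - j)) := by
  induction j generalizing m with
  | zero =>
    simp only [chainVol, Nat.sub_zero, Finset.Ioc_self, Finset.prod_empty, one_mul]
    exact (hr.vol_skeleton hcpt m).symm
  | succ j ih =>
    obtain ⟨m, rfl⟩ : ∃ m', m = m' + 1 := ⟨m - 1, by omega⟩
    rw [hr.sum_chainVol_succ (fun F hF => hμ (m + 1) (by omega) hm F hF),
      ih m (by omega) (by omega), Nat.add_sub_add_right, Finset.prod_Ioc_succ_top (by omega)]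
    ring

theorem IsRep.chainVol_top {P : Set 𝔼[d]} {p : 𝔼[d]} {s : Finset 𝔼[d]}
    {b : 𝔼[d] → ℝ} (hr : IsRep P ⊤ p s b) (hcpt : IsCompact P) {μ : ℕ → ℕ}
    (hμ : HasConstantIncidence P μ) {j : ℕ} (hj : j ≤ d) :
    chainVol j d P =
      (∏ i ∈ Finset.Ioc (d - j) d, (μ i : ℝ)) * vol (d - j) (skeleton P (d - j)) := by
  rw [← hr.sum_chainVol hcpt hμ j d hj le_rfl]
  have hP : IsFace P d P := by
    have := hr.isFace_self
    rwa [finrank_top, finrank_euclideanSpace_fin] at this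
  have : (hr.finite_faces d).toFinset = {P} := by
    ext F
    simp only [Set.Finite.mem_toFinset, Set.mem_ofPred_eq, Finset.mem_singleton]
    exact ⟨fun hF => hr.eq_of_subset hF hP hF.subset le_rfl, fun h => h ▸ hP⟩
  rw [this, Finset.sum_singleton]

/-- The volume of the `r`-interior of a dimension-wise equiangular polytope is a polynomial for
small `r`. -/
theorem IsPolytope.volume_rInterior {P : Set 𝔼[d]} (hP : IsPolytope P) (α : ℕ → ℝ) (μ : ℕ → ℕ)
    (hα : IsDimensionwiseEquiangular P α) (hμ : HasConstantIncidence P μ) :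
    ∃ ε : ℝ, 0 < ε ∧ ∀ r ∈ Set.Icc 0 ε, W P r = ∑ k ∈ Finset.range (d + 1),
      (-1 : ℝ) ^ (d - k) * (∏ j ∈ Finset.Ioc k d, (μ j : ℝ)) * vol k (skeleton P k) *
        (∏ j ∈ Finset.Ioc k d, gam d α j) * (r ^ (d - k) / ((d - k).factorial : ℝ)) := by
  obtain ⟨p, s, b, hr⟩ := hP.exists_isRep
  -- The induction asks for angles in `(0, π)` at all indices, whereas `α` is controlled only from
  -- `2` to `d`. No other index enters the final products.
  set β : ℕ → ℝ := fun k => if 2 ≤ k ∧ k ≤ d then α k else Real.pi / 2 with hβ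
  have hβ0 : ∀ k, β k ∈ Set.Ioo 0 Real.pi := by
    intro k
    by_cases hk : 2 ≤ k ∧ k ≤ d
    · simp only [hβ, if_pos hk]; exact (hα k hk.1 hk.2).1
    · simp only [hβ, if_neg hk]; constructor <;> linarith [Real.pi_pos]
  have hβeq : ∀ k, 2 ≤ k → k ≤ d → β k = α k := fun k h2 hk => if_pos ⟨h2, hk⟩
  have hβ1 : IsDimensionwiseEquiangular P β := by
    intro k h2 hk
    rw [hβeq k h2 hk]; exact hα k h2 hk
  have hE := hr.isEquiangularPolytope hP.1 hβ0 hβ1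
  obtain ⟨ε, hε, hsub⟩ := mem_nhdsGE_iff_exists_Icc_subset.1
    (IsEquiangularPolytope.eventually_volume_par d P hE)
  refine ⟨ε, hε, fun r hrε => ?_⟩
  have h1 : (μHE[d] (par P r)).toReal = parPoly β d P r := hsub hrε
  unfold W
  rw [hr.rInterior_eq_par r, ← EuclideanSpace.euclideanHausdorffMeasure_eq_volume, h1]
  unfold parPoly
  rw [← Finset.sum_flip]
  refine Finset.sum_congr rfl fun k hk => ?_
  have hk : k ≤ d := Nat.lt_succ_iff.1 (Finset.mem_range.1 hk)
  rw [hr.chainVol_top hP.1 hμ (by omega), Nat.sub_sub_self hk]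
  have hgam : ∏ i ∈ Finset.Ioc k d, gam d β i = ∏ i ∈ Finset.Ioc k d, gam d α i := by
    refine Finset.prod_congr rfl fun i hi => Finset.prod_congr rfl fun l hl => ?_
    rw [Finset.mem_Ioc] at hi hl
    rw [hβeq l (by omega) hl.2]
  rw [hgam]
  ring

/-! ### Flags and symmetries of regular polytopes -/

theorem vectorSpan_image_isometryEquiv (f : 𝔼[d] ≃ᵃⁱ[ℝ] 𝔼[d]) (F : Set 𝔼[d]) :
    vectorSpan ℝ (f '' F) =
      (vectorSpan ℝ F).map (f.linearIsometryEquiv.toLinearEquiv : 𝔼[d] →ₗ[ℝ] 𝔼[d]) :=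
  (AffineMap.map_vectorSpan (f := (f.toAffineEquiv : 𝔼[d] →ᵃ[ℝ] 𝔼[d]))).symm

theorem IsFace.image {k : ℕ} {G F : Set 𝔼[d]} (h : IsFace G k F) (f : 𝔼[d] ≃ᵃⁱ[ℝ] 𝔼[d]) :
    IsFace (f '' G) k (f '' F) := by
  refine ⟨h.1.image f, fun _ => ?_, ?_⟩
  · obtain ⟨l, hl⟩ := h.2.1 h.1
    have hmap : ∀ x y, f x - f y = f.linearIsometryEquiv (x - y) := fun x y =>
      (f.map_vsub x y).symm
    let l' : StrongDual ℝ 𝔼[d] :=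
      l.comp (f.linearIsometryEquiv.symm.toContinuousLinearEquiv : 𝔼[d] →L[ℝ] 𝔼[d])
    have hl' : ∀ x y, l' (f x) ≤ l' (f y) ↔ l x ≤ l y := by
      intro x y
      have : l' (f y) - l' (f x) = l y - l x := by
        rw [← map_sub, hmap]
        simp [l']
      constructor <;> intro h <;> linarith
    refine ⟨l', ?_⟩
    ext z
    constructor
    · rintro ⟨x, hx, rfl⟩
      rw [hl] at hx
      refine ⟨⟨x, hx.1, rfl⟩, ?_⟩
      rintro _ ⟨y, hy, rfl⟩
      exact (hl' y x).2 (hx.2 y hy)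
    · rintro ⟨⟨x, hx, rfl⟩, hz⟩
      refine ⟨x, ?_, rfl⟩
      rw [hl]
      exact ⟨hx, fun y hy => (hl' y x).1 (hz _ ⟨y, hy, rfl⟩)⟩
  · rw [vectorSpan_image_isometryEquiv, LinearEquiv.finrank_map_eq]
    exact h.2.2

theorem IsInnerUnitNormal.image {F R : Set 𝔼[d]} {N : 𝔼[d]} (h : IsInnerUnitNormal F R N)
    (f : 𝔼[d] ≃ᵃⁱ[ℝ] 𝔼[d]) :
    IsInnerUnitNormal (f '' F) (f '' R) (f.linearIsometryEquiv N) := by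
  have hmap : ∀ x y, inner ℝ (f.linearIsometryEquiv N) (f x - f y) = (inner ℝ N (x - y) : ℝ) := by
    intro x y
    rw [← LinearIsometryEquiv.inner_map_map f.linearIsometryEquiv N (x - y)]
    congr 1
    exact (f.map_vsub x y).symm
  refine ⟨?_, ?_, ?_, ?_⟩
  · rw [vectorSpan_image_isometryEquiv]
    exact ⟨N, h.1, rfl⟩
  · rw [LinearIsometryEquiv.norm_map]; exact h.2.1
  · rintro _ ⟨x, hx, rfl⟩ _ ⟨y, hy, rfl⟩
    rw [hmap]; exact h.2.2.1 x hx y hy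
  · rintro _ ⟨x, hx, rfl⟩ _ ⟨y, hy, rfl⟩
    rw [hmap]; exact h.2.2.2 x hx y hy

/-- A chain of faces of `P` of consecutive dimensions `a, …, c`. -/
def IsFaceChain (P : Set 𝔼[d]) (a c : ℕ) (Φ : ℕ → Set 𝔼[d]) : Prop :=
  (∀ i, a ≤ i → i ≤ c → IsFace P i (Φ i)) ∧ ∀ i, a ≤ i → i < c → Φ i ⊆ Φ (i + 1)

theorem IsFaceChain.glue {P : Set 𝔼[d]} {a c e : ℕ} {Φ Ψ : ℕ → Set 𝔼[d]} (hΦ : IsFaceChain P a c Φ)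
    (hΨ : IsFaceChain P c e Ψ) (hc : Φ c = Ψ c) :
    ∃ Θ, IsFaceChain P a e Θ ∧ (∀ i ≤ c, Θ i = Φ i) ∧ ∀ i, c ≤ i → Θ i = Ψ i := by
  have h1 : ∀ i ≤ c, (fun i => if i ≤ c then Φ i else Ψ i) i = Φ i := fun i hi => if_pos hi
  have h2 : ∀ i, c ≤ i → (fun i => if i ≤ c then Φ i else Ψ i) i = Ψ i := by
    intro i hi
    rcases hi.eq_or_lt with rfl | h
    · rw [h1 c le_rfl, hc]
    · exact if_neg (by omega)
  refine ⟨fun i => if i ≤ c then Φ i else Ψ i, ⟨fun i hi hi' => ?_, fun i hi hi' => ?_⟩, h1, h2⟩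
  · by_cases hic : i ≤ c
    · rw [h1 i hic]; exact hΦ.1 i hi hic
    · rw [h2 i (by omega)]; exact hΨ.1 i (by omega) hi'
  · by_cases hic : i < c
    · rw [h1 i hic.le, h1 (i + 1) hic]; exact hΦ.2 i hi hic
    · rw [h2 i (by omega), h2 (i + 1) (by omega)]; exact hΨ.2 i (by omega) hi'

/-- By induction on the dimension: a proper face lies in a facet, and a chain up to that facet is
extended by `G`. -/
theorem exists_faceChain_self (m : ℕ) : ∀ (G : Set 𝔼[d]) (V : Submodule ℝ 𝔼[d]) (p : 𝔼[d]) (s : Finset 𝔼[d])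
    (b : 𝔼[d] → ℝ), IsRep G V p s b → Module.finrank ℝ V = m → ∀ (k : ℕ) (F : Set 𝔼[d]), IsFace G k F →
    ∃ Φ, IsFaceChain G k m Φ ∧ Φ k = F ∧ Φ m = G := by
  induction m with
  | zero =>
    intro G V p s b hr hm k F hF
    have hG : IsFace G 0 G := hm ▸ hr.isFace_self
    have hk := hF.finrank_le (hr.vectorSpan_eq ▸ hm)
    obtain rfl : k = 0 := by omega
    have hFG := hr.eq_of_subset hF hG hF.subset le_rfl
    refine ⟨fun _ => G, ⟨fun i _ hi => ?_, fun i _ hi => by omega⟩, hFG.symm, rfl⟩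
    obtain rfl : i = 0 := by omega
    exact hG
  | succ m ih =>
    intro G V p s b hr hm k F hF
    have hG : IsFace G (m + 1) G := hm ▸ hr.isFace_self
    have hk := hF.finrank_le (hr.vectorSpan_eq ▸ hm)
    by_cases hFG : F = G
    · subst hFG
      have hkm : k = m + 1 := by rw [← hF.2.2, ← hG.2.2]
      subst hkm
      refine ⟨fun _ => F, ⟨fun i hi hi' => ?_, fun i hi hi' => by omega⟩, rfl, rfl⟩
      obtain rfl : i = m + 1 := by omega
      exact hG
    · obtain ⟨n, hn, hsub⟩ := hr.exists_subset_facet hF hFG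
      have hfac := hr.isFace_facet hn hm
      obtain ⟨p', s', b', hr'⟩ := hr.exists_isRep_face hfac
      have hF' := hF.mono hfac.subset hsub
      have hkm := hF'.finrank_le hfac.2.2
      obtain ⟨Φ, hΦ, hk', hm'⟩ := ih _ _ p' s' b' hr' hfac.2.2 k F hF'
      have h1 : IsFaceChain G k m Φ :=
        ⟨fun i hi hi' => hr.isFace_trans hfac (hΦ.1 i hi hi'), hΦ.2⟩
      have h2 : IsFaceChain G m (m + 1) (fun i => if i = m then facet G b n else G) := by
        refine ⟨fun i hi hi' => ?_, fun i hi hi' => ?_⟩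
        · beta_reduce
          by_cases him : i = m
          · rw [if_pos him, him]; exact hfac
          · rw [if_neg him]
            obtain rfl : i = m + 1 := by omega
            exact hG
        · obtain rfl : i = m := by omega
          beta_reduce
          rw [if_pos rfl, if_neg (by omega)]
          exact hfac.subset
      obtain ⟨Θ, hΘ, e1, e2⟩ := h1.glue h2 (by rw [hm', if_pos rfl])
      refine ⟨Θ, hΘ, by rw [e1 k hkm, hk'], ?_⟩
      rw [e2 (m + 1) (by omega), if_neg (by omega)]

namespace IsRep

variable {P : Set 𝔼[d]} {V : Submodule ℝ 𝔼[d]} {p : 𝔼[d]} {s : Finset 𝔼[d]} {b : 𝔼[d] → ℝ}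

theorem exists_faceChain (hr : IsRep P V p s b) {a c : ℕ} {A C : Set 𝔼[d]} (hA : IsFace P a A)
    (hC : IsFace P c C) (hAC : A ⊆ C) : ∃ Φ, IsFaceChain P a c Φ ∧ Φ a = A ∧ Φ c = C := by
  obtain ⟨p', s', b', hr'⟩ := hr.exists_isRep_face hC
  obtain ⟨Φ, hΦ, h1, h2⟩ := exists_faceChain_self c C _ p' s' b' hr' hC.2.2 a A
    (hA.mono hC.subset hAC)
  exact ⟨Φ, ⟨fun i hi hi' => hr.isFace_trans hC (hΦ.1 i hi hi'), hΦ.2⟩, h1, h2⟩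

theorem exists_vertex (hr : IsRep P V p s b) (hc : IsCompact P) : ∃ v, IsFace P 0 {v} := by
  obtain ⟨v, hv⟩ := hc.extremePoints_nonempty ⟨p, hr.base_mem⟩
  obtain ⟨x, hx, he⟩ := hr.exists_eq_faceAt (Set.singleton_nonempty v) (convex_singleton v)
    (isExtreme_singleton.2 hv)
  have hxP : x ∈ P := by rw [Set.mem_singleton_iff.1 hx]; exact hv.1
  refine ⟨v, Set.singleton_nonempty v, he ▸ hr.isExposed_faceAt hxP, ?_⟩
  rw [vectorSpan_singleton, finrank_bot]

theorem exists_vertex_mem (hr : IsRep P V p s b) (hc : IsCompact P) {k : ℕ} {F : Set 𝔼[d]}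
    (hF : IsFace P k F) : ∃ v ∈ F, IsFace P 0 {v} := by
  obtain ⟨p', s', b', hr'⟩ := hr.exists_isRep_face hF
  obtain ⟨v, hv⟩ := hr'.exists_vertex (hc.of_isClosed_subset hr'.isClosed hF.subset)
  exact ⟨v, hv.subset rfl, hr.isFace_trans hF hv⟩

/-- Any three nested faces are part of a flag. -/
theorem exists_flag (hr : IsRep P (⊤ : Submodule ℝ 𝔼[d]) p s b) (hcpt : IsCompact P) {a c e : ℕ}
    {A C D : Set 𝔼[d]} (hA : IsFace P a A) (hC : IsFace P c C) (hD : IsFace P e D) (hac : a ≤ c)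
    (hce : c ≤ e) (hAC : A ⊆ C) (hCD : C ⊆ D) :
    ∃ Θ : ℕ → Set 𝔼[d], IsFlag P (fun i : Fin d => Θ i) ∧ Θ d = P ∧ Θ a = A ∧ Θ c = C ∧ Θ e = D := by
  have hd : Module.finrank ℝ (vectorSpan ℝ P) = d := by
    rw [hr.vectorSpan_eq, finrank_top, finrank_euclideanSpace_fin]
  have hP : IsFace P d P := by
    have := hr.isFace_self
    rwa [finrank_top, finrank_euclideanSpace_fin] at this
  obtain ⟨v, hvA, hv⟩ := hr.exists_vertex_mem hcpt hA
  obtain ⟨Φ₁, h₁, -, e₁⟩ := hr.exists_faceChain hv hA (Set.singleton_subset_iff.2 hvA)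
  obtain ⟨Φ₂, h₂, f₂, e₂⟩ := hr.exists_faceChain hA hC hAC
  obtain ⟨Φ₃, h₃, f₃, e₃⟩ := hr.exists_faceChain hC hD hCD
  obtain ⟨Φ₄, h₄, f₄, e₄⟩ := hr.exists_faceChain hD hP hD.subset
  obtain ⟨Ψ₁, k₁, l₁, r₁⟩ := h₁.glue h₂ (e₁.trans f₂.symm)
  obtain ⟨Ψ₂, k₂, l₂, r₂⟩ := k₁.glue h₃ (by rw [r₁ c hac, e₂, f₃])
  have hed := hD.finrank_le hd
  obtain ⟨Θ, k₃, l₃, r₃⟩ := k₂.glue h₄ (by rw [r₂ e hce, e₃, f₄])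
  refine ⟨Θ, ⟨fun i => k₃.1 i (Nat.zero_le _) i.2.le, ?_⟩, by rw [r₃ d hed, e₄], ?_, ?_, ?_⟩
  -- The inclusions in `Θ` are known only up to index `d`, hence the truncation.
  · have hmono : Monotone fun i => Θ (min i d) := by
      refine monotone_nat_of_le_succ fun i => ?_
      rcases lt_or_ge i d with hi | hi
      · rw [min_eq_left hi.le, min_eq_left hi]
        exact k₃.2 i (Nat.zero_le _) hi
      · rw [min_eq_right hi, min_eq_right (by omega)]
    intro i j hij
    have := hmono (show (i : ℕ) ≤ j from hij)
    simpa only [min_eq_left i.2.le, min_eq_left j.2.le] using this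
  · rw [l₃ a (hac.trans hce), l₂ a hac, l₁ a le_rfl, e₁]
  · rw [l₃ c hce, l₂ c le_rfl, r₁ c hac, e₂]
  · rw [l₃ e le_rfl, r₂ e hce, e₃]

/-- The symmetries of a regular polytope act transitively on triples of nested faces. -/
theorem exists_symmetry (hr : IsRep P (⊤ : Submodule ℝ 𝔼[d]) p s b) (hcpt : IsCompact P)
    (hreg : IsRegular P) {a c e : ℕ} (hac : a ≤ c) (hce : c ≤ e)
    {A C D A' C' D' : Set 𝔼[d]} (hA : IsFace P a A) (hC : IsFace P c C) (hD : IsFace P e D)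
    (hAC : A ⊆ C) (hCD : C ⊆ D)
    (hA' : IsFace P a A') (hC' : IsFace P c C') (hD' : IsFace P e D') (hAC' : A' ⊆ C')
    (hCD' : C' ⊆ D') :
    ∃ f : 𝔼[d] ≃ᵃⁱ[ℝ] 𝔼[d], f '' P = P ∧ f '' A = A' ∧ f '' C = C' ∧ f '' D = D' := by
  have hd : Module.finrank ℝ (vectorSpan ℝ P) = d := by
    rw [hr.vectorSpan_eq, finrank_top, finrank_euclideanSpace_fin]
  obtain ⟨Θ, h1, h2, h3, h4, h5⟩ := hr.exists_flag hcpt hA hC hD hac hce hAC hCD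
  obtain ⟨Θ', h1', h2', h3', h4', h5'⟩ := hr.exists_flag hcpt hA' hC' hD' hac hce hAC' hCD'
  obtain ⟨f, hfP, hf⟩ := hreg _ _ h1 h1'
  have hall : ∀ i ≤ d, f '' Θ i = Θ' i := by
    intro i hi
    rcases hi.eq_or_lt with rfl | hi
    · rw [h2, h2', hfP]
    · exact hf ⟨i, hi⟩
  refine ⟨f, hfP, ?_, ?_, ?_⟩
  · rw [← h3, ← h3']; exact hall a (hA.finrank_le hd)
  · rw [← h4, ← h4']; exact hall c (hC.finrank_le hd)
  · rw [← h5, ← h5']; exact hall e (hD.finrank_le hd)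

/-- A symmetry taking `G` to `G'` maps the `k`-faces above `G` injectively to those above `G'`, so
by exchanging the roles the counts agree. -/
theorem exists_constantIncidence (hr : IsRep P (⊤ : Submodule ℝ 𝔼[d]) p s b) (hcpt : IsCompact P)
    (hreg : IsRegular P) : ∃ μ : ℕ → ℕ, HasConstantIncidence P μ := by
  have hle : ∀ k, 1 ≤ k → ∀ G G' : Set 𝔼[d], IsFace P (k - 1) G → IsFace P (k - 1) G' →
      {F : Set 𝔼[d] | IsFace P k F ∧ G ⊆ F}.encard ≤ {F : Set 𝔼[d] | IsFace P k F ∧ G' ⊆ F}.encard := by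
    intro k _ G G' hG hG'
    obtain ⟨f, hfP, hfG, -, -⟩ := hr.exists_symmetry hcpt hreg le_rfl le_rfl hG hG hG
      subset_rfl subset_rfl hG' hG' hG' subset_rfl subset_rfl
    rw [← (Set.image_injective.2 f.injective).encard_image]
    apply Set.encard_le_encard
    rintro _ ⟨F, ⟨hF, hGF⟩, rfl⟩
    refine ⟨?_, ?_⟩
    · have := hF.image f
      rwa [hfP] at this
    · rw [← hfG]; exact Set.image_mono hGF
  have hex : ∀ k : ℕ, ∃ c : ℕ, 1 ≤ k → ∀ G : Set 𝔼[d], IsFace P (k - 1) G →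
      {F : Set 𝔼[d] | IsFace P k F ∧ G ⊆ F}.encard = (c : ℕ∞) := by
    intro k
    by_cases hk : 1 ≤ k ∧ ∃ G : Set 𝔼[d], IsFace P (k - 1) G
    · obtain ⟨hk, G, hG⟩ := hk
      have hfin : {F : Set 𝔼[d] | IsFace P k F ∧ G ⊆ F}.Finite :=
        (hr.finite_faces k).subset fun F hF => hF.1
      refine ⟨hfin.toFinset.card, fun _ G' hG' => ?_⟩
      rw [← hfin.encard_eq_coe_toFinset_card]
      exact le_antisymm (hle k hk G' G hG' hG) (hle k hk G G' hG hG')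
    · exact ⟨0, fun h1 G hG => absurd ⟨h1, G, hG⟩ hk⟩
  choose μ hμ using hex
  exact ⟨μ, fun k h1 _ G hG => hμ k h1 G hG⟩

/-- The normals of two facets of `F` that meet in a ridge. -/
def RidgeNormals (P : Set 𝔼[d]) (k : ℕ) (F G₁ G₂ : Set 𝔼[d]) (N₁ N₂ : 𝔼[d]) : Prop :=
  IsFace P k F ∧ IsFace F (k - 1) G₁ ∧ IsFace F (k - 1) G₂ ∧ G₁ ≠ G₂ ∧
    IsFace F (k - 2) (G₁ ∩ G₂) ∧ IsInnerUnitNormal F G₁ N₁ ∧ IsInnerUnitNormal F G₂ N₂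

/-- An inner product of `1` or `-1` would make the unit normals equal or opposite. The first
contradicts that the facets differ, the second that they have a common point. -/
theorem ridgeNormals_inner_mem (hr : IsRep P V p s b) {k : ℕ} (hk : 2 ≤ k)
    {F G₁ G₂ : Set 𝔼[d]} {N₁ N₂ : 𝔼[d]} (h : RidgeNormals P k F G₁ G₂ N₁ N₂) :
    (inner ℝ N₁ N₂ : ℝ) ∈ Set.Ioo (-1) 1 := by
  obtain ⟨hF, h1, h2, hne, hR, hN1, hN2⟩ := h
  obtain ⟨p', s', b', hr'⟩ := hr.exists_isRep_face hF
  obtain ⟨k, rfl⟩ : ∃ j, k = j + 1 := ⟨k - 1, by omega⟩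
  rw [Nat.add_sub_cancel] at h1 h2
  obtain ⟨n₁, hn₁, rfl⟩ := hr'.exists_eq_facet hF.2.2 h1
  obtain ⟨n₂, hn₂, rfl⟩ := hr'.exists_eq_facet hF.2.2 h2
  obtain ⟨x, hx1, hx2⟩ := hR.1
  rw [hr'.eq_of_isInnerUnitNormal_facet hn₁ hN1, hr'.eq_of_isInnerUnitNormal_facet hn₂ hN2]
  have a1 := hr'.norm_eq n₁ hn₁
  have a2 := hr'.norm_eq n₂ hn₂
  have hle := abs_le.1 (abs_real_inner_le_norm n₁ n₂)
  rw [a1, a2, mul_one] at hle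
  constructor
  · refine lt_of_le_of_ne hle.1 fun he => ?_
    refine hr'.ne_neg_of_active hn₁ hn₂ hx1.2 hx2.2 ?_
    have : inner ℝ n₁ (-n₂) = (1 : ℝ) := by rw [inner_neg_right, ← he, neg_neg]
    rw [inner_eq_one_iff_of_norm_eq_one a1 (by rw [norm_neg, a2])] at this
    rw [this, neg_neg]
  · refine lt_of_le_of_ne hle.2 fun he => hne ?_
    rw [inner_eq_one_iff_of_norm_eq_one a1 a2] at he
    rw [he]

/-- A symmetry matches ridge, first facet and face. It sends `G₂` to a facet of `F'` through the
ridge other than `G₁'`; as only two facets contain a ridge, this is `G₂'`. -/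
theorem ridgeNormals_inner_eq (hr : IsRep P (⊤ : Submodule ℝ 𝔼[d]) p s b) (hcpt : IsCompact P)
    (hreg : IsRegular P) {k : ℕ} (hk : 2 ≤ k)
    {F G₁ G₂ F' G₁' G₂' : Set 𝔼[d]} {N₁ N₂ N₁' N₂' : 𝔼[d]} (h : RidgeNormals P k F G₁ G₂ N₁ N₂)
    (h' : RidgeNormals P k F' G₁' G₂' N₁' N₂') : (inner ℝ N₁ N₂ : ℝ) = inner ℝ N₁' N₂' := by
  obtain ⟨hF, h1, h2, hne, hR, hN1, hN2⟩ := h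
  obtain ⟨hF', h1', h2', hne', hR', hN1', hN2'⟩ := h'
  obtain ⟨k, rfl⟩ : ∃ j, k = j + 2 := ⟨k - 2, by omega⟩
  rw [show k + 2 - 1 = k + 1 by omega] at h1 h2 h1' h2'
  rw [show k + 2 - 2 = k by omega] at hR hR'
  obtain ⟨f, hfP, hfR, hfG, hfF⟩ := hr.exists_symmetry hcpt hreg (show k ≤ k + 1 by omega)
    (show k + 1 ≤ k + 2 by omega) (hr.isFace_trans hF hR) (hr.isFace_trans hF h1) hF
    Set.inter_subset_left h1.subset (hr.isFace_trans hF' hR') (hr.isFace_trans hF' h1') hF'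
    Set.inter_subset_left h1'.subset
  obtain ⟨p', s', b', hr'⟩ := hr.exists_isRep_face hF'
  have e1 := hN1.image f
  have e2 := hN2.image f
  have h3 := h2.image f
  rw [hfF] at e1 e2 h3
  rw [hfG] at e1
  have hm : Module.finrank ℝ (vectorSpan ℝ F') = (k + 1) + 1 := hF'.2.2
  have hne3 : f '' G₂ ≠ G₁' := by
    rw [← hfG]
    exact fun he => hne (Set.image_injective.2 f.injective he).symm
  have hsub3 : G₁' ∩ G₂' ⊆ f '' G₂ := by
    rw [← hfR]; exact Set.image_mono Set.inter_subset_right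
  obtain ⟨n₁, hn₁, rfl⟩ := hr'.exists_eq_facet hm h1'
  obtain ⟨n₂, hn₂, rfl⟩ := hr'.exists_eq_facet hm h2'
  obtain ⟨n₃, hn₃, hn3e⟩ := hr'.exists_eq_facet hm h3
  rw [hn3e] at hne3 hsub3 e2
  have h23 : n₂ = n₃ := by
    by_contra h23
    exact hr'.ridge_not_three (m := k) hF'.2.2 hR' hn₁ hn₂ hn₃ (fun h => hne' (by rw [h]))
      (fun h => hne3 (by rw [h])) h23 Set.inter_subset_left Set.inter_subset_right hsub3
  subst h23
  rw [hr'.eq_of_isInnerUnitNormal_facet hn₁ hN1', hr'.eq_of_isInnerUnitNormal_facet hn₂ hN2',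
    ← hr'.eq_of_isInnerUnitNormal_facet hn₁ e1, ← hr'.eq_of_isInnerUnitNormal_facet hn₂ e2,
    LinearIsometryEquiv.inner_map_map]

theorem exists_dimensionwiseEquiangular (hr : IsRep P (⊤ : Submodule ℝ 𝔼[d]) p s b)
    (hcpt : IsCompact P) (hreg : IsRegular P) :
    ∃ α : ℕ → ℝ, IsDimensionwiseEquiangular P α := by
  have hex : ∀ k : ℕ, ∃ a : ℝ, 2 ≤ k → a ∈ Set.Ioo 0 Real.pi ∧ ∀ F G₁ G₂ N₁ N₂,
      RidgeNormals P k F G₁ G₂ N₁ N₂ → inner ℝ N₁ N₂ = Real.cos a := by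
    intro k
    by_cases hk : 2 ≤ k ∧ ∃ F G₁ G₂ N₁ N₂, RidgeNormals P k F G₁ G₂ N₁ N₂
    · obtain ⟨hk, F, G₁, G₂, N₁, N₂, h⟩ := hk
      have hmem := hr.ridgeNormals_inner_mem hk h
      refine ⟨Real.arccos (inner ℝ N₁ N₂), fun _ => ⟨⟨Real.arccos_pos.2 hmem.2,
        Real.arccos_lt_pi.2 hmem.1⟩, fun F' G₁' G₂' N₁' N₂' h' => ?_⟩⟩
      rw [Real.cos_arccos hmem.1.le hmem.2.le]
      exact hr.ridgeNormals_inner_eq hcpt hreg hk h' h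
    · exact ⟨Real.pi / 2, fun h2 => ⟨⟨by linarith [Real.pi_pos], by linarith [Real.pi_pos]⟩,
        fun F G₁ G₂ N₁ N₂ h => absurd ⟨h2, F, G₁, G₂, N₁, N₂, h⟩ hk⟩⟩
  choose α hα using hex
  refine ⟨α, fun k h2 _ => ⟨(hα k h2).1, fun F hF G₁ G₂ h1 h2' hne hR N₁ N₂ hN1 hN2 => ?_⟩⟩
  exact (hα k h2).2 F G₁ G₂ N₁ N₂ ⟨hF, h1, h2', hne, hR, hN1, hN2⟩

end IsRep

/-! ### The equidistant centre and the comparison of coefficients -/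

theorem coeff_eq_of_forall_Icc {n : ℕ} {a c : ℕ → ℝ} {ε : ℝ} (hε : 0 < ε)
    (h : ∀ r ∈ Set.Icc 0 ε, ∑ j ∈ Finset.range (n + 1), a j * r ^ j =
      ∑ j ∈ Finset.range (n + 1), c j * r ^ j) {j : ℕ} (hj : j ≤ n) : a j = c j := by
  set q : Polynomial ℝ := ∑ j ∈ Finset.range (n + 1), Polynomial.C (a j - c j) * Polynomial.X ^ j
    with hq
  have h0 : q = 0 := by
    refine Polynomial.eq_zero_of_infinite_isRoot q ((Set.Icc_infinite hε).mono fun r hr => ?_)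
    have := h r hr
    rw [Set.mem_ofPred_eq, Polynomial.IsRoot.def, hq, Polynomial.eval_finsetSum]
    simp only [Polynomial.eval_mul, Polynomial.eval_C, Polynomial.eval_pow, Polynomial.eval_X,
      sub_mul, Finset.sum_sub_distrib]
    rw [this, sub_self]
  have h1 := congrArg (fun q => q.coeff j) h0
  simp only [hq, Polynomial.finsetSum_coeff, Polynomial.coeff_C_mul_X_pow,
    Polynomial.coeff_zero] at h1
  rw [Finset.sum_ite_eq, if_pos (Finset.mem_range.2 (by omega))] at h1
  linarith

namespace IsRep

variable {P : Set 𝔼[d]} {p : 𝔼[d]} {s : Finset 𝔼[d]} {b : 𝔼[d] → ℝ}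

/-- The symmetries of a polytope fix the centroid of its vertices. -/
theorem map_centroid (hr : IsRep P (⊤ : Submodule ℝ 𝔼[d]) p s b) (hcpt : IsCompact P)
    (f : 𝔼[d] ≃ᵃⁱ[ℝ] 𝔼[d]) (hf : f '' P = P) :
    f ((hr.finite_vertices.toFinset.card : ℝ)⁻¹ • ∑ v ∈ hr.finite_vertices.toFinset, v) =
      (hr.finite_vertices.toFinset.card : ℝ)⁻¹ • ∑ v ∈ hr.finite_vertices.toFinset, v := by
  classical
  set S := hr.finite_vertices.toFinset with hS
  have hSne : S.Nonempty := by
    obtain ⟨v, hv⟩ := hr.exists_vertex hcpt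
    exact ⟨v, by simpa [hS] using hv⟩
  have hcard : (S.card : ℝ) ≠ 0 := by
    rw [Nat.cast_ne_zero]; exact hSne.card_ne_zero
  have himg : S.image f = S := by
    apply Finset.eq_of_subset_of_card_le
    · intro w hw
      obtain ⟨v, hv, rfl⟩ := Finset.mem_image.1 hw
      have hv' : IsFace P 0 {v} := by simpa [hS] using hv
      have := hv'.image f
      rw [hf, Set.image_singleton] at this
      simpa [hS] using this
    · rw [Finset.card_image_of_injective _ f.injective]
  have hval : ∀ x, f x = f.linearIsometryEquiv x + f 0 := by
    intro x
    have := f.map_vadd 0 x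
    simpa using this
  have hsum : ∑ v ∈ S, f v = ∑ v ∈ S, v := by
    conv_rhs => rw [← himg]
    rw [Finset.sum_image (fun a _ c _ h => f.injective h)]
  have hsum2 : ∑ v ∈ S, f v = f.linearIsometryEquiv (∑ v ∈ S, v) + (S.card : ℝ) • f 0 := by
    rw [Finset.sum_congr rfl fun v _ => hval v, Finset.sum_add_distrib, map_sum, Finset.sum_const,
      Nat.cast_smul_eq_nsmul]
  rw [hval, map_smul]
  have : f.linearIsometryEquiv (∑ v ∈ S, v) = ∑ v ∈ S, v - (S.card : ℝ) • f 0 :=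
    eq_sub_of_add_eq (hsum2.symm.trans hsum)
  rw [this, smul_sub, smul_smul, inv_mul_cancel₀ hcard, one_smul, sub_add_cancel]

/-- Some vertex does not lie on a given facet. -/
theorem exists_vertex_lt (hr : IsRep P (⊤ : Submodule ℝ 𝔼[d]) p s b) (hcpt : IsCompact P) {n : 𝔼[d]}
    (hn : n ∈ s) : ∃ v, IsFace P 0 {v} ∧ b n < inner ℝ n v := by
  obtain ⟨x, hx, hmax⟩ := hcpt.exists_isMaxOn ⟨p, hr.base_mem⟩
    (f := fun y => (inner ℝ n y : ℝ)) (by fun_prop)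
  have hF : IsFace P _ {x ∈ P | ∀ y ∈ P, (innerSL ℝ n) y ≤ (innerSL ℝ n) x} :=
    ⟨⟨x, hx, fun y hy => hmax hy⟩, fun _ => ⟨innerSL ℝ n, rfl⟩, rfl⟩
  obtain ⟨v, hv, hvP⟩ := hr.exists_vertex_mem hcpt hF
  exact ⟨v, hvP, (hr.lt n hn).trans_le (hv.2 p hr.base_mem)⟩

/-- A regular polytope has a center that is equally far from all facets. -/
theorem exists_equidistant (hr : IsRep P (⊤ : Submodule ℝ 𝔼[d]) p s b) (hcpt : IsCompact P)
    (hreg : IsRegular P) (hd : 0 < d) :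
    s.Nonempty ∧ ∃ O : 𝔼[d], ∃ g : ℝ, 0 < g ∧ ∀ n ∈ s, inner ℝ n O = b n + g := by
  have hm : Module.finrank ℝ (⊤ : Submodule ℝ 𝔼[d]) = (d - 1) + 1 := by
    rw [finrank_top, finrank_euclideanSpace_fin]; omega
  have hsne : s.Nonempty := by
    have hpos : 0 < Module.finrank ℝ (⊤ : Submodule ℝ 𝔼[d]) := by omega
    obtain ⟨⟨u, hu⟩, hu0⟩ := Module.finrank_pos_iff_exists_ne_zero.1 hpos
    obtain ⟨n, hn, -⟩ := hr.exists_inner_neg hcpt hu fun h0 => hu0 (Subtype.ext h0)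
    exact ⟨n, hn⟩
  refine ⟨hsne, ?_⟩
  set S := hr.finite_vertices.toFinset with hS
  set O : 𝔼[d] := (S.card : ℝ)⁻¹ • ∑ v ∈ S, v with hO
  have hmemS : ∀ v, v ∈ S ↔ IsFace P 0 {v} := fun v => by simp [hS]
  have hpos : ∀ n ∈ s, b n < inner ℝ n O := by
    intro n hn
    obtain ⟨v, hv, hlt⟩ := hr.exists_vertex_lt hcpt hn
    have hvS := (hmemS v).2 hv
    have hcard : 0 < (S.card : ℝ) := by
      rw [Nat.cast_pos]; exact Finset.card_pos.2 ⟨v, hvS⟩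
    rw [hO, inner_smul_right, inner_sum]
    have : ∑ w ∈ S, b n < ∑ w ∈ S, (inner ℝ n w : ℝ) :=
      Finset.sum_lt_sum (fun w hw => hr.le (((hmemS w).1 hw).subset rfl) hn) ⟨v, hvS, hlt⟩
    rw [Finset.sum_const, nsmul_eq_mul] at this
    rw [inv_mul_eq_div, lt_div_iff₀ hcard, mul_comm]
    exact this
  have hconst : ∀ n ∈ s, ∀ n' ∈ s, (inner ℝ n O : ℝ) - b n = inner ℝ n' O - b n' := by
    intro n hn n' hn'
    have hF := hr.isFace_facet hn hm
    have hF' := hr.isFace_facet hn' hm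
    obtain ⟨f, hfP, hf, -, -⟩ := hr.exists_symmetry hcpt hreg le_rfl le_rfl hF hF hF subset_rfl
      subset_rfl hF' hF' hF' subset_rfl subset_rfl
    have hN := (hr.isInnerUnitNormal_facet hn).image f
    rw [hfP, hf] at hN
    have hNn := hr.eq_of_isInnerUnitNormal_facet hn' hN
    obtain ⟨x, hx⟩ := hF.1
    have hfx : f x ∈ facet P b n' := hf ▸ Set.mem_image_of_mem f hx
    have hfO : f O = O := hr.map_centroid hcpt f hfP
    rw [← hx.2, ← hfx.2, ← inner_sub_right, ← inner_sub_right,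
      ← LinearIsometryEquiv.inner_map_map f.linearIsometryEquiv n (O - x), hNn]
    congr 1
    nth_rw 2 [← hfO]
    exact f.map_vsub O x
  obtain ⟨n₀, hn₀⟩ := hsne
  refine ⟨O, (inner ℝ n₀ O : ℝ) - b n₀, sub_pos.2 (hpos n₀ hn₀), fun n hn => ?_⟩
  linarith [hconst n hn n₀ hn₀]

/-- If a larger ball with centre `c` fitted, every normal would be positive on `c - O`, but
boundedness gives each nonzero direction a normal that is negative on it. -/
theorem inradius_eq (hr : IsRep P (⊤ : Submodule ℝ 𝔼[d]) p s b) (hcpt : IsCompact P)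
    (hs : s.Nonempty) {O : 𝔼[d]} {g : ℝ} (hg : 0 < g) (hO : ∀ n ∈ s, inner ℝ n O = b n + g) :
    inradius P = g := by
  refine IsGreatest.csSup_eq ⟨⟨hg, O, fun x hx => ?_⟩, ?_⟩
  · refine (hr.mem_iff x).2 ⟨trivial, fun n hn => ?_⟩
    rw [Metric.mem_closedBall, dist_eq_norm'] at hx
    have := real_inner_le_norm n (O - x)
    rw [hr.norm_eq n hn, one_mul, inner_sub_right, hO n hn] at this
    linarith
  · rintro g' ⟨hg', c, hc⟩
    by_contra hlt
    push Not at hlt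
    have hdist : ∀ n ∈ s, b n + g' ≤ inner ℝ n c := by
      intro n hn
      have hmem : c - g' • n ∈ P := hc (by
        rw [Metric.mem_closedBall, dist_eq_norm, sub_sub_cancel_left, norm_neg, norm_smul,
          hr.norm_eq n hn, mul_one, Real.norm_eq_abs, abs_of_pos hg'])
      have := hr.le hmem hn
      rw [inner_sub_right, inner_smul_right, real_inner_self_eq_norm_sq, hr.norm_eq n hn] at this
      linarith
    have hu : ∀ n ∈ s, 0 < (inner ℝ n (c - O) : ℝ) := by
      intro n hn
      rw [inner_sub_right, hO n hn]
      linarith [hdist n hn]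
    have hne : c - O ≠ 0 := by
      intro h0
      obtain ⟨n, hn⟩ := hs
      have := hu n hn
      rw [h0, inner_zero_right] at this
      exact lt_irrefl _ this
    obtain ⟨n, hn, hneg⟩ := hr.exists_inner_neg hcpt (Submodule.mem_top (x := c - O)) hne
    exact absurd (hu n hn) (not_lt.2 hneg.le)

/-- If all facets have the same distance from `O`, the parallel bodies are homothetic. -/
theorem par_eq_homothety (hr : IsRep P (⊤ : Submodule ℝ 𝔼[d]) p s b) {O : 𝔼[d]} {g : ℝ} (hg : 0 < g)
    (hO : ∀ n ∈ s, inner ℝ n O = b n + g) {r : ℝ} (h0 : 0 ≤ r) (hrg : r < g) :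
    par P r = AffineMap.homothety O (1 - r / g) '' P := by
  have hc : 0 < 1 - r / g := by rw [sub_pos, div_lt_one hg]; exact hrg
  have key : ∀ x, AffineMap.homothety O (1 - r / g) x ∈ par P r ↔ x ∈ P := by
    intro x
    rw [hr.mem_par_iff_of_nonneg h0, hr.mem_iff]
    refine and_congr (by simp) (forall₂_congr fun n hn => ?_)
    rw [AffineMap.homothety_apply, vsub_eq_sub, vadd_eq_add, inner_add_right, inner_smul_right,
      inner_sub_right, hO n hn]
    have : (1 - r / g) * g = g - r := by field_simp
    constructor
    · intro h
      have h1 : (1 - r / g) * b n ≤ (1 - r / g) * inner ℝ n x := by nlinarith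
      exact le_of_mul_le_mul_left h1 hc
    · intro h
      have h1 := mul_le_mul_of_nonneg_left h hc.le
      nlinarith
  ext y
  constructor
  · intro hy
    have hyy : AffineMap.homothety O (1 - r / g) (AffineMap.homothety O (1 - r / g)⁻¹ y) = y := by
      simp only [AffineMap.homothety_apply, vsub_eq_sub, vadd_eq_add, add_sub_cancel_right,
        smul_smul, mul_inv_cancel₀ hc.ne', one_smul, sub_add_cancel]
    refine ⟨AffineMap.homothety O (1 - r / g)⁻¹ y, ?_, hyy⟩
    rw [← key, hyy]; exact hy
  · rintro ⟨x, hx, rfl⟩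
    exact (key x).2 hx

theorem W_eq_of_equidistant (hr : IsRep P (⊤ : Submodule ℝ 𝔼[d]) p s b) {O : 𝔼[d]} {g : ℝ} (hg : 0 < g)
    (hO : ∀ n ∈ s, inner ℝ n O = b n + g) {r : ℝ} (h0 : 0 ≤ r) (hrg : r < g) :
    W P r = (1 - r / g) ^ d * W P 0 := by
  have hc : 0 < 1 - r / g := by rw [sub_pos, div_lt_one hg]; exact hrg
  unfold W
  rw [hr.rInterior_eq_par r, hr.rInterior_eq_par 0, hr.par_zero,
    hr.par_eq_homothety hg hO h0 hrg, ← EuclideanSpace.euclideanHausdorffMeasure_eq_volume,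
    euclideanHausdorffMeasure_homothety_image d O hc.ne', ENNReal.smul_def, smul_eq_mul,
    ENNReal.toReal_mul]
  congr 1
  rw [ENNReal.coe_toReal, NNReal.coe_pow, coe_nnnorm, Real.norm_eq_abs, abs_of_pos hc]

end IsRep

/-- Near `0` the volume function is both the general polynomial and `(1 - r/g)^d * W P 0`. The
identity compares their coefficients in degree `d - k`. -/
theorem IsPolytope.factorial_mul_vol {P : Set 𝔼[d]} (hP : IsPolytope P) (hreg : IsRegular P)
    (α : ℕ → ℝ) (μ : ℕ → ℕ) (hα : IsDimensionwiseEquiangular P α)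
    (hμ : HasConstantIncidence P μ) {k : ℕ} (hk : k < d) :
    (d.factorial : ℝ) * vol d (skeleton P d) =
      (k.factorial : ℝ) * (∏ j ∈ Finset.Ioc k d, (μ j : ℝ)) * vol k (skeleton P k) *
        (∏ j ∈ Finset.Ioc k d, gam d α j) * inradius P ^ (d - k) := by
  obtain ⟨p, s, b, hr⟩ := hP.exists_isRep
  obtain ⟨hs, O, g, hg, hO⟩ := hr.exists_equidistant hP.1 hreg (by omega)
  rw [hr.inradius_eq hP.1 hs hg hO]
  obtain ⟨ε, hε, hW⟩ := hP.volume_rInterior α μ hα hμ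
  set A : ℕ → ℝ := fun k => (∏ j ∈ Finset.Ioc k d, (μ j : ℝ)) * vol k (skeleton P k) *
    (∏ j ∈ Finset.Ioc k d, gam d α j) with hA
  have hcoef : ∀ j ≤ d, (-1 : ℝ) ^ j * A (d - j) / (j.factorial : ℝ) =
      (-1 : ℝ) ^ j * (g⁻¹) ^ j * (d.choose j : ℝ) * W P 0 := by
    intro j hj
    -- The bound `g / 2` ensures `r < g`, so that the homothety has positive ratio.
    refine coeff_eq_of_forall_Icc (n := d) (ε := min ε (g / 2)) (lt_min hε (by linarith))
      (a := fun j => (-1 : ℝ) ^ j * A (d - j) / (j.factorial : ℝ))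
      (c := fun j => (-1 : ℝ) ^ j * (g⁻¹) ^ j * (d.choose j : ℝ) * W P 0) (fun r hrm => ?_) hj
    have h1 := hW r ⟨hrm.1, hrm.2.trans (min_le_left _ _)⟩
    have h2 : r < g := by
      have := hrm.2.trans (min_le_right _ _)
      linarith
    rw [hr.W_eq_of_equidistant hg hO hrm.1 h2, ← Finset.sum_flip] at h1
    have e1 : (1 - r / g) ^ d * W P 0 = ∑ j ∈ Finset.range (d + 1),
        ((-1 : ℝ) ^ j * (g⁻¹) ^ j * (d.choose j : ℝ) * W P 0) * r ^ j := by
      rw [sub_eq_neg_add, add_pow, Finset.sum_mul]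
      refine Finset.sum_congr rfl fun j _ => ?_
      rw [one_pow, neg_pow, div_eq_inv_mul, mul_pow]; ring
    rw [← e1, h1]
    refine Finset.sum_congr rfl fun j hj => ?_
    rw [Nat.sub_sub_self (Nat.lt_succ_iff.1 (Finset.mem_range.1 hj))]
    simp only [hA]
    ring
  have htop : vol d (skeleton P d) = W P 0 := by
    have := hcoef 0 (Nat.zero_le _)
    simpa [hA] using this
  have h1 := hcoef (d - k) (by omega)
  rw [Nat.sub_sub_self hk.le, Nat.choose_symm hk.le] at h1
  have hsign : (-1 : ℝ) ^ (d - k) ≠ 0 := pow_ne_zero _ (by norm_num)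
  have hch : (d.choose k : ℝ) * (k.factorial : ℝ) * ((d - k).factorial : ℝ) = d.factorial := by
    exact_mod_cast Nat.choose_mul_factorial_mul_factorial hk.le
  have hf : ((d - k).factorial : ℝ) ≠ 0 := by positivity
  have h2 : A k = (g⁻¹) ^ (d - k) * (d.choose k : ℝ) * W P 0 * ((d - k).factorial : ℝ) := by
    rw [div_eq_iff hf] at h1
    apply mul_left_cancel₀ hsign
    rw [h1]; ring
  have h3 : (g⁻¹) ^ (d - k) * g ^ (d - k) = 1 := by
    rw [← mul_pow, inv_mul_cancel₀ hg.ne', one_pow]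
  rw [htop, mul_assoc (k.factorial : ℝ), mul_assoc (k.factorial : ℝ)]
  change _ = (k.factorial : ℝ) * A k * g ^ (d - k)
  rw [h2, ← hch]
  linear_combination (-(d.choose k : ℝ) * (k.factorial : ℝ) * ((d - k).factorial : ℝ) * W P 0) * h3

end EuclPolytope

theorem mainTheorem5 {d : ℕ} (P : Set (EuclideanSpace ℝ (Fin d)))
    (hP : EuclPolytope.IsPolytope P) :
    (∀ (α : ℕ → ℝ) (μ : ℕ → ℕ), EuclPolytope.IsDimensionwiseEquiangular P α →
      EuclPolytope.HasConstantIncidence P μ →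
      ∃ ε : ℝ, 0 < ε ∧ ∀ r ∈ Set.Icc 0 ε,
        EuclPolytope.W P r =
          ∑ k ∈ Finset.range (d + 1),
            (-1 : ℝ) ^ (d - k) * (∏ j ∈ Finset.Ioc k d, (μ j : ℝ)) *
              EuclPolytope.vol k (EuclPolytope.skeleton P k) *
              (∏ j ∈ Finset.Ioc k d, EuclPolytope.gam d α j) *
              (r ^ (d - k) / ((d - k).factorial : ℝ))) ∧
    (EuclPolytope.IsRegular P →
      (∃ α : ℕ → ℝ, EuclPolytope.IsDimensionwiseEquiangular P α) ∧
      (∃ μ : ℕ → ℕ, EuclPolytope.HasConstantIncidence P μ) ∧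
      ∀ (α : ℕ → ℝ) (μ : ℕ → ℕ), EuclPolytope.IsDimensionwiseEquiangular P α →
        EuclPolytope.HasConstantIncidence P μ →
        ∀ k : ℕ, k < d →
          (d.factorial : ℝ) * EuclPolytope.vol d (EuclPolytope.skeleton P d) =
            (k.factorial : ℝ) * (∏ j ∈ Finset.Ioc k d, (μ j : ℝ)) *
              EuclPolytope.vol k (EuclPolytope.skeleton P k) *
              (∏ j ∈ Finset.Ioc k d, EuclPolytope.gam d α j) *
              EuclPolytope.inradius P ^ (d - k)) := by
  obtain ⟨p, s, b, hr⟩ := hP.exists_isRep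
  exact ⟨fun α μ hα hμ => hP.volume_rInterior α μ hα hμ, fun hreg =>
    ⟨hr.exists_dimensionwiseEquiangular hP.1 hreg, hr.exists_constantIncidence hP.1 hreg,
      fun α μ hα hμ k hk => hP.factorial_mul_vol hreg α μ hα hμ hk⟩⟩
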